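/- Let $\tau\in i\mathbb{R}_{>0}$, $q=e^{2\pi i\tau}\in(0,1)$, and write $q^x:=e^{2\pi i\tau x}$ for $x\in\mathbb{C}$. Let $s\in\mathbb{Q}_{>0}$ and $\kappa,\lambda,\upsilon,\varsigma\in\mathbb{R}$, and put $$(a,b,c,d)=\big(q^{\kappa+\lambda},-q^{\kappa-\lambda},q^{\frac s2+\upsilon+\varsigma},-q^{\frac s2+\upsilon-\varsigma}\big),\qquad (\tilde a,\tilde b,\tilde c,\tilde d)=\big(q^{\kappa+\upsilon},-q^{\kappa-\upsilon},q^{\frac s2+\lambda+\varsigma},-q^{\frac s2+\lambda-\varsigma}\big).$$ Write $(u;p)_r=\prod_{i=0}^{r-1}(1-up^i)$ for $r\in\mathbb{Z}_{\ge0}\cup\{\infty\}$ and $(u_1,\dots,u_m;p)_r=\prod_j(u_j;p)_r$, and let $${}_8W_7(\alpha_0;\alpha_1,\dots,\alpha_5;p,y)=\sum_{r=0}^\infty\frac{1-\alpha_0p^{2r}}{1-\alpha_0}\,y^r\prod_{j=0}^5\frac{(\alpha_j;p)_r}{(p\alpha_0/\alpha_j;p)_r}.$$ Define the Askey--Wilson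 second order difference operator by $$(\mathcal{D}f)(x)=A(x)\big(f(x+s)-f(x)\big)+A(-x)\big(f(x-s)-f(x)\big),\qquad A(x)=\frac{(1-aq^x)(1-bq^x)(1-cq^x)(1-dq^x)}{\tilde a(1-q^{2x})(1-q^{s+2x})},$$ and put $W(x,z)=q^{(\kappa+\lambda+x)(\kappa+\upsilon+z)/s}$, $$\mathrm{St}(x)=\Big(\tfrac{q^{s+x}}{a},\tfrac{q^{s+x}}{b},\tfrac{q^{s+x}}{c},\tfrac{q^{s+x}}{d};q^s\Big)_\infty,\qquad \mathrm{St}^d(z)=\Big(\tfrac{q^{s+z}}{\tilde a},\tfrac{q^{s+z}}{\tilde b},\tfrac{q^{s+z}}{\tilde c},\tfrac{q^{s+z}}{\tilde d};q^s\Big)_\infty.$$ Then there exist unique holomorphic functions $\Gamma_r$ on $\mathbb{C}$ ($r\ge0$) satisfying the following three conditions: 1. $\Gamma_0(z)=(q^{s+2z};q^s)_\infty$. 2. The series $\Psi(x,z)=\sum_{r=0}^\infty\Gamma_r(z)q^{rx}$ is normally convergent on compacta of $(x,z)\in\mathbb{C}\times\mathbb{C}$ (consequently $\Psi$ is holomorphic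 on $\mathbb{C}\times\mathbb{C}$). 3. The meromorphic function $\Phi(x,z)=\dfrac{W(x,z)}{\mathrm{St}(x)\,\mathrm{St}^d(z)}\Psi(x,z)$ satisfies $$\big((\mathcal{D}_x-q^z-q^{-z}+\tilde a+\tilde a^{-1})\Phi\big)(x,z)=0$$ (as an identity of meromorphic functions, i.e. at all points at which no denominator in the formula vanishes), where $\mathcal{D}_x$ is $\mathcal{D}$ acting on the $x$-variable. Furthermore, each $\Gamma_r$ is $\tau^{-1}$-translation invariant, i.e. $\Gamma_r(z+\tau^{-1})=\Gamma_r(z)$, and for all $x,z\in\mathbb{C}$ with $|dq^x|<1$ for which no denominator on the right-hand side vanishes, the ${}_8W_7$ series below converges absolutely and $$\Psi(x,z)=\frac{\Big(\frac{q^{s+x+z}a}{\tilde a},\frac{q^{s+x+z}b}{\tilde a},\frac{q^{s+x+z}c}{\tilde a},\frac{q^{s+x+z}\tilde a}{d},q^{s+2z},dq^x;q^s\Big)_\infty}{\Big(\frac{q^{2s+x+2z}}{d};q^s\Big)_\infty}\;{}_8W_7\Big(\tfrac{q^{s+x+2z}}{d};\tfrac{q^{s+z}}{\tilde a},\tfrac{q^{s+z}}{\tilde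 d},\tilde bq^z,\tilde cq^z,\tfrac{q^{s+x}}{d};q^s,dq^x\Big).$$ -/

import Mathlib

namespace AskeyWilson

/-- The four (real) Hecke parameters `κ, λ, υ, ς`. -/
structure HeckeParams where
  kappa : ℝ
  lam : ℝ
  upsilon : ℝ
  varsigma : ℝ

/-- The dual Hecke parameters: the roles of `λ` and `υ` are interchanged. -/
def HeckeParams.dual (h : HeckeParams) : HeckeParams where
  kappa := h.kappa
  lam := h.upsilon
  upsilon := h.lam
  varsigma := h.varsigma

/-- `q ^ x = exp (2 π i τ x)`, where `q = exp (2 π i τ)`. -/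
noncomputable def qpow (τ x : ℂ) : ℂ :=
  Complex.exp (2 * (Real.pi : ℂ) * Complex.I * τ * x)

/-- The finite `q`-shifted factorial `(a; p)_n`. -/
noncomputable def qPoch (a p : ℂ) (n : ℕ) : ℂ :=
  ∏ i ∈ Finset.range n, (1 - a * p ^ i)

/-- The infinite `q`-shifted factorial `(a; p)_∞`, for `|p| < 1`. -/
noncomputable def qPochInf (a p : ℂ) : ℂ :=
  ∏' i : ℕ, (1 - a * p ^ i)

/-- The `r`-th term of the very-well-poised series
`₈W₇(α₀; α₁, α₂, α₃, α₄, α₅; p, y)`. -/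
noncomputable def W87Term (α : Fin 6 → ℂ) (p y : ℂ) (r : ℕ) : ℂ :=
  (1 - α 0 * p ^ (2 * r)) / (1 - α 0) * y ^ r *
    ∏ j : Fin 6, qPoch (α j) p r / qPoch (p * α 0 / α j) p r

/-- The very-well-poised series `₈W₇(α₀; α₁, α₂, α₃, α₄, α₅; p, y)`. -/
noncomputable def W87 (α : Fin 6 → ℂ) (p y : ℂ) : ℂ :=
  ∑' r : ℕ, W87Term α p y r

/-- No denominator vanishes in any term of the series `₈W₇(α₀; α₁, …, α₅; p, y)`. -/
def W87Defined (α : Fin 6 → ℂ) (p : ℂ) : Prop :=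
  1 - α 0 ≠ 0 ∧ ∀ (j : Fin 6) (r : ℕ), qPoch (p * α 0 / α j) p r ≠ 0

/-! The Askey--Wilson parameters `a_s, b_s, c_s, d_s`.  The dual parameters are obtained by
applying these definitions to `h.dual`. -/

noncomputable def parA (τ : ℂ) (h : HeckeParams) : ℂ :=
  qpow τ ((h.kappa : ℂ) + h.lam)

noncomputable def parB (τ : ℂ) (h : HeckeParams) : ℂ :=
  -qpow τ ((h.kappa : ℂ) - h.lam)

noncomputable def parC (τ : ℂ) (s : ℝ) (h : HeckeParams) : ℂ :=
  qpow τ ((s : ℂ) / 2 + h.upsilon + h.varsigma)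

noncomputable def parD (τ : ℂ) (s : ℝ) (h : HeckeParams) : ℂ :=
  -qpow τ ((s : ℂ) / 2 + h.upsilon - h.varsigma)

/-- The coefficient `A(x)` of the Askey--Wilson operator. -/
noncomputable def coeffA (τ : ℂ) (s : ℝ) (h : HeckeParams) (x : ℂ) : ℂ :=
  (1 - parA τ h * qpow τ x) * (1 - parB τ h * qpow τ x) *
      (1 - parC τ s h * qpow τ x) * (1 - parD τ s h * qpow τ x) /
    (parA τ h.dual * (1 - qpow τ (2 * x)) * (1 - qpow τ (s + 2 * x)))

/-- The Askey--Wilson second order difference operator `𝓓` with step size `s`. -/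
noncomputable def opD (τ : ℂ) (s : ℝ) (h : HeckeParams) (f : ℂ → ℂ) (x : ℂ) : ℂ :=
  coeffA τ s h x * (f (x + s) - f x) + coeffA τ s h (-x) * (f (x - s) - f x)

/-- `W(x,z) = q ^ ((κ + λ + x) (κ + υ + z) / s)`. -/
noncomputable def gaugeW (τ : ℂ) (s : ℝ) (h : HeckeParams) (x z : ℂ) : ℂ :=
  qpow τ (((h.kappa : ℂ) + h.lam + x) * ((h.kappa : ℂ) + h.upsilon + z) / s)

/-- The singular term
`St(x) = (q^{s+x}/a_s, q^{s+x}/b_s, q^{s+x}/c_s, q^{s+x}/d_s; q^s)_∞`. -/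
noncomputable def St (τ : ℂ) (s : ℝ) (h : HeckeParams) (x : ℂ) : ℂ :=
  qPochInf (qpow τ (s + x) / parA τ h) (qpow τ s) *
    qPochInf (qpow τ (s + x) / parB τ h) (qpow τ s) *
    qPochInf (qpow τ (s + x) / parC τ s h) (qpow τ s) *
    qPochInf (qpow τ (s + x) / parD τ s h) (qpow τ s)

/-- The power series `Ψ(x,z) = ∑ Γ_r(z) q^{rx}` attached to a sequence of functions `Γ_r`. -/
noncomputable def seriesPsi (τ : ℂ) (Γ : ℕ → ℂ → ℂ) (x z : ℂ) : ℂ :=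
  ∑' r : ℕ, Γ r z * qpow τ (r * x)

/-- `Φ(x,z) = W(x,z) Ψ(x,z) / (St(x) St^d(z))`. -/
noncomputable def seriesPhi (τ : ℂ) (s : ℝ) (h : HeckeParams) (Γ : ℕ → ℂ → ℂ) (x z : ℂ) : ℂ :=
  gaugeW τ s h x z / (St τ s h x * St τ s h.dual z) * seriesPsi τ Γ x z

/-- Normal convergence of a series of functions on compacta of `ℂ × ℂ` : on each compact set,
the series of sup-norms converges. -/
def NormallyConvergentOnCompacta (F : ℕ → ℂ × ℂ → ℂ) : Prop :=
  ∀ K : Set (ℂ × ℂ), IsCompact K →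
    ∃ u : ℕ → ℝ, Summable u ∧ ∀ r : ℕ, ∀ p ∈ K, ‖F r p‖ ≤ u r

/-- No denominator vanishes in `(𝓓_x Φ)(x,z)`: neither those of `A(x)` and `A(-x)`, nor those of
`Φ` at `(x,z)`, `(x+s,z)` and `(x-s,z)`. -/
def RegularPoint (τ : ℂ) (s : ℝ) (h : HeckeParams) (x z : ℂ) : Prop :=
  qpow τ (2 * x) ≠ 1 ∧ qpow τ (s + 2 * x) ≠ 1 ∧
    qpow τ (2 * -x) ≠ 1 ∧ qpow τ (s + 2 * -x) ≠ 1 ∧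
    St τ s h x ≠ 0 ∧ St τ s h (x + s) ≠ 0 ∧ St τ s h (x - s) ≠ 0 ∧ St τ s h.dual z ≠ 0

/-- `Γ_r` (`r ≥ 0`) are holomorphic functions on `ℂ` that satisfy
(1) `Γ_0(z) = (q^{s+2z}; q^s)_∞`,
(2) `∑ Γ_r(z) q^{rx}` is normally convergent on compacta of `ℂ × ℂ`,
(3) `(𝓓_x - q^z - q^{-z} + ã + ã⁻¹) Φ = 0` as an identity between meromorphic functions, i.e.
at all points at which no denominator vanishes. -/
structure IsAsymptoticSolution (τ : ℂ) (s : ℝ) (h : HeckeParams) (Γ : ℕ → ℂ → ℂ) : Prop where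
  holomorphic : ∀ r : ℕ, Differentiable ℂ (Γ r)
  initial : ∀ z : ℂ, Γ 0 z = qPochInf (qpow τ (s + 2 * z)) (qpow τ s)
  normal : NormallyConvergentOnCompacta fun r p => Γ r p.2 * qpow τ (r * p.1)
  eigen : ∀ x z : ℂ, RegularPoint τ s h x z →
    opD τ s h (fun y => seriesPhi τ s h Γ y z) x +
      (-qpow τ z - qpow τ (-z) + parA τ h.dual + (parA τ h.dual)⁻¹) *
        seriesPhi τ s h Γ x z = 0

/-- The parameters
`q^{s+x+2z}/d_s; q^{s+z}/ã_s, q^{s+z}/d̃_s, b̃_s q^z, c̃_s q^z, q^{s+x}/d_s`. -/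
noncomputable def psiParams (τ : ℂ) (s : ℝ) (h : HeckeParams) (x z : ℂ) : Fin 6 → ℂ :=
  ![qpow τ (s + x + 2 * z) / parD τ s h,
    qpow τ (s + z) / parA τ h.dual,
    qpow τ (s + z) / parD τ s h.dual,
    parB τ h.dual * qpow τ z,
    parC τ s h.dual * qpow τ z,
    qpow τ (s + x) / parD τ s h]

/-- The product of infinite `q^s`-shifted factorials in front of the `₈W₇` series for `Ψ`. -/
noncomputable def psiPrefactor (τ : ℂ) (s : ℝ) (h : HeckeParams) (x z : ℂ) : ℂ :=
  qPochInf (qpow τ (s + x + z) * parA τ h / parA τ h.dual) (qpow τ s) *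
    qPochInf (qpow τ (s + x + z) * parB τ h / parA τ h.dual) (qpow τ s) *
    qPochInf (qpow τ (s + x + z) * parC τ s h / parA τ h.dual) (qpow τ s) *
    qPochInf (qpow τ (s + x + z) * parA τ h.dual / parD τ s h) (qpow τ s) *
    qPochInf (qpow τ (s + 2 * z)) (qpow τ s) *
    qPochInf (parD τ s h * qpow τ x) (qpow τ s) /
  qPochInf (qpow τ (2 * s + x + 2 * z) / parD τ s h) (qpow τ s)

end AskeyWilson

/-! ### Shifted factorials: functional equation, bounds, holomorphy -/

namespace AskeyWilson

open Filter Topology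

/-! Write `X = q^x`, `Z = q^z`, `p = q^s`, `t = ã`. Conjugating the eigenvalue equation by
`W/(St·St^d)` and clearing denominators (`eigen_eq_gaugedLHS`) gives a difference equation with
polynomial coefficients in `X`, `Z Q(X) Ψ(pX) + Z⁻¹ (1 - pX²) Ψ(X/p) + mid(X) Ψ(X) = 0`.

On coefficients this is a recursion whose diagonal factor is `Z⁻¹ p⁻ⁿ (1 - pⁿ)(1 - pⁿZ²)`
(`coeff_op`). It vanishes for `n > 0` only at the resonances `pⁿZ² = 1`, so the initial coefficient
determines all the others, by continuation in `z` also at resonances. The prescribed `Γ_0 =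
(pZ²;p)_∞` contains every resonant factor, so each `Γ_n` is holomorphic, and periodic because it
depends on `z` only through `Z` (`op_G`, `IsAsymptoticSolution.eq_G`).

Convergence for all `X` needs more. The recursion gives a geometric bound, hence some positive
radius. Solving the equation for `Ψ(X/p)` then enlarges a disc by the factor `1/|p|`, provided that
the division by `1 - pX²` creates no pole. The roots are `±r⁻¹` with `r² = p`, and there the
numerator vanishes: the equation at `X = ±r` and the identity `Q(r⁻¹)(1 - p²) = K(r)K(r⁻¹)` force it
(`hasEval_rhs_zero`). Iterating with estimates uniform for `Z` in compacta of `ℂ \ {0}` gives normal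
convergence (`bootstrap`, `exists_entire_bound`).

For the explicit formula, the `₈W₇` series times its prefactor and `(wXZ²;p)_∞`, with `w = p/d`, is
a series of functions entire in `X`, convergent for `|dX| < 1`. Divided by `(wXZ²;p)_∞` it solves
the same difference equation near `X = 0`, by a creative telescoping identity (`certificate`,
`regSum_equation`), and it has the same value at `X = 0`. Formal uniqueness identifies the two near
`0`, and the identity theorem extends this to the disc (`tsum_G_mul_qPochInf`). Well-definedness of
the `₈W₇` excludes the resonances, since `(pZ²;p)_r` is one of its denominators. -/

theorem summable_norm_mul_pow (a : ℂ) {p : ℂ} (hp : ‖p‖ < 1) :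
    Summable fun i : ℕ => ‖-(a * p ^ i)‖ := by
  simpa using (summable_geometric_of_lt_one (norm_nonneg p) hp).mul_left ‖a‖

theorem multipliable_qPochInf (a : ℂ) {p : ℂ} (hp : ‖p‖ < 1) :
    Multipliable fun i : ℕ => 1 - a * p ^ i := by
  simpa [sub_eq_add_neg] using multipliable_one_add_of_summable (summable_norm_mul_pow a hp)

theorem qPoch_zero (a p : ℂ) : qPoch a p 0 = 1 := by simp [qPoch]

theorem qPoch_succ (a p : ℂ) (n : ℕ) : qPoch a p (n + 1) = qPoch a p n * (1 - a * p ^ n) := by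
  simp [qPoch, Finset.prod_range_succ]

theorem qPoch_succ' (a p : ℂ) (n : ℕ) : qPoch a p (n + 1) = (1 - a) * qPoch (a * p) p n := by
  simp [qPoch, Finset.prod_range_succ', pow_succ', mul_assoc, mul_comm]

theorem tendsto_qPoch (a : ℂ) {p : ℂ} (hp : ‖p‖ < 1) :
    Tendsto (qPoch a p) atTop (𝓝 (qPochInf a p)) :=
  (multipliable_qPochInf a hp).hasProd.tendsto_prod_nat

theorem qPochInf_eq_one_sub_mul (a : ℂ) {p : ℂ} (hp : ‖p‖ < 1) :
    qPochInf a p = (1 - a) * qPochInf (a * p) p := by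
  refine tendsto_nhds_unique ((tendsto_qPoch a hp).comp (tendsto_add_atTop_nat 1)) ?_
  refine ((tendsto_qPoch (a * p) hp).const_mul (1 - a)).congr fun n => ?_
  simp [qPoch_succ']

theorem qPochInf_eq_qPoch_mul (a : ℂ) {p : ℂ} (hp : ‖p‖ < 1) (n : ℕ) :
    qPochInf a p = qPoch a p n * qPochInf (a * p ^ n) p := by
  induction n with
  | zero => simp [qPoch_zero]
  | succ n ih =>
    rw [ih, qPochInf_eq_one_sub_mul _ hp, qPoch_succ, pow_succ]
    ring_nf

theorem qPochInf_zero (p : ℂ) : qPochInf 0 p = 1 := by simp [qPochInf]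

theorem qPochInf_ne_zero {a p : ℂ} (hp : ‖p‖ < 1) (h : ∀ i : ℕ, 1 - a * p ^ i ≠ 0) :
    qPochInf a p ≠ 0 := by
  have := tprod_one_add_ne_zero_of_summable (f := fun i : ℕ => -(a * p ^ i))
    (by simpa [sub_eq_add_neg] using h) (summable_norm_mul_pow a hp)
  simpa [qPochInf, sub_eq_add_neg] using this

theorem qPochInf_ne_zero_of_norm_lt {a p : ℂ} (hp : ‖p‖ < 1) (ha : ‖a‖ < 1) :
    qPochInf a p ≠ 0 := by
  refine qPochInf_ne_zero hp fun i h => ?_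
  have h1 : ‖a * p ^ i‖ < 1 := by
    rw [norm_mul, norm_pow]
    exact (mul_le_of_le_one_right (norm_nonneg a) (pow_le_one₀ (norm_nonneg p) hp.le)).trans_lt ha
  rw [← sub_eq_zero.1 h] at h1
  simp at h1

theorem norm_qPoch_le (a : ℂ) {p : ℂ} (hp : ‖p‖ < 1) (n : ℕ) :
    ‖qPoch a p n‖ ≤ Real.exp (‖a‖ / (1 - ‖p‖)) := by
  have h1 : ‖qPoch a p n‖ ≤ ∏ i ∈ Finset.range n, Real.exp (‖a‖ * ‖p‖ ^ i) := by
    rw [qPoch, norm_prod]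
    refine Finset.prod_le_prod (fun _ _ => norm_nonneg _) fun i _ => ?_
    calc ‖1 - a * p ^ i‖ ≤ ‖(1 : ℂ)‖ + ‖a * p ^ i‖ := norm_sub_le _ _
      _ = ‖a‖ * ‖p‖ ^ i + 1 := by simp [add_comm]
      _ ≤ _ := Real.add_one_le_exp _
  refine h1.trans ?_
  rw [← Real.exp_sum, ← Finset.mul_sum, div_eq_mul_inv]
  refine Real.exp_le_exp.2 (mul_le_mul_of_nonneg_left ?_ (norm_nonneg a))
  rw [← tsum_geometric_of_lt_one (norm_nonneg p) hp]
  exact (summable_geometric_of_lt_one (norm_nonneg p) hp).sum_le_tsum _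
    fun i _ => by positivity

theorem norm_qPoch_le_of_le {a p : ℂ} {R : ℝ} (hp : ‖p‖ < 1) (ha : ‖a‖ ≤ R) (n : ℕ) :
    ‖qPoch a p n‖ ≤ Real.exp (R / (1 - ‖p‖)) := by
  refine (norm_qPoch_le a hp n).trans (Real.exp_le_exp.2 ?_)
  have : 0 < 1 - ‖p‖ := by linarith
  gcongr

theorem norm_qPochInf_le_of_le {a p : ℂ} {R : ℝ} (hp : ‖p‖ < 1) (ha : ‖a‖ ≤ R) :
    ‖qPochInf a p‖ ≤ Real.exp (R / (1 - ‖p‖)) :=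
  le_of_tendsto (tendsto_qPoch a hp).norm (Eventually.of_forall (norm_qPoch_le_of_le hp ha))

theorem differentiable_qPoch (p : ℂ) (n : ℕ) : Differentiable ℂ fun a => qPoch a p n := by
  unfold qPoch
  fun_prop

theorem differentiable_qPochInf {p : ℂ} (hp : ‖p‖ < 1) :
    Differentiable ℂ fun a => qPochInf a p := by
  intro a
  have hloc : HasProdLocallyUniformlyOn (fun (i : ℕ) (x : ℂ) => 1 + -(x * p ^ i))
      (fun x => ∏' i : ℕ, (1 + -(x * p ^ i))) (Metric.ball (0 : ℂ) (‖a‖ + 1)) := by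
    refine Summable.hasProdLocallyUniformlyOn_nat_one_add Metric.isOpen_ball
      (u := fun i : ℕ => (‖a‖ + 1) * ‖p‖ ^ i)
      ((summable_geometric_of_lt_one (norm_nonneg p) hp).mul_left _)
      (Eventually.of_forall fun n x hx => ?_) fun i => by fun_prop
    rw [norm_neg, norm_mul, norm_pow]
    have : ‖x‖ ≤ ‖a‖ + 1 := by simpa using (Metric.mem_ball.1 hx).le
    gcongr
  have hd := hloc.differentiableOn (Eventually.of_forall fun s => by
    simpa [Finset.prod_fn] using DifferentiableOn.finsetProd (fun _ _ => by fun_prop))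
    Metric.isOpen_ball
  have := hd.differentiableAt (Metric.isOpen_ball.mem_nhds (x := a) (by simp))
  simpa [qPochInf, sub_eq_add_neg] using this

end AskeyWilson

/-! ### Evaluation of formal power series and weighted coefficient bounds -/

namespace AskeyWilson

open Filter Topology Polynomial

/-- The power series `f` converges at `x` to the value `a`. -/
def HasEval (f : PowerSeries ℂ) (x a : ℂ) : Prop :=
  HasSum (fun n => PowerSeries.coeff n f * x ^ n) a

theorem HasEval.add {f g : PowerSeries ℂ} {x a b : ℂ} (hf : HasEval f x a) (hg : HasEval g x b) :
    HasEval (f + g) x (a + b) := by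
  simpa [HasEval, add_mul] using HasSum.add hf hg

theorem HasEval.neg {f : PowerSeries ℂ} {x a : ℂ} (hf : HasEval f x a) :
    HasEval (-f) x (-a) := by
  simpa [HasEval] using HasSum.neg hf

theorem HasEval.X_mul {f : PowerSeries ℂ} {x a : ℂ} (hf : HasEval f x a) :
    HasEval (PowerSeries.X * f) x (x * a) := by
  unfold HasEval at *
  rw [← hasSum_nat_add_iff' 1]
  simp only [PowerSeries.coeff_succ_X_mul, Finset.range_one, Finset.sum_singleton,
    PowerSeries.coeff_zero_X_mul, zero_mul, sub_zero]
  exact (hf.mul_left x).congr_fun fun n => by ring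

theorem HasEval.polynomial_mul {f : PowerSeries ℂ} {x a : ℂ} (hf : HasEval f x a) (Q : ℂ[X]) :
    HasEval ((Q : PowerSeries ℂ) * f) x (Q.eval x * a) := by
  induction Q using Polynomial.induction_on with
  | C c => simpa [HasEval, mul_assoc] using HasSum.mul_left c hf
  | add P Q hP hQ => simpa [add_mul] using hP.add hQ
  | monomial n c ih =>
    have h := ih.X_mul
    have e1 : ((C c * X ^ (n + 1) : ℂ[X]) : PowerSeries ℂ) * f =
        PowerSeries.X * (((C c * X ^ n : ℂ[X]) : PowerSeries ℂ) * f) := by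
      simp only [Polynomial.coe_mul, Polynomial.coe_C, Polynomial.coe_pow, Polynomial.coe_X]
      ring
    have e2 : (C c * X ^ (n + 1) : ℂ[X]).eval x * a = x * ((C c * X ^ n : ℂ[X]).eval x * a) := by
      simp; ring
    rw [e1, e2]
    exact h

theorem hasEval_rescale {f : PowerSeries ℂ} {c x a : ℂ} :
    HasEval (PowerSeries.rescale c f) x a ↔ HasEval f (c * x) a := by
  simp only [HasEval, PowerSeries.coeff_rescale]
  have : (fun n => c ^ n * PowerSeries.coeff n f * x ^ n) =
      fun n => PowerSeries.coeff n f * (c * x) ^ n := by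
    funext n; ring
  rw [this]

theorem hasEval_of_norm_mul_pow_le {f : PowerSeries ℂ} {σ A : ℝ} {x : ℂ}
    (h : ∀ n, ‖PowerSeries.coeff n f‖ * σ ^ n ≤ A) (hx : ‖x‖ < σ) :
    ∃ a, HasEval f x a := by
  have hσ : 0 < σ := (norm_nonneg x).trans_lt hx
  refine (Summable.of_norm_bounded (g := fun n => A * (‖x‖ / σ) ^ n)
    ((summable_geometric_of_lt_one (by positivity) ((div_lt_one hσ).2 hx)).mul_left A)
    fun n => ?_)
  rw [norm_mul, norm_pow, div_pow, ← mul_div_assoc, le_div_iff₀ (by positivity)]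
  have := mul_le_mul_of_nonneg_right (h n) (pow_nonneg (norm_nonneg x) n)
  linarith

/-- Only a punctured neighbourhood is assumed because `q^x` never takes the value `0`; continuity of
the sum supplies the missing point. -/
theorem eq_zero_of_eventually_hasEval {f : PowerSeries ℂ}
    (h : ∀ᶠ x in 𝓝[≠] (0 : ℂ), HasEval f x 0) : f = 0 := by
  -- The value at `0` must be the constant term for `g` to be the sum of the series; that it is `0`
  -- is proved afterwards.
  set g : ℂ → ℂ := fun x => if x = 0 then PowerSeries.coeff 0 f else 0 with hg
  set q : FormalMultilinearSeries ℂ ℂ ℂ :=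
    FormalMultilinearSeries.ofScalars ℂ fun n => PowerSeries.coeff n f with hq
  have hc : ∀ n, q.coeff n = PowerSeries.coeff n f := by
    intro n; simp [hq, FormalMultilinearSeries.coeff_ofScalars]
  have h1 : HasFPowerSeriesAt g q 0 := by
    rw [hasFPowerSeriesAt_iff]
    rw [eventually_nhdsWithin_iff] at h
    filter_upwards [h] with x hx
    by_cases h0 : x = 0
    · subst h0
      have := hasSum_single (f := fun n => (0 : ℂ) ^ n • q.coeff n) 0
        (fun n hn => by simp [hn])
      simpa [hg, hc] using this
    · have := hx h0
      simpa [hg, h0, hc, HasEval, mul_comm] using this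
  have h2 : g 0 = 0 := by
    have t1 : Tendsto g (𝓝[≠] 0) (𝓝 (g 0)) := h1.continuousAt.tendsto.mono_left nhdsWithin_le_nhds
    have t2 : Tendsto g (𝓝[≠] 0) (𝓝 0) := by
      refine tendsto_const_nhds.congr' ?_
      filter_upwards [self_mem_nhdsWithin] with x hx
      have hx' : x ≠ 0 := hx
      simp [hg, hx']
    exact tendsto_nhds_unique t1 t2
  have h3 : g = 0 := by
    funext x
    by_cases h0 : x = 0
    · rw [h0, h2]; rfl
    · simp [hg, h0]
  rw [h3] at h1
  have h4 := h1.eq_zero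
  ext n
  rw [← hc, h4]
  simp [FormalMultilinearSeries.coeff]

/-- The weighted `ℓ¹`-norm of the coefficients of a polynomial. -/
noncomputable def weightedNorm (σ : ℝ) (Q : ℂ[X]) : ℝ :=
  ∑ k ∈ Finset.range (Q.natDegree + 1), ‖Q.coeff k‖ * σ ^ k

theorem weightedNorm_nonneg {σ : ℝ} (hσ : 0 ≤ σ) (Q : ℂ[X]) : 0 ≤ weightedNorm σ Q :=
  Finset.sum_nonneg fun _ _ => by positivity

theorem sum_range_coeff_le_weightedNorm {σ : ℝ} (hσ : 0 ≤ σ) (Q : ℂ[X]) (n : ℕ) :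
    ∑ k ∈ Finset.range n, ‖Q.coeff k‖ * σ ^ k ≤ weightedNorm σ Q := by
  rw [weightedNorm]
  rcases le_total n (Q.natDegree + 1) with hn | hn
  · exact Finset.sum_le_sum_of_subset_of_nonneg (Finset.range_mono hn) fun _ _ _ => by positivity
  · refine (Finset.sum_subset (Finset.range_mono hn) fun k _ hk => ?_).ge
    rw [Polynomial.coeff_eq_zero_of_natDegree_lt (by simpa using hk)]
    simp

theorem coeff_polynomial_mul (Q : ℂ[X]) (f : PowerSeries ℂ) (n : ℕ) :
    PowerSeries.coeff n ((Q : PowerSeries ℂ) * f) =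
      ∑ k ∈ Finset.range (n + 1), Q.coeff k * PowerSeries.coeff (n - k) f := by
  rw [PowerSeries.coeff_mul, Finset.Nat.sum_antidiagonal_eq_sum_range_succ_mk]
  simp [Polynomial.coeff_coe]

theorem coeff_polynomial_mul' (Q : ℂ[X]) (f : PowerSeries ℂ) (n : ℕ) :
    PowerSeries.coeff n ((Q : PowerSeries ℂ) * f) =
      Q.coeff 0 * PowerSeries.coeff n f +
        ∑ m ∈ Finset.range n, Q.coeff (n - m) * PowerSeries.coeff m f := by
  rw [mul_comm, PowerSeries.coeff_mul, Finset.Nat.sum_antidiagonal_eq_sum_range_succ_mk,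
    Finset.sum_range_succ]
  simp [Polynomial.coeff_coe, mul_comm, add_comm]

theorem norm_coeff_polynomial_mul_le {f : PowerSeries ℂ} {σ A : ℝ} (hσ : 0 < σ)
    (h : ∀ n, ‖PowerSeries.coeff n f‖ * σ ^ n ≤ A) (Q : ℂ[X]) (n : ℕ) :
    ‖PowerSeries.coeff n ((Q : PowerSeries ℂ) * f)‖ * σ ^ n ≤ weightedNorm σ Q * A := by
  have hA : 0 ≤ A := le_trans (by positivity) (h 0)
  rw [coeff_polynomial_mul]
  calc _ ≤ (∑ k ∈ Finset.range (n + 1), ‖Q.coeff k * PowerSeries.coeff (n - k) f‖) * σ ^ n := by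
        gcongr; exact norm_sum_le _ _
    _ = ∑ k ∈ Finset.range (n + 1),
          ‖Q.coeff k‖ * σ ^ k * (‖PowerSeries.coeff (n - k) f‖ * σ ^ (n - k)) := by
        rw [Finset.sum_mul]
        refine Finset.sum_congr rfl fun k hk => ?_
        have hk' : k ≤ n := by simpa [Nat.lt_succ_iff] using hk
        rw [norm_mul, ← pow_sub_mul_pow σ hk']
        ring
    _ ≤ ∑ k ∈ Finset.range (n + 1), ‖Q.coeff k‖ * σ ^ k * A := by
        gcongr; exact h _
    _ ≤ weightedNorm σ Q * A := by
        rw [← Finset.sum_mul]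
        gcongr
        exact sum_range_coeff_le_weightedNorm hσ.le Q _

end AskeyWilson

/-! ### The gauged difference equation and its formal solution -/

namespace AskeyWilson

open Filter Topology Polynomial

/-- The polynomial `(1 - X²)(1 - pX²)(1 - X²/p)`. -/
noncomputable def polyS (p : ℂ) : ℂ[X] :=
  (1 - X ^ 2) * (1 - C p * X ^ 2) * (1 - C p⁻¹ * X ^ 2)

/-- The polynomial coefficients of a second order `p`-difference equation
`Z Q(X) Ψ(pX) + Z⁻¹ (1 - pX²) Ψ(X/p) + (K(X) - (Z + Z⁻¹) S(X)) Ψ(X) = 0`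
whose singularities at `pX² = 1` are apparent. -/
structure GaugedData (p : ℂ) where
  Q : ℂ[X]
  K : ℂ[X]
  Q_zero : Q.coeff 0 = 1
  K_zero : K.coeff 0 = 0
  root : ∀ r, r ^ 2 = p → Q.eval r = 0
  cross : ∀ r, r ^ 2 = p → Q.eval r⁻¹ * (1 - p ^ 2) = K.eval r * K.eval r⁻¹

namespace GaugedData

variable {p : ℂ} (D : GaugedData p)

/-- The coefficient of `Ψ(X)`. -/
noncomputable def mid (Z : ℂ) : ℂ[X] := D.K - C (Z + Z⁻¹) * polyS p

/-- The difference operator on formal power series. -/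
noncomputable def op (Z : ℂ) (f : PowerSeries ℂ) : PowerSeries ℂ :=
  ((C Z * D.Q : ℂ[X]) : PowerSeries ℂ) * PowerSeries.rescale p f +
    ((C Z⁻¹ * (1 - C p * X ^ 2) : ℂ[X]) : PowerSeries ℂ) * PowerSeries.rescale p⁻¹ f +
    (D.mid Z : PowerSeries ℂ) * f

/-- The coefficient of `f_m` in the `n`-th coefficient of `op f`, for `m < n`. -/
noncomputable def low (n m : ℕ) (Z : ℂ) : ℂ :=
  Z * D.Q.coeff (n - m) * p ^ m + Z⁻¹ * (1 - C p * X ^ 2 : ℂ[X]).coeff (n - m) * p⁻¹ ^ m +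
    (D.mid Z).coeff (n - m)

theorem polyS_coeff_zero (p : ℂ) : (polyS p).coeff 0 = 1 := by
  rw [coeff_zero_eq_eval_zero]; simp [polyS]

/-- The constant terms of the three coefficients are `Z`, `Z⁻¹` and `-(Z + Z⁻¹)`, and `Zpⁿ + Z⁻¹p⁻ⁿ
- Z - Z⁻¹` factors; everything else involves lower indices only. -/
theorem coeff_op (hp0 : p ≠ 0) {Z : ℂ} (hZ : Z ≠ 0) (f : PowerSeries ℂ) (n : ℕ) :
    PowerSeries.coeff n (D.op Z f) =
      Z⁻¹ * p⁻¹ ^ n * (1 - p ^ n) * (1 - p ^ n * Z ^ 2) * PowerSeries.coeff n f +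
        ∑ m ∈ Finset.range n, D.low n m Z * PowerSeries.coeff m f := by
  have h1 : (1 - C p * X ^ 2 : ℂ[X]).coeff 0 = 1 := by simp [coeff_zero_eq_eval_zero]
  have h2 : (D.mid Z).coeff 0 = -(Z + Z⁻¹) := by
    simp [mid, D.K_zero, polyS_coeff_zero]
  simp only [op, map_add, coeff_polynomial_mul', PowerSeries.coeff_rescale, coeff_C_mul, h1, h2,
    D.Q_zero, low, add_mul, Finset.sum_add_distrib]
  have e : Z * 1 * (p ^ n * PowerSeries.coeff n f) + Z⁻¹ * 1 * (p⁻¹ ^ n * PowerSeries.coeff n f) +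
      -(Z + Z⁻¹) * PowerSeries.coeff n f =
      Z⁻¹ * p⁻¹ ^ n * (1 - p ^ n) * (1 - p ^ n * Z ^ 2) * PowerSeries.coeff n f := by
    rw [inv_pow]
    field_simp
    ring
  rw [← e]
  simp only [mul_assoc]
  ring

/-- Away from the resonances the diagonal factor is invertible for every `n > 0`, so the recursion
leaves only the constant term free. -/
theorem eq_of_op_eq_zero (hp0 : p ≠ 0) (hp : ‖p‖ < 1) {Z : ℂ} (hZ : Z ≠ 0)
    (hres : ∀ n : ℕ, 0 < n → 1 - p ^ n * Z ^ 2 ≠ 0)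
    {f g : PowerSeries ℂ} (hf : D.op Z f = 0) (hg : D.op Z g = 0)
    (h0 : PowerSeries.coeff 0 f = PowerSeries.coeff 0 g) : f = g := by
  ext n
  induction n using Nat.strong_induction_on with
  | _ n ih =>
    rcases Nat.eq_zero_or_pos n with rfl | hn
    · exact h0
    · have e1 := D.coeff_op hp0 hZ f n
      have e2 := D.coeff_op hp0 hZ g n
      rw [hf] at e1
      rw [hg] at e2
      have e3 : ∑ m ∈ Finset.range n, D.low n m Z * PowerSeries.coeff m f =
          ∑ m ∈ Finset.range n, D.low n m Z * PowerSeries.coeff m g :=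
        Finset.sum_congr rfl fun m hm => by rw [ih m (Finset.mem_range.1 hm)]
      rw [e3] at e1
      have e4 := add_right_cancel (e1.symm.trans e2)
      have hpn : 1 - p ^ n ≠ 0 := fun h => by
        have := pow_lt_one₀ (norm_nonneg p) hp hn.ne'
        rw [← norm_pow, ← sub_eq_zero.1 h] at this
        simp at this
      refine mul_left_cancel₀ ?_ e4
      have := hres n hn
      positivity

/-- `Γ_n = P_n (p^{n+1} Z²; p)_∞` solves the recursion. -/
noncomputable def P (D : GaugedData p) (n : ℕ) (Z : ℂ) : ℂ :=
  if n = 0 then 1 else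
    -(Z * p ^ n / (1 - p ^ n)) * ∑ m : Fin n,
      D.low n m Z * (D.P m Z * ∏ j ∈ Finset.Ico (m.1 + 1) n, (1 - p ^ j * Z ^ 2))
termination_by n
decreasing_by exact m.2

/-- The coefficients of the asymptotic solution, as functions of `Z`. -/
noncomputable def G (n : ℕ) (Z : ℂ) : ℂ := D.P n Z * qPochInf (p ^ (n + 1) * Z ^ 2) p

theorem G_zero (Z : ℂ) : D.G 0 Z = qPochInf (p * Z ^ 2) p := by
  rw [G, P]; simp

theorem prod_Ico_mul_qPochInf (hp : ‖p‖ < 1) (Y : ℂ) {m n : ℕ} (h : m ≤ n) :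
    (∏ j ∈ Finset.Ico m n, (1 - p ^ j * Y)) * qPochInf (p ^ n * Y) p = qPochInf (p ^ m * Y) p := by
  induction n, h using Nat.le_induction with
  | base => simp
  | succ n hmn ih =>
    rw [Finset.prod_Ico_succ_top hmn, ← ih, qPochInf_eq_one_sub_mul (p ^ n * Y) hp, pow_succ]
    ring_nf

/-- The factor `1 - pⁿZ²` needed on the diagonal is the first factor of `(pⁿZ²;p)_∞`, and `1 - pⁿ`
is never zero for `n > 0`. No division by a resonant factor occurs, so the equation holds for every
`Z ≠ 0`. -/
theorem op_G (hp0 : p ≠ 0) (hp : ‖p‖ < 1) {Z : ℂ} (hZ : Z ≠ 0) :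
    D.op Z (PowerSeries.mk fun n => D.G n Z) = 0 := by
  ext n
  rw [D.coeff_op hp0 hZ]
  simp only [PowerSeries.coeff_mk, map_zero]
  rcases Nat.eq_zero_or_pos n with rfl | hn
  · simp
  have hpn : 1 - p ^ n ≠ 0 := fun h => by
    have := pow_lt_one₀ (norm_nonneg p) hp hn.ne'
    rw [← norm_pow, ← sub_eq_zero.1 h] at this
    simp at this
  -- Every lower term contains `(p^{m+1}Z²;p)_∞` with `m + 1 ≤ n`, hence the common factor
  -- `(pⁿZ²;p)_∞`.
  have e1 : ∑ m ∈ Finset.range n, D.low n m Z * D.G m Z =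
      (∑ m : Fin n, D.low n m Z * (D.P m Z * ∏ j ∈ Finset.Ico (m.1 + 1) n, (1 - p ^ j * Z ^ 2))) *
        qPochInf (p ^ n * Z ^ 2) p := by
    rw [Fin.sum_univ_eq_sum_range (fun m => D.low n m Z *
      (D.P m Z * ∏ j ∈ Finset.Ico (m + 1) n, (1 - p ^ j * Z ^ 2))), Finset.sum_mul]
    refine Finset.sum_congr rfl fun m hm => ?_
    rw [G, ← prod_Ico_mul_qPochInf hp (Z ^ 2) (Nat.succ_le_of_lt (Finset.mem_range.1 hm))]
    ring
  rw [e1, G, P, if_neg hn.ne', qPochInf_eq_one_sub_mul (p ^ n * Z ^ 2) hp,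
    show p ^ n * Z ^ 2 * p = p ^ (n + 1) * Z ^ 2 by ring, inv_pow]
  field_simp
  ring

theorem differentiableOn_low (n m : ℕ) : DifferentiableOn ℂ (D.low n m) {0}ᶜ := by
  unfold low mid
  simp only [coeff_sub, coeff_C_mul]
  intro Z hZ
  have hZ' : Z ≠ 0 := hZ
  refine DifferentiableAt.differentiableWithinAt ?_
  fun_prop (disch := assumption)

theorem differentiableOn_P (n : ℕ) : DifferentiableOn ℂ (D.P n) {0}ᶜ := by
  induction n using Nat.strong_induction_on with
  | _ n ih =>
    have h : D.P n = fun Z => if n = 0 then 1 else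
        -(Z * p ^ n / (1 - p ^ n)) * ∑ m : Fin n,
          D.low n m Z * (D.P m Z * ∏ j ∈ Finset.Ico (m.1 + 1) n, (1 - p ^ j * Z ^ 2)) := by
      funext Z
      rw [P]
    rw [h]
    split_ifs with hn
    · fun_prop
    · refine DifferentiableOn.mul (by fun_prop) (DifferentiableOn.fun_sum fun m _ => ?_)
      refine (D.differentiableOn_low n m).mul ((ih m m.2).mul ?_)
      exact DifferentiableOn.fun_finsetProd fun _ _ => by fun_prop

theorem differentiableOn_G (hp : ‖p‖ < 1) (n : ℕ) : DifferentiableOn ℂ (D.G n) {0}ᶜ :=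
  (D.differentiableOn_P n).mul
    ((differentiable_qPochInf hp).comp (by fun_prop : Differentiable ℂ
      fun Z : ℂ => p ^ (n + 1) * Z ^ 2)).differentiableOn

end GaugedData
end AskeyWilson

/-! ### Division of a power series by `1 - pX²` -/

namespace AskeyWilson

open Filter Topology Polynomial

/-- Here `g` is the coefficient sequence of `h(X)/(1 - pX²)`, and the denominator has no zero with
`|X| ≤ σ`. -/
theorem norm_mul_pow_le_of_two_step {p : ℂ} {σ B : ℝ} (hσ : 0 < σ) (hσp : σ ^ 2 * ‖p‖ < 1)
    {g h : ℕ → ℂ} (h0 : g 0 = h 0) (h1 : g 1 = h 1)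
    (hrec : ∀ n, g (n + 2) = p * g n + h (n + 2)) (hh : ∀ n, ‖h n‖ * σ ^ n ≤ B) (n : ℕ) :
    ‖g n‖ * σ ^ n ≤ B / (1 - σ ^ 2 * ‖p‖) := by
  have hB : 0 ≤ B := le_trans (by positivity) (hh 0)
  have hd : 0 < 1 - σ ^ 2 * ‖p‖ := by linarith
  have hBd : B ≤ B / (1 - σ ^ 2 * ‖p‖) := by
    rw [le_div_iff₀ hd]
    have : 0 ≤ σ ^ 2 * ‖p‖ := by positivity
    nlinarith
  induction n using Nat.twoStepInduction with
  | zero => rw [h0]; exact (hh 0).trans hBd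
  | one => rw [h1]; exact (hh 1).trans hBd
  | more n ih _ =>
    rw [hrec]
    calc ‖p * g n + h (n + 2)‖ * σ ^ (n + 2) ≤ (‖p‖ * ‖g n‖ + ‖h (n + 2)‖) * σ ^ (n + 2) := by
          gcongr
          exact (norm_add_le _ _).trans_eq (by rw [norm_mul])
      _ = σ ^ 2 * ‖p‖ * (‖g n‖ * σ ^ n) + ‖h (n + 2)‖ * σ ^ (n + 2) := by ring
      _ ≤ σ ^ 2 * ‖p‖ * (B / (1 - σ ^ 2 * ‖p‖)) + B := by
          gcongr
          exact hh _
      _ = B / (1 - σ ^ 2 * ‖p‖) := by field_simp; ring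

/-- The recursion preserves parity, and `(1 + (-1)^(n+j))/2` selects the indices `j` of the parity
of `n`. -/
theorem two_step_eq_sum {s b : ℕ → ℂ} (h0 : s 0 = b 0) (h1 : s 1 = b 1)
    (hrec : ∀ n, s (n + 2) = s n + b (n + 2)) (n : ℕ) :
    s n = 2⁻¹ * ∑ j ∈ Finset.range (n + 1), b j * (1 + (-1) ^ (n + j)) := by
  induction n using Nat.twoStepInduction with
  | zero => simp [h0]; ring
  | one => simp [Finset.sum_range_succ, h1]; ring
  | more n ih _ =>
    rw [hrec, ih, Finset.sum_range_succ _ (n + 2), Finset.sum_range_succ _ (n + 1)]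
    have e1 : ∀ j, (-1 : ℂ) ^ (n + 2 + j) = (-1) ^ (n + j) := fun j => by ring
    have e2 : (-1 : ℂ) ^ (n + (n + 1)) = -1 := by
      rw [show n + (n + 1) = 2 * n + 1 by ring, pow_succ, pow_mul]; simp
    have e3 : (-1 : ℂ) ^ (n + (n + 2)) = 1 := by
      rw [show n + (n + 2) = 2 * (n + 1) by ring, pow_mul]; simp
    simp only [e1, e2, e3]
    ring

/-- The zeros `±r⁻¹` of `1 - pX²` now lie in the disc of radius `σ`, but `h` vanishes at both. The
partial sums giving `g n` are therefore minus the tails, and tails have the required decay. -/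
theorem norm_mul_pow_le_of_two_step_of_hasSum {p r : ℂ} {σ B : ℝ} (hr : r ^ 2 = p) (hp0 : p ≠ 0)
    (hσ : 0 < σ) (hσp : 1 < σ ^ 2 * ‖p‖)
    {g h : ℕ → ℂ} (h0 : g 0 = h 0) (h1 : g 1 = h 1)
    (hrec : ∀ n, g (n + 2) = p * g n + h (n + 2)) (hh : ∀ n, ‖h n‖ * σ ^ n ≤ B)
    (hs1 : HasSum (fun n => h n * r⁻¹ ^ n) 0) (hs2 : HasSum (fun n => h n * (-r⁻¹) ^ n) 0)
    (n : ℕ) : ‖g n‖ * σ ^ n ≤ B / (σ * ‖r‖ - 1) := by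
  have hr0 : r ≠ 0 := by rintro rfl; simp at hr; exact hp0 hr.symm
  have hB : 0 ≤ B := le_trans (by positivity) (hh 0)
  have hrn : ‖r‖ ^ 2 = ‖p‖ := by rw [← hr, norm_pow]
  have hrpos : 0 < ‖r‖ := norm_pos_iff.2 hr0
  have hσr : 1 < σ * ‖r‖ := by
    rw [← hrn] at hσp
    nlinarith [mul_pos hσ hrpos]
  set b : ℕ → ℂ := fun n => h n * r⁻¹ ^ n with hb
  set θ : ℝ := (σ * ‖r‖)⁻¹ with hθ
  have hθ0 : 0 < θ := by positivity
  have hθ1 : θ < 1 := inv_lt_one_of_one_lt₀ hσr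
  have hbn : ∀ n, ‖b n‖ ≤ B * θ ^ n := by
    intro n
    have : ‖b n‖ = ‖h n‖ * σ ^ n * θ ^ n := by
      rw [hb, hθ]
      simp only [norm_mul, norm_pow, norm_inv, inv_pow, mul_pow]
      field_simp
    rw [this]
    gcongr
    exact hh n
  -- The two vanishing conditions together say that the even and the odd parts of `∑ b j` are
  -- separately zero.
  have hsum : HasSum (fun j => b j * (1 + (-1) ^ (n + j))) 0 := by
    have := hs1.add (hs2.mul_left ((-1) ^ n))
    simp only [mul_zero, add_zero] at this
    refine this.congr_fun fun j => ?_
    simp only [hb, neg_pow r⁻¹ j, pow_add]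
    ring
  have hs : g n * r⁻¹ ^ n = 2⁻¹ * ∑ j ∈ Finset.range (n + 1), b j * (1 + (-1) ^ (n + j)) := by
    refine two_step_eq_sum (s := fun n => g n * r⁻¹ ^ n) (by simp [hb, h0]) (by simp [hb, h1])
      (fun n => ?_) n
    simp only [hb, hrec, ← hr, inv_pow]
    field_simp
    ring
  have htail : HasSum (fun j => b (j + (n + 1)) * (1 + (-1) ^ (n + (j + (n + 1)))))
      (-(2 * (g n * r⁻¹ ^ n))) := by
    have := (hasSum_nat_add_iff' (n + 1)).2 hsum
    rw [hs, mul_inv_cancel_left₀ two_ne_zero]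
    rwa [zero_sub] at this
  have hle : ‖-(2 * (g n * r⁻¹ ^ n))‖ ≤ 2 * (B * θ ^ (n + 1) * (1 - θ)⁻¹) := by
    rw [← htail.tsum_eq]
    refine tsum_of_norm_bounded
      (((hasSum_geometric_of_lt_one hθ0.le hθ1).mul_left (B * θ ^ (n + 1))).mul_left 2)
      fun j => ?_
    calc _ ≤ ‖b (j + (n + 1))‖ * 2 := by
          rw [norm_mul]
          gcongr
          refine (norm_add_le _ _).trans ?_
          simp only [norm_one, norm_pow, norm_neg, one_pow]
          norm_num
      _ ≤ B * θ ^ (j + (n + 1)) * 2 := by gcongr; exact hbn _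
      _ = _ := by ring
  have hgn : ‖g n‖ ≤ B * θ ^ (n + 1) * (1 - θ)⁻¹ * ‖r‖ ^ n := by
    have : ‖-(2 * (g n * r⁻¹ ^ n))‖ = 2 * (‖g n‖ * ‖r‖⁻¹ ^ n) := by simp
    rw [this] at hle
    have h2 : ‖g n‖ * ‖r‖⁻¹ ^ n ≤ B * θ ^ (n + 1) * (1 - θ)⁻¹ := by linarith
    rwa [inv_pow, ← div_eq_mul_inv, div_le_iff₀ (by positivity)] at h2
  calc ‖g n‖ * σ ^ n ≤ B * θ ^ (n + 1) * (1 - θ)⁻¹ * ‖r‖ ^ n * σ ^ n := by gcongr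
    _ = B / (σ * ‖r‖ - 1) := by
      have h1 : θ * (σ * ‖r‖) = 1 := inv_mul_cancel₀ (by positivity)
      have h2 : θ ^ n * (‖r‖ ^ n * σ ^ n) = 1 := by
        rw [← mul_pow, ← mul_pow, mul_comm ‖r‖, h1, one_pow]
      have h3 : θ * (1 - θ)⁻¹ = (σ * ‖r‖ - 1)⁻¹ := by
        have : 1 - θ ≠ 0 := by linarith
        have : σ * ‖r‖ - 1 ≠ 0 := by linarith
        field_simp
        linear_combination h1
      rw [div_eq_mul_inv, ← h3, pow_succ]
      linear_combination (B * θ * (1 - θ)⁻¹) * h2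

end AskeyWilson

/-! ### Apparent singularities and enlargement of the disc of convergence -/

namespace AskeyWilson

open Filter Topology Polynomial
namespace GaugedData

variable {p : ℂ} (D : GaugedData p)

/-- The inhomogeneous part `-(Z Q(X) f(pX) + mid(X) f(X))` of the equation. -/
noncomputable def rhs (Z : ℂ) (f : PowerSeries ℂ) : PowerSeries ℂ :=
  -(((C Z * D.Q : ℂ[X]) : PowerSeries ℂ) * PowerSeries.rescale p f + (D.mid Z : PowerSeries ℂ) * f)

theorem norm_coeff_rhs_le (hp : ‖p‖ < 1) {σ A M : ℝ} (hσ : 0 < σ) {Z : ℂ} {f : PowerSeries ℂ}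
    (hZ : ‖Z‖ ≤ M) (hZ' : ‖Z⁻¹‖ ≤ M) (hA : ∀ n, ‖PowerSeries.coeff n f‖ * σ ^ n ≤ A) (n : ℕ) :
    ‖PowerSeries.coeff n (D.rhs Z f)‖ * σ ^ n ≤
      M * (weightedNorm σ D.Q * A) +
        (weightedNorm σ D.K * A + (M + M) * (weightedNorm σ (polyS p) * A)) := by
  have hM : 0 ≤ M := (norm_nonneg Z).trans hZ
  have h1 : ∀ n, ‖PowerSeries.coeff n (PowerSeries.rescale p f)‖ * σ ^ n ≤ A := fun n => by
    rw [PowerSeries.coeff_rescale, norm_mul, norm_pow]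
    refine le_trans ?_ (hA n)
    have := pow_le_one₀ (n := n) (norm_nonneg p) hp.le
    have h2 : 0 ≤ ‖PowerSeries.coeff n f‖ * σ ^ n := by positivity
    nlinarith
  have e : PowerSeries.coeff n (D.rhs Z f) =
      -(Z * PowerSeries.coeff n ((D.Q : PowerSeries ℂ) * PowerSeries.rescale p f) +
        (PowerSeries.coeff n ((D.K : PowerSeries ℂ) * f) -
          (Z + Z⁻¹) * PowerSeries.coeff n ((polyS p : PowerSeries ℂ) * f))) := by
    simp only [rhs, mid, Polynomial.coe_mul, Polynomial.coe_sub, Polynomial.coe_C, sub_mul,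
      Polynomial.coe_add, add_mul, mul_assoc, map_neg, map_add, map_sub, PowerSeries.coeff_C_mul]
  rw [e, norm_neg]
  calc _ ≤ (‖Z‖ * ‖PowerSeries.coeff n ((D.Q : PowerSeries ℂ) * PowerSeries.rescale p f)‖ +
        (‖PowerSeries.coeff n ((D.K : PowerSeries ℂ) * f)‖ +
          (‖Z‖ + ‖Z⁻¹‖) * ‖PowerSeries.coeff n ((polyS p : PowerSeries ℂ) * f)‖)) * σ ^ n := by
        gcongr
        refine (norm_add_le _ _).trans (add_le_add (norm_mul_le _ _) ?_)
        refine (norm_sub_le _ _).trans (add_le_add le_rfl ?_)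
        rw [norm_mul]
        gcongr
        exact norm_add_le _ _
    _ = ‖Z‖ * (‖PowerSeries.coeff n ((D.Q : PowerSeries ℂ) * PowerSeries.rescale p f)‖ * σ ^ n) +
        (‖PowerSeries.coeff n ((D.K : PowerSeries ℂ) * f)‖ * σ ^ n +
          (‖Z‖ + ‖Z⁻¹‖) *
            (‖PowerSeries.coeff n ((polyS p : PowerSeries ℂ) * f)‖ * σ ^ n)) := by ring
    _ ≤ _ := by
        have b1 := norm_coeff_polynomial_mul_le hσ h1 D.Q n
        have b2 := norm_coeff_polynomial_mul_le hσ hA D.K n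
        have b3 := norm_coeff_polynomial_mul_le hσ hA (polyS p) n
        exact add_le_add (mul_le_mul hZ b1 (by positivity) hM)
          (add_le_add b2 (mul_le_mul (add_le_add hZ hZ') b3 (by positivity) (by positivity)))

theorem eval_polyS_eq_zero {r : ℂ} (hr : r ^ 2 = p) (hr0 : r ≠ 0) :
    (polyS p).eval r = 0 ∧ (polyS p).eval r⁻¹ = 0 := by
  subst hr
  simp only [polyS, eval_mul, eval_sub, eval_one, eval_pow, eval_X, eval_C]
  constructor <;> field_simp <;> ring

/-- Since `Q(r) = 0`, the equation at `X = r` involves only `f(r)` and `f(r⁻¹)`; the right-hand side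
at `X = r⁻¹` involves the same two values. The `cross` identity makes the two linear relations
proportional. -/
theorem hasEval_rhs_zero (hp0 : p ≠ 0) (hp : ‖p‖ < 1) {σ A : ℝ} (hσ : 0 < σ)
    (hσp : 1 < σ ^ 2 * ‖p‖) {Z : ℂ} (hZ : Z ≠ 0) {f : PowerSeries ℂ} (hf : D.op Z f = 0)
    (hA : ∀ n, ‖PowerSeries.coeff n f‖ * σ ^ n ≤ A) {r : ℂ} (hr : r ^ 2 = p) :
    HasEval (D.rhs Z f) r⁻¹ 0 := by
  have hr0 : r ≠ 0 := by rintro rfl; simp at hr; exact hp0 hr.symm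
  have hrn : ‖r‖ ^ 2 = ‖p‖ := by rw [← hr, norm_pow]
  have hrpos : 0 < ‖r‖ := norm_pos_iff.2 hr0
  have hr1 : ‖r‖ < 1 := by nlinarith
  have hσr : 1 < σ * ‖r‖ := by
    rw [← hrn] at hσp
    nlinarith [mul_pos hσ hrpos]
  have h1 : ‖r⁻¹‖ < σ := by
    rw [norm_inv, inv_lt_iff_one_lt_mul₀ hrpos]; linarith
  have h2 : ‖r‖ < σ := by
    have : 1 < ‖r⁻¹‖ := by rw [norm_inv]; exact (one_lt_inv₀ hrpos).2 hr1
    linarith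
  have h3 : ‖p * r‖ < σ := by
    rw [norm_mul]
    have := mul_lt_of_lt_one_left hrpos hp
    linarith
  obtain ⟨a, ha⟩ := hasEval_of_norm_mul_pow_le hA h1
  obtain ⟨b, hb⟩ := hasEval_of_norm_mul_pow_le hA h2
  obtain ⟨c, hc⟩ := hasEval_of_norm_mul_pow_le hA h3
  have e1 : p * r⁻¹ = r := by rw [← hr]; field_simp
  have e2 : p⁻¹ * r = r⁻¹ := by rw [← hr]; field_simp
  have hop := ((hasEval_rescale.2 hc).polynomial_mul (C Z * D.Q)).add
    ((hasEval_rescale.2 (e2 ▸ ha)).polynomial_mul (C Z⁻¹ * (1 - C p * X ^ 2))) |>.add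
    (hb.polynomial_mul (D.mid Z))
  have hz : HasEval (D.op Z f) r 0 := by
    rw [hf]; simp [HasEval]
  have key := hz.unique hop
  have hrhs := (((hasEval_rescale.2 (e1.symm ▸ hb)).polynomial_mul (C Z * D.Q)).add
    (ha.polynomial_mul (D.mid Z))).neg
  have hS := eval_polyS_eq_zero hr hr0
  -- `polyS p` vanishes at `r` and `r⁻¹`, so the middle coefficient no longer depends on `Z` at
  -- these points.
  have hmid : (D.mid Z).eval r = D.K.eval r := by simp [mid, hS.1]
  have hmid' : (D.mid Z).eval r⁻¹ = D.K.eval r⁻¹ := by simp [mid, hS.2]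
  have hQ := D.root r hr
  have hcross := D.cross r hr
  rw [rhs]
  convert hrhs using 1
  simp only [eval_mul, eval_C, eval_sub, eval_one, eval_pow, eval_X, hmid, hmid', hQ, hr] at key ⊢
  have hp1 : 1 - p * p ≠ 0 := by
    intro h
    have h4 : ‖p * p‖ < 1 := by rw [norm_mul]; nlinarith [norm_nonneg p]
    rw [← sub_eq_zero.1 h] at h4
    simp at h4
  refine (mul_right_cancel₀ (mul_ne_zero (inv_ne_zero hZ) hp1) ?_).symm
  have hZZ : Z * Z⁻¹ = 1 := mul_inv_cancel₀ hZ
  linear_combination (-(b * (1 - p * p) * D.Q.eval r⁻¹)) * hZZ - b * hcross + D.K.eval r⁻¹ * key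

/-- The equation reads `Z⁻¹(1 - pX²) f(X/p) = rhs(X)`. A bound for `f` at radius `σ` bounds the
right-hand side at `σ`; division by `1 - pX²` bounds `f(X/p)` at `σ`, that is, `f` at `σ/|p|`. The
excluded case is a zero of `1 - pX²` on the circle itself. The constant depends on `Z` only through
`M`. -/
theorem bootstrap (hp0 : p ≠ 0) (hp : ‖p‖ < 1) {σ : ℝ} (hσ : 0 < σ) (hne : σ ^ 2 * ‖p‖ ≠ 1)
    (A M : ℝ) : ∃ A', ∀ (Z : ℂ) (f : PowerSeries ℂ), Z ≠ 0 → ‖Z‖ ≤ M → ‖Z⁻¹‖ ≤ M →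
      D.op Z f = 0 → (∀ n, ‖PowerSeries.coeff n f‖ * σ ^ n ≤ A) →
      ∀ n, ‖PowerSeries.coeff n f‖ * (σ / ‖p‖) ^ n ≤ A' := by
  obtain ⟨r, hr⟩ : ∃ r : ℂ, r ^ 2 = p := IsAlgClosed.exists_pow_nat_eq p two_pos
  set B := M * (weightedNorm σ D.Q * A) +
        (weightedNorm σ D.K * A + (M + M) * (weightedNorm σ (polyS p) * A)) with hB
  have hpn : 0 < ‖p‖ := norm_pos_iff.2 hp0
  have main : ∃ B', ∀ (Z : ℂ) (f : PowerSeries ℂ), Z ≠ 0 → ‖Z‖ ≤ M → ‖Z⁻¹‖ ≤ M →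
      D.op Z f = 0 → (∀ n, ‖PowerSeries.coeff n f‖ * σ ^ n ≤ A) →
      ∀ n, ‖Z⁻¹ * (p⁻¹ ^ n * PowerSeries.coeff n f)‖ * σ ^ n ≤ B' := by
    have hg : ∀ (Z : ℂ) (f : PowerSeries ℂ), D.op Z f = 0 →
        PowerSeries.C Z⁻¹ * PowerSeries.rescale p⁻¹ f = D.rhs Z f +
          PowerSeries.X ^ 2 *
            (PowerSeries.C p * (PowerSeries.C Z⁻¹ * PowerSeries.rescale p⁻¹ f)) := by
      intro Z f hf
      rw [rhs]
      have : D.op Z f = 0 := hf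
      simp only [op, Polynomial.coe_mul, Polynomial.coe_sub, Polynomial.coe_C, Polynomial.coe_one,
        Polynomial.coe_pow, Polynomial.coe_X] at this ⊢
      linear_combination this
    have h0 : ∀ (Z : ℂ) (f : PowerSeries ℂ), D.op Z f = 0 →
        Z⁻¹ * (p⁻¹ ^ 0 * PowerSeries.coeff 0 f) = PowerSeries.coeff 0 (D.rhs Z f) := by
      intro Z f hf
      have := congrArg (PowerSeries.coeff 0) (hg Z f hf)
      simpa [PowerSeries.coeff_X_pow_mul'] using this
    have h1 : ∀ (Z : ℂ) (f : PowerSeries ℂ), D.op Z f = 0 →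
        Z⁻¹ * (p⁻¹ ^ 1 * PowerSeries.coeff 1 f) = PowerSeries.coeff 1 (D.rhs Z f) := by
      intro Z f hf
      have := congrArg (PowerSeries.coeff 1) (hg Z f hf)
      simpa [PowerSeries.coeff_X_pow_mul', PowerSeries.coeff_rescale,
        PowerSeries.coeff_C_mul] using this
    have h2 : ∀ (Z : ℂ) (f : PowerSeries ℂ), D.op Z f = 0 → ∀ n,
        Z⁻¹ * (p⁻¹ ^ (n + 2) * PowerSeries.coeff (n + 2) f) =
          p * (Z⁻¹ * (p⁻¹ ^ n * PowerSeries.coeff n f)) +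
            PowerSeries.coeff (n + 2) (D.rhs Z f) := by
      intro Z f hf n
      have := congrArg (PowerSeries.coeff (n + 2)) (hg Z f hf)
      simp only [map_add, PowerSeries.coeff_X_pow_mul, PowerSeries.coeff_rescale,
        PowerSeries.coeff_C_mul] at this
      rw [this]; ring
    rcases lt_or_gt_of_ne hne with hlt | hgt
    · exact ⟨B / (1 - σ ^ 2 * ‖p‖), fun Z f hZ hM hM' hf hA n =>
        norm_mul_pow_le_of_two_step (g := fun n => Z⁻¹ * (p⁻¹ ^ n * PowerSeries.coeff n f))
          hσ hlt (h0 Z f hf) (h1 Z f hf) (h2 Z f hf)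
          (D.norm_coeff_rhs_le hp hσ hM hM' hA) n⟩
    · refine ⟨B / (σ * ‖r‖ - 1), fun Z f hZ hM hM' hf hA n =>
        norm_mul_pow_le_of_two_step_of_hasSum
          (g := fun n => Z⁻¹ * (p⁻¹ ^ n * PowerSeries.coeff n f)) hr hp0
          hσ hgt (h0 Z f hf) (h1 Z f hf) (h2 Z f hf)
          (D.norm_coeff_rhs_le hp hσ hM hM' hA)
          (D.hasEval_rhs_zero hp0 hp hσ hgt hZ hf hA hr) ?_ n⟩
      have := D.hasEval_rhs_zero hp0 hp hσ hgt hZ hf hA (r := -r) (by rw [neg_sq, hr])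
      rwa [inv_neg] at this
  obtain ⟨B', hB'⟩ := main
  refine ⟨M * B', fun Z f hZ hM hM' hf hA n => ?_⟩
  have h := hB' Z f hZ hM hM' hf hA n
  have hB0 : 0 ≤ B' := le_trans (by positivity) h
  have hM0 : 0 ≤ M := (norm_nonneg Z).trans hM
  calc ‖PowerSeries.coeff n f‖ * (σ / ‖p‖) ^ n =
        ‖Z‖ * (‖Z⁻¹ * (p⁻¹ ^ n * PowerSeries.coeff n f)‖ * σ ^ n) := by
        have : ‖Z‖ ≠ 0 := norm_ne_zero_iff.2 hZ
        simp only [norm_mul, norm_inv, norm_pow, div_pow, inv_pow]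
        field_simp
    _ ≤ M * B' := by gcongr

end GaugedData
end AskeyWilson

/-! ### Locally uniform bounds for the coefficients -/

namespace AskeyWilson

open Filter Topology Polynomial
namespace GaugedData

variable {p : ℂ} (D : GaugedData p)

/-- The factor `p⁻ᵐ` in `low` is unbounded, but the recursion carries a factor `pⁿ` with `n ≥ m`.
The resulting bound depends on `n - m` only and can be summed over `m`. -/
theorem norm_pow_mul_low_le (hp0 : p ≠ 0) (hp : ‖p‖ < 1) {M : ℝ} {Z : ℂ} (hZ : ‖Z‖ ≤ M)
    (hZ' : ‖Z⁻¹‖ ≤ M) {n m : ℕ} (hmn : m ≤ n) :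
    ‖p‖ ^ n * ‖D.low n m Z‖ ≤ M * ‖D.Q.coeff (n - m)‖ +
      M * ‖(1 - C p * X ^ 2 : ℂ[X]).coeff (n - m)‖ +
      (‖D.K.coeff (n - m)‖ + (M + M) * ‖(polyS p).coeff (n - m)‖) := by
  have hM : 0 ≤ M := (norm_nonneg Z).trans hZ
  have hpn : 0 < ‖p‖ := norm_pos_iff.2 hp0
  have h1 : ‖p‖ ^ n ≤ 1 := pow_le_one₀ hpn.le hp.le
  have h2 : ‖p‖ ^ m ≤ 1 := pow_le_one₀ hpn.le hp.le
  have h3 : ‖p‖ ^ n * (‖p‖ ^ m)⁻¹ ≤ 1 := by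
    rw [← div_eq_mul_inv, div_le_one (by positivity)]
    exact pow_le_pow_of_le_one hpn.le hp.le hmn
  have h4 : ‖D.low n m Z‖ ≤ M * ‖D.Q.coeff (n - m)‖ * ‖p‖ ^ m +
      M * ‖(1 - C p * X ^ 2 : ℂ[X]).coeff (n - m)‖ * (‖p‖ ^ m)⁻¹ +
      (‖D.K.coeff (n - m)‖ + (M + M) * ‖(polyS p).coeff (n - m)‖) := by
    rw [low]
    refine (norm_add₃_le).trans (add_le_add (add_le_add ?_ ?_) ?_)
    · rw [norm_mul, norm_mul, norm_pow]; gcongr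
    · rw [norm_mul, norm_mul, norm_pow, norm_inv p, inv_pow]; gcongr
    · rw [mid, coeff_sub, coeff_C_mul]
      refine (norm_sub_le _ _).trans (add_le_add le_rfl ?_)
      rw [norm_mul]
      gcongr
      exact (norm_add_le _ _).trans (add_le_add hZ hZ')
  calc _ ≤ ‖p‖ ^ n * (M * ‖D.Q.coeff (n - m)‖ * ‖p‖ ^ m +
      M * ‖(1 - C p * X ^ 2 : ℂ[X]).coeff (n - m)‖ * (‖p‖ ^ m)⁻¹ +
      (‖D.K.coeff (n - m)‖ + (M + M) * ‖(polyS p).coeff (n - m)‖)) := by gcongr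
    _ = M * ‖D.Q.coeff (n - m)‖ * (‖p‖ ^ n * ‖p‖ ^ m) +
      M * ‖(1 - C p * X ^ 2 : ℂ[X]).coeff (n - m)‖ * (‖p‖ ^ n * (‖p‖ ^ m)⁻¹) +
      (‖D.K.coeff (n - m)‖ + (M + M) * ‖(polyS p).coeff (n - m)‖) * ‖p‖ ^ n := by ring
    _ ≤ M * ‖D.Q.coeff (n - m)‖ * 1 +
      M * ‖(1 - C p * X ^ 2 : ℂ[X]).coeff (n - m)‖ * 1 +
      (‖D.K.coeff (n - m)‖ + (M + M) * ‖(polyS p).coeff (n - m)‖) * 1 := by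
        gcongr
        exact mul_le_one₀ h1 (by positivity) h2
    _ = _ := by ring

theorem sum_norm_coeff_le (Q : ℂ[X]) (n : ℕ) :
    ∑ m ∈ Finset.range n, ‖Q.coeff (n - m)‖ ≤ weightedNorm 1 Q := by
  have h := sum_range_coeff_le_weightedNorm zero_le_one Q (n + 1)
  simp only [one_pow, mul_one] at h
  refine le_trans ?_ h
  rw [← Finset.sum_range_reflect (fun k => ‖Q.coeff k‖) (n + 1), Finset.sum_range_succ]
  simp only [add_tsub_cancel_right]
  exact le_add_of_nonneg_right (norm_nonneg _)

theorem exists_norm_bounds {K : Set ℂ} (hK : IsCompact K) (hK0 : K ⊆ {0}ᶜ) :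
    ∃ M : ℝ, 1 ≤ M ∧ ∀ Z ∈ K, ‖Z‖ ≤ M ∧ ‖Z⁻¹‖ ≤ M := by
  obtain ⟨M₁, h1⟩ := hK.exists_bound_of_continuousOn (f := fun Z : ℂ => Z) continuousOn_id
  obtain ⟨M₂, h2⟩ := hK.exists_bound_of_continuousOn (f := fun Z : ℂ => Z⁻¹)
    (continuousOn_inv₀.mono hK0)
  exact ⟨max 1 (max M₁ M₂), le_max_left _ _, fun Z hZ =>
    ⟨(h1 Z hZ).trans ((le_max_left _ _).trans (le_max_right _ _)),
      (h2 Z hZ).trans ((le_max_right _ _).trans (le_max_right _ _))⟩⟩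

/-- For large `n` the factors `1 - pⁿ` and `1 - pⁿZ²` are bounded below, so the recursion multiplies
the bound by at most a constant; the finitely many earlier coefficients are continuous on the
compact set. -/
theorem exists_geometric_bound (hp0 : p ≠ 0) (hp : ‖p‖ < 1) {K : Set ℂ} (hK : IsCompact K)
    (hK0 : K ⊆ {0}ᶜ) : ∃ A T : ℝ, 1 ≤ T ∧ ∀ Z ∈ K, ∀ n, ‖D.G n Z‖ ≤ A * T ^ n := by
  obtain ⟨M, hM1, hM⟩ := exists_norm_bounds hK hK0
  have hM0 : 0 ≤ M := zero_le_one.trans hM1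
  set B := M * weightedNorm 1 D.Q + M * weightedNorm 1 (1 - C p * X ^ 2 : ℂ[X]) +
    (weightedNorm 1 D.K + (M + M) * weightedNorm 1 (polyS p)) with hB
  have hBsum : ∀ Z ∈ K, ∀ n, ∑ m ∈ Finset.range n, ‖p‖ ^ n * ‖D.low n m Z‖ ≤ B := by
    intro Z hZ n
    refine (Finset.sum_le_sum fun m hm => D.norm_pow_mul_low_le hp0 hp (hM Z hZ).1 (hM Z hZ).2
      (Finset.mem_range.1 hm).le).trans ?_
    simp only [Finset.sum_add_distrib, ← Finset.mul_sum]
    rw [hB]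
    gcongr <;> exact sum_norm_coeff_le _ n
  have hB0 : 0 ≤ B := by
    have := fun Q : ℂ[X] => weightedNorm_nonneg zero_le_one Q
    have h1 := this D.Q
    have h2 := this D.K
    have h3 := this (polyS p)
    have h4 := this (1 - C p * X ^ 2)
    positivity
  have hlim := tendsto_pow_atTop_nhds_zero_of_lt_one (norm_nonneg p) hp
  have hlim2 : Tendsto (fun n => ‖p‖ ^ n * M ^ 2) atTop (𝓝 0) := by
    simpa using hlim.mul_const (M ^ 2)
  -- From `n₀` on both diagonal factors have norm at least `1/2`, which is the source of the
  -- constant `4` in `T`.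
  obtain ⟨n₀, hn₀⟩ := eventually_atTop.1 ((hlim.eventually_le_const (half_pos one_pos)).and
    (hlim2.eventually_le_const (half_pos one_pos)))
  have hcont : ∀ n, ∃ A, ∀ Z ∈ K, ‖D.G n Z‖ ≤ A := fun n =>
    hK.exists_bound_of_continuousOn ((D.differentiableOn_G hp n).continuousOn.mono hK0)
  choose a ha using hcont
  set T := max 1 (4 * M * B) with hT
  have hT1 : 1 ≤ T := le_max_left _ _
  set A := ∑ n ∈ Finset.range (n₀ + 1), |a n| with hA
  have hA0 : 0 ≤ A := Finset.sum_nonneg fun _ _ => abs_nonneg _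
  refine ⟨A, T, hT1, fun Z hZ n => ?_⟩
  have hZ0 : Z ≠ 0 := hK0 hZ
  induction n using Nat.strong_induction_on with
  | _ n ih =>
    rcases Nat.lt_or_ge n (n₀ + 1) with hn | hn
    · calc ‖D.G n Z‖ ≤ |a n| := (ha n Z hZ).trans (le_abs_self _)
        _ ≤ A := Finset.single_le_sum (f := fun n => |a n|) (fun _ _ => abs_nonneg _)
            (Finset.mem_range.2 hn)
        _ ≤ A * T ^ n := le_mul_of_one_le_right hA0 (one_le_pow₀ hT1)
    · obtain ⟨b1, b2⟩ := hn₀ n (by omega)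
      have hpos : 0 < n := by omega
      have key := D.coeff_op hp0 hZ0 (PowerSeries.mk fun n => D.G n Z) n
      rw [D.op_G hp0 hp hZ0] at key
      simp only [PowerSeries.coeff_mk, map_zero] at key
      have hG : (1 - p ^ n) * (1 - p ^ n * Z ^ 2) * D.G n Z =
          -(Z * ∑ m ∈ Finset.range n, p ^ n * D.low n m Z * D.G m Z) := by
        have e : ∑ m ∈ Finset.range n, p ^ n * D.low n m Z * D.G m Z =
            p ^ n * ∑ m ∈ Finset.range n, D.low n m Z * D.G m Z := by
          rw [Finset.mul_sum]; simp only [mul_assoc]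
        rw [e]
        have h5 : Z * Z⁻¹ = 1 := mul_inv_cancel₀ hZ0
        have h6 : p ^ n * p⁻¹ ^ n = 1 := by rw [← mul_pow, mul_inv_cancel₀ hp0, one_pow]
        have h7 : Z * Z⁻¹ * (p ^ n * p⁻¹ ^ n) = 1 := by rw [h5, h6, one_mul]
        linear_combination (-(Z * p ^ n)) * key -
          ((1 - p ^ n) * (1 - p ^ n * Z ^ 2) * D.G n Z) * h7
      have l1 : 1 / 2 ≤ ‖1 - p ^ n‖ := by
        have := norm_sub_norm_le (1 : ℂ) (p ^ n)
        rw [norm_one, norm_pow] at this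
        linarith
      have l2 : 1 / 2 ≤ ‖1 - p ^ n * Z ^ 2‖ := by
        have := norm_sub_norm_le (1 : ℂ) (p ^ n * Z ^ 2)
        rw [norm_one, norm_mul, norm_pow, norm_pow] at this
        have h7 : ‖p‖ ^ n * ‖Z‖ ^ 2 ≤ ‖p‖ ^ n * M ^ 2 := by
          gcongr; exact (hM Z hZ).1
        linarith
      have u1 : ‖Z * ∑ m ∈ Finset.range n, p ^ n * D.low n m Z * D.G m Z‖ ≤
          M * (B * (A * T ^ (n - 1))) := by
        rw [norm_mul]
        refine mul_le_mul (hM Z hZ).1 ?_ (norm_nonneg _) hM0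
        refine (norm_sum_le _ _).trans ?_
        calc _ ≤ ∑ m ∈ Finset.range n, ‖p‖ ^ n * ‖D.low n m Z‖ * (A * T ^ (n - 1)) := by
              refine Finset.sum_le_sum fun m hm => ?_
              have hm' := Finset.mem_range.1 hm
              rw [norm_mul, norm_mul, norm_pow]
              gcongr
              refine (ih m hm').trans ?_
              gcongr
              omega
          _ ≤ _ := by
              rw [← Finset.sum_mul]
              gcongr
              exact hBsum Z hZ n
      have u2 : ‖D.G n Z‖ ≤ 4 * ‖(1 - p ^ n) * (1 - p ^ n * Z ^ 2) * D.G n Z‖ := by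
        rw [norm_mul, norm_mul]
        have : 1 / 2 * (1 / 2) ≤ ‖1 - p ^ n‖ * ‖1 - p ^ n * Z ^ 2‖ := by gcongr
        nlinarith [norm_nonneg (D.G n Z)]
      rw [hG, norm_neg] at u2
      calc ‖D.G n Z‖ ≤ 4 * (M * (B * (A * T ^ (n - 1)))) := u2.trans (by gcongr)
        _ = (4 * M * B) * (A * T ^ (n - 1)) := by ring
        _ ≤ T * (A * T ^ (n - 1)) := by gcongr; exact le_max_right _ _
        _ = A * T ^ n := by
          conv_rhs => rw [← Nat.sub_add_cancel hpos, pow_succ]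
          ring

/-- The geometric bound starts an induction in which each use of `bootstrap` multiplies the radius
by `1/|p|`, until it exceeds `R`. -/
theorem exists_entire_bound (hp0 : p ≠ 0) (hp : ‖p‖ < 1) {K : Set ℂ} (hK : IsCompact K)
    (hK0 : K ⊆ {0}ᶜ) {R : ℝ} (hR : 0 ≤ R) : ∃ A, ∀ Z ∈ K, ∀ n, ‖D.G n Z‖ * R ^ n ≤ A := by
  obtain ⟨A₀, T, hT1, hAT⟩ := D.exists_geometric_bound hp0 hp hK hK0
  obtain ⟨M, hM1, hM⟩ := exists_norm_bounds hK hK0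
  have hpn : 0 < ‖p‖ := norm_pos_iff.2 hp0
  -- With `σ = t^(1+4m)/|p|^j`, the quantity `σ²|p|` is a power of `t` with exponent `6 + 8(m - j)`.
  -- This is never `0`, so the case excluded by `bootstrap` does not occur.
  obtain ⟨t, ht0, ht⟩ : ∃ t : ℝ, 0 < t ∧ t ^ 4 = ‖p‖ :=
    ⟨Real.sqrt (Real.sqrt ‖p‖), by positivity, by
      rw [show 4 = 2 * 2 by rfl, pow_mul, Real.sq_sqrt (Real.sqrt_nonneg _),
        Real.sq_sqrt hpn.le]⟩
  have ht1 : t < 1 := by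
    by_contra h
    have := one_le_pow₀ (n := 4) (not_lt.1 h)
    linarith
  obtain ⟨m, hm⟩ : ∃ m : ℕ, t ^ (1 + 4 * m) ≤ T⁻¹ := by
    obtain ⟨m, hm⟩ := exists_pow_lt_of_lt_one (inv_pos.2 (zero_lt_one.trans_le hT1)) ht1
    exact ⟨m, (pow_le_pow_of_le_one ht0.le ht1.le (by omega)).trans hm.le⟩
  have step : ∀ j : ℕ, ∃ A, ∀ Z ∈ K, ∀ n, ‖D.G n Z‖ * (t ^ (1 + 4 * m) / ‖p‖ ^ j) ^ n ≤ A := by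
    intro j
    induction j with
    | zero =>
      refine ⟨A₀, fun Z hZ n => ?_⟩
      rw [pow_zero, div_one]
      have h1 := hAT Z hZ n
      have hT0 : 0 < T := zero_lt_one.trans_le hT1
      have h2 : 0 ≤ A₀ * T ^ n := (norm_nonneg _).trans h1
      calc ‖D.G n Z‖ * (t ^ (1 + 4 * m)) ^ n ≤ (A₀ * T ^ n) * T⁻¹ ^ n := by gcongr
        _ = A₀ := by rw [mul_assoc, ← mul_pow, mul_inv_cancel₀ hT0.ne', one_pow, mul_one]
    | succ j ih =>
      obtain ⟨A, hA⟩ := ih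
      have hσ : 0 < t ^ (1 + 4 * m) / ‖p‖ ^ j := by positivity
      have hne : (t ^ (1 + 4 * m) / ‖p‖ ^ j) ^ 2 * ‖p‖ ≠ 1 := by
        rw [← ht, div_pow, div_mul_eq_mul_div, Ne, div_eq_one_iff_eq (by positivity), ← pow_mul,
          ← pow_add, ← pow_mul, ← pow_mul]
        intro h
        have := pow_right_injective₀ ht0 ht1.ne h
        omega
      obtain ⟨A', hA'⟩ := D.bootstrap hp0 hp hσ hne A M
      refine ⟨A', fun Z hZ n => ?_⟩
      have := hA' Z (PowerSeries.mk fun n => D.G n Z) (hK0 hZ) (hM Z hZ).1 (hM Z hZ).2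
        (D.op_G hp0 hp (hK0 hZ)) (by simpa using hA Z hZ) n
      rw [PowerSeries.coeff_mk, div_div, ← pow_succ] at this
      exact this
  obtain ⟨j, hj⟩ : ∃ j : ℕ, R ≤ t ^ (1 + 4 * m) / ‖p‖ ^ j := by
    obtain ⟨j, hj⟩ := exists_pow_lt_of_lt_one
      (show 0 < t ^ (1 + 4 * m) / (R + 1) by positivity) hp
    refine ⟨j, ?_⟩
    rw [lt_div_iff₀ (by positivity)] at hj
    rw [le_div_iff₀ (by positivity)]
    nlinarith [pow_pos hpn j]
  obtain ⟨A, hA⟩ := step j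
  exact ⟨A, fun Z hZ n => le_trans (by gcongr) (hA Z hZ n)⟩

end GaugedData
end AskeyWilson

/-! ### The creative telescoping certificate -/

namespace AskeyWilson

open Filter Topology

/-- `∏ (1 - T / u_j)` in terms of the elementary symmetric polynomials of `u`, where
`u₁ u₂ u₃ u₄ = p w²`. -/
noncomputable def quarticInv (e1 e2 e3 p w T : ℂ) : ℂ :=
  1 - e3 / (p * w ^ 2) * T + e2 / (p * w ^ 2) * T ^ 2 - e1 / (p * w ^ 2) * T ^ 3 +
    T ^ 4 / (p * w ^ 2)

/-- `∏ (1 - T u_j)` in terms of the elementary symmetric polynomials of `u`. -/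
noncomputable def quartic (e1 e2 e3 p w T : ℂ) : ℂ :=
  1 - e1 * T + e2 * T ^ 2 - e3 * T ^ 3 + p * w ^ 2 * T ^ 4

/-- `∏_{i<j} (1 - X u_i u_j / w)` in terms of the elementary symmetric polynomials of `u`. -/
noncomputable def pairPoly (e1 e2 e3 p w X : ℂ) : ℂ :=
  (1 + p * X ^ 2) ^ 3 - e2 / w * X * (1 + p * X ^ 2) ^ 2 +
    (e1 * e3 - 4 * (p * w ^ 2)) / w ^ 2 * X ^ 2 * (1 + p * X ^ 2) -
    (e1 ^ 2 * (p * w ^ 2) + e3 ^ 2 - 4 * e2 * (p * w ^ 2)) / w ^ 3 * X ^ 3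

/-- The coefficient of `Ψ(X)`, in terms of the elementary symmetric polynomials of `u`. -/
noncomputable def midSym (e1 e3 p w Z X : ℂ) : ℂ :=
  (1 - X ^ 2) * (-(Z + Z⁻¹) * (1 - p * X ^ 2) * (1 - X ^ 2 / p) +
    (e1 + e3 / p) / w * X * (1 + X ^ 2) - (1 + 1 / p) * (e1 + e3 / w ^ 2) * X ^ 2)

/-- The polynomial factor of the telescoping certificate. -/
noncomputable def certPoly (e1 e2 e3 p w Z v N : ℂ) : ℂ :=
  -(1 - p ^ 3 * v ^ 2) * (1 - w * v) / Z +
  (w * v * (Z + Z⁻¹) * (1 - p * v ^ 2) * (1 - p ^ 3 * v ^ 2) + e3 * p * v ^ 3 * (1 - p ^ 2) / w -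
    e3 * v ^ 2 * (1 - p ^ 3 * v ^ 2) + e1 * p ^ 2 * v ^ 2 * (1 - p * v ^ 2)) * N +
  (-(w * v ^ 2 * Z * (w + p ^ 3 * v) * (1 - p * v ^ 2) * (1 - p ^ 3 * v ^ 2)) +
    p ^ 2 * v ^ 3 * (1 + Z ^ 2) * (1 - p * v ^ 2) * (p * v * e3 - w * e1) +
    p * v ^ 3 * Z * e2 * (1 - p ^ 3 * v ^ 2) * (w - p * v)) * N ^ 2 +
  (w ^ 2 * p ^ 3 * v ^ 4 * Z * (1 + Z ^ 2) * (1 - p * v ^ 2) * (1 - p ^ 3 * v ^ 2) -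
    e3 * w * p ^ 3 * v ^ 5 * Z ^ 2 * (1 - p * v ^ 2) +
    e1 * w * p ^ 3 * v ^ 5 * Z ^ 2 * (1 - p ^ 3 * v ^ 2) -
    e1 * w ^ 2 * p ^ 3 * v ^ 6 * Z ^ 2 * (1 - p ^ 2)) * N ^ 3 -
  w ^ 2 * p ^ 4 * v ^ 6 * Z ^ 3 * (1 - p ^ 3 * v ^ 2) * (1 - w * v) * N ^ 4

-- The telescoping identity with the common transcendental factor removed: `N` stands for `p^r`, and
-- the left-hand side collects the summands at `v`, `pv` and `p²v` with the coefficients of the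
-- difference equation. Elementary symmetric functions, with the fourth one fixed as `pw²`, make it
-- a rational identity in eight variables.
set_option maxHeartbeats 4000000 in
theorem certificate (e1 e2 e3 : ℂ) {p w Z : ℂ} (hp : p ≠ 0) (hw : w ≠ 0) (hZ : Z ≠ 0) (v N : ℂ) :
    Z⁻¹ * (1 - p * (p * v) ^ 2) * (1 - w * v * Z ^ 2 * N ^ 2) * (1 - w * v) * (1 - p * v / w) *
        quarticInv e1 e2 e3 p w (p * (w * v * Z * N)) *
        quarticInv e1 e2 e3 p w (p ^ 2 * (w * v * Z * N)) +
      Z * pairPoly e1 e2 e3 p w (p * v) * (1 - (p * v) ^ 2 / p) * N ^ 2 *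
        (1 - p ^ 2 * (w * v * Z ^ 2) * N ^ 2) * (1 - w * v * N) * (1 - p * (w * v) * N) *
        (1 - p * (w * v * Z ^ 2) * N) * (1 - w * v * Z ^ 2 * N) +
      midSym e1 e3 p w Z (p * v) * N * (1 - p * (w * v * Z ^ 2) * N ^ 2) * (1 - w * v * N) *
        (1 - w * v * Z ^ 2 * N) * quarticInv e1 e2 e3 p w (p ^ 2 * (w * v * Z * N)) =
    p * v / w * quartic e1 e2 e3 p w (Z * N) * (1 - w * v * N) * (1 - w * v * Z ^ 2 * N) *
        certPoly e1 e2 e3 p w Z v (p * N) -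
      (1 - N) * (1 - Z ^ 2 * N) * quarticInv e1 e2 e3 p w (p ^ 2 * (w * v * Z * N)) *
        certPoly e1 e2 e3 p w Z v N := by
  unfold quarticInv quartic pairPoly midSym certPoly
  field_simp
  ring

end AskeyWilson

/-! ### Shifts in `X` and in the summation index of the very-well-poised terms -/

namespace AskeyWilson

open Filter Topology

theorem exists_norm_inv_qPoch_le {a p : ℂ} (hp : ‖p‖ < 1) (h : ∀ i : ℕ, 1 - a * p ^ i ≠ 0) :
    ∃ C, ∀ r, ‖(qPoch a p r)⁻¹‖ ≤ C := by
  have ht := (tendsto_qPoch a hp).inv₀ (qPochInf_ne_zero hp h)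
  obtain ⟨C, hC⟩ := (Metric.isBounded_range_of_tendsto _ ht).exists_norm_le
  exact ⟨C, fun r => hC _ (Set.mem_range_self r)⟩

theorem one_sub_mul_pow_ne_zero {a p : ℂ} (hp : ‖p‖ < 1) (ha : ‖a‖ < 1) (i : ℕ) :
    1 - a * p ^ i ≠ 0 := by
  intro h
  have h1 : ‖a * p ^ i‖ < 1 := by
    rw [norm_mul, norm_pow]
    exact (mul_le_of_le_one_right (norm_nonneg a) (pow_le_one₀ (norm_nonneg p) hp.le)).trans_lt ha
  rw [← sub_eq_zero.1 h] at h1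
  simp at h1

theorem qPoch_ne_zero {a p : ℂ} (h : ∀ i : ℕ, 1 - a * p ^ i ≠ 0) (r : ℕ) : qPoch a p r ≠ 0 :=
  Finset.prod_ne_zero_iff.2 fun i _ => h i

/-- `(1 - a) (a p; p)_r = (a; p)_r (1 - a p^r)`. -/
theorem one_sub_mul_qPoch (a p : ℂ) (r : ℕ) :
    (1 - a) * qPoch (a * p) p r = qPoch a p r * (1 - a * p ^ r) := by
  rw [← qPoch_succ', qPoch_succ]

/-- The `r`-th term of the very-well-poised series, multiplied by its prefactor and by
`(wXZ²; p)_∞`. -/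
noncomputable def regTerm (u : Fin 4 → ℂ) (p w Z X : ℂ) (r : ℕ) : ℂ :=
  (1 - w * X * Z ^ 2 * (p ^ r) ^ 2) * (p * X / w) ^ r * (∏ j, qPoch (u j * Z) p r) *
    qPoch (w * X) p r * qPoch (w * X * Z ^ 2) p r * (qPoch p p r)⁻¹ *
    (∏ j, qPochInf (p ^ (r + 1) * (w * X * Z) / u j) p) *
    qPochInf (p ^ (r + 1) * Z ^ 2) p * qPochInf (p * X / w) p

/-- The common factor of `regTerm` at `v`, `pv` and `p²v`. -/
noncomputable def baseTerm (u : Fin 4 → ℂ) (p w Z v : ℂ) (r : ℕ) : ℂ :=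
  (p * v / w) ^ r * (∏ j, qPoch (u j * Z) p r) *
    qPoch (w * v) p r * qPoch (w * v * Z ^ 2) p r * (qPoch p p r)⁻¹ *
    (∏ j, qPochInf (p ^ (r + 3) * (w * v * Z) / u j) p) *
    qPochInf (p ^ (r + 1) * Z ^ 2) p * qPochInf (p ^ 3 * v / w) p

theorem prod_qPochInf_div {p : ℂ} (hp : ‖p‖ < 1) (u : Fin 4 → ℂ) (T : ℂ) :
    ∏ j, qPochInf (T / u j) p = (∏ j, (1 - T / u j)) * ∏ j, qPochInf (p * T / u j) p := by
  rw [← Finset.prod_mul_distrib]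
  refine Finset.prod_congr rfl fun j _ => ?_
  rw [qPochInf_eq_one_sub_mul _ hp, show T / u j * p = p * T / u j by ring]

/-- This and the next two lemmas write the summands at `v`, `pv` and `p²v` as explicit elementary
multiples of one `baseTerm`, so that only rational identities remain. -/
theorem regTerm_eq {p : ℂ} (hp : ‖p‖ < 1) (u : Fin 4 → ℂ) (w Z v : ℂ) (r : ℕ) :
    regTerm u p w Z v r = (1 - w * v * Z ^ 2 * (p ^ r) ^ 2) * (1 - p * v / w) *
      (1 - p * (p * v) / w) * (∏ j, (1 - p * (w * v * Z * p ^ r) / u j)) *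
      (∏ j, (1 - p ^ 2 * (w * v * Z * p ^ r) / u j)) * baseTerm u p w Z v r := by
  rw [regTerm, baseTerm,
    show p ^ (r + 1) * (w * v * Z) = p * (w * v * Z * p ^ r) by ring,
    prod_qPochInf_div hp, show p * (p * (w * v * Z * p ^ r)) = p ^ 2 * (w * v * Z * p ^ r) by ring,
    prod_qPochInf_div hp, show p * (p ^ 2 * (w * v * Z * p ^ r)) = p ^ (r + 3) * (w * v * Z) by ring,
    qPochInf_eq_one_sub_mul (p * v / w) hp, show p * v / w * p = p * (p * v) / w by ring,
    qPochInf_eq_one_sub_mul (p * (p * v) / w) hp,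
    show p * (p * v) / w * p = p ^ 3 * v / w by ring]
  ring

/-- The shifts of `(wX;p)_r` and `(wXZ²;p)_r` would introduce the denominators `1 - wv` and `1 -
wvZ²`; these are kept as factors on the left. -/
theorem regTerm_mul_eq {p : ℂ} (hp : ‖p‖ < 1) (u : Fin 4 → ℂ) (w Z v : ℂ) (r : ℕ) :
    (1 - w * v) * (1 - w * v * Z ^ 2) * regTerm u p w Z (p * v) r =
      (1 - p * (p * v) / w) * (p ^ r * (1 - p * (w * v * Z ^ 2) * (p ^ r) ^ 2) *
        (1 - w * v * p ^ r) * (1 - w * v * Z ^ 2 * p ^ r) *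
        (∏ j, (1 - p ^ 2 * (w * v * Z * p ^ r) / u j))) * baseTerm u p w Z v r := by
  have h1 := one_sub_mul_qPoch (w * v) p r
  have h2 := one_sub_mul_qPoch (w * v * Z ^ 2) p r
  rw [regTerm, baseTerm,
    show p ^ (r + 1) * (w * (p * v) * Z) = p ^ 2 * (w * v * Z * p ^ r) by ring,
    prod_qPochInf_div hp, show p * (p ^ 2 * (w * v * Z * p ^ r)) = p ^ (r + 3) * (w * v * Z) by ring,
    qPochInf_eq_one_sub_mul (p * (p * v) / w) hp,
    show p * (p * v) / w * p = p ^ 3 * v / w by ring,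
    show w * (p * v) * Z ^ 2 = w * v * Z ^ 2 * p by ring, show w * (p * v) = w * v * p by ring,
    show p * (p * v) / w = p * (p * v / w) by ring, mul_pow p (p * v / w) r]
  linear_combination (qPochInf (p ^ (r + 1) * Z ^ 2) p * (1 - p * (p * v / w)) *
    qPochInf (p ^ 3 * v / w) p * (1 - w * v * Z ^ 2 * p * (p ^ r) ^ 2) *
    (p ^ r * (p * v / w) ^ r) * (∏ j, qPoch (u j * Z) p r) * (qPoch p p r)⁻¹ *
    ((∏ j, (1 - p ^ 2 * (w * v * Z * p ^ r) / u j)) *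
      ∏ j, qPochInf (p ^ (r + 3) * (w * v * Z) / u j) p)) *
    ((1 - w * v * Z ^ 2) * qPoch (w * v * Z ^ 2 * p) p r * h1 +
      qPoch (w * v) p r * (1 - w * v * p ^ r) * h2)

theorem regTerm_mul_mul_eq {p : ℂ} (u : Fin 4 → ℂ) (w Z v : ℂ) (r : ℕ) :
    (1 - w * v) * (1 - p * (w * v)) * ((1 - w * v * Z ^ 2) * (1 - p * (w * v * Z ^ 2))) *
        regTerm u p w Z (p * (p * v)) r =
      ((p ^ r) ^ 2 * (1 - p ^ 2 * (w * v * Z ^ 2) * (p ^ r) ^ 2) *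
        (1 - w * v * p ^ r) * (1 - p * (w * v) * p ^ r) *
        (1 - p * (w * v * Z ^ 2) * p ^ r) * (1 - w * v * Z ^ 2 * p ^ r)) *
        baseTerm u p w Z v r := by
  have h1 : (1 - w * v) * ((1 - p * (w * v)) * qPoch (w * v * p * p) p r) =
      qPoch (w * v) p r * (1 - w * v * p ^ r) * (1 - p * (w * v) * p ^ r) := by
    rw [mul_comm p, one_sub_mul_qPoch, ← mul_assoc, one_sub_mul_qPoch]
  have h2 : (1 - w * v * Z ^ 2) * ((1 - p * (w * v * Z ^ 2)) *
      qPoch (w * v * Z ^ 2 * p * p) p r) = qPoch (w * v * Z ^ 2) p r *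
        (1 - w * v * Z ^ 2 * p ^ r) * (1 - p * (w * v * Z ^ 2) * p ^ r) := by
    rw [mul_comm p, one_sub_mul_qPoch, ← mul_assoc, one_sub_mul_qPoch]
  rw [regTerm, baseTerm,
    show p ^ (r + 1) * (w * (p * (p * v)) * Z) = p ^ (r + 3) * (w * v * Z) by ring,
    show p * (p * (p * v)) / w = p ^ 2 * (p * v / w) by ring, mul_pow (p ^ 2) (p * v / w) r,
    show p ^ 2 * (p * v / w) = p ^ 3 * v / w by ring,
    show w * (p * (p * v)) * Z ^ 2 = w * v * Z ^ 2 * p * p by ring,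
    show w * (p * (p * v)) = w * v * p * p by ring, pow_right_comm p 2 r]
  linear_combination (qPochInf (p ^ (r + 1) * Z ^ 2) p *
    qPochInf (p ^ 3 * v / w) p * (1 - w * v * Z ^ 2 * p * p * (p ^ r) ^ 2) *
    ((p ^ r) ^ 2 * (p * v / w) ^ r) * (∏ j, qPoch (u j * Z) p r) * (qPoch p p r)⁻¹ *
      ∏ j, qPochInf (p ^ (r + 3) * (w * v * Z) / u j) p) *
    ((1 - w * v * Z ^ 2) * ((1 - p * (w * v * Z ^ 2)) * qPoch (w * v * Z ^ 2 * p * p) p r) * h1 +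
      qPoch (w * v) p r * (1 - w * v * p ^ r) * (1 - p * (w * v) * p ^ r) * h2)

/-- The term ratio in `r`, in cross-multiplied form; its factors are those that accompany `certPoly`
at `pN` and at `N` in `certificate`. -/
theorem baseTerm_succ {p : ℂ} (hp : ‖p‖ < 1) (u : Fin 4 → ℂ) (w Z v : ℂ) (r : ℕ) :
    (1 - p * p ^ r) * (1 - Z ^ 2 * (p * p ^ r)) *
        (∏ j, (1 - p ^ 2 * (w * v * Z * (p * p ^ r)) / u j)) * baseTerm u p w Z v (r + 1) =
      p * v / w * (∏ j, (1 - u j * Z * p ^ r)) * (1 - w * v * p ^ r) *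
        (1 - w * v * Z ^ 2 * p ^ r) * baseTerm u p w Z v r := by
  have hne : 1 - p * p ^ r ≠ 0 := one_sub_mul_pow_ne_zero hp hp r
  have e1 : ∏ j, qPoch (u j * Z) p (r + 1) =
      (∏ j, qPoch (u j * Z) p r) * ∏ j, (1 - u j * Z * p ^ r) := by
    rw [← Finset.prod_mul_distrib]
    exact Finset.prod_congr rfl fun j _ => qPoch_succ _ _ _
  rw [baseTerm, baseTerm, e1, qPoch_succ, qPoch_succ, qPoch_succ,
    show p ^ (r + 3) * (w * v * Z) = p ^ 2 * (w * v * Z * (p * p ^ r)) by ring,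
    prod_qPochInf_div hp u (p ^ 2 * (w * v * Z * (p * p ^ r))),
    show p * (p ^ 2 * (w * v * Z * (p * p ^ r))) = p ^ (r + 1 + 3) * (w * v * Z) by ring,
    show p ^ (r + 1) * Z ^ 2 = Z ^ 2 * (p * p ^ r) by ring,
    qPochInf_eq_one_sub_mul (Z ^ 2 * (p * p ^ r)) hp,
    show Z ^ 2 * (p * p ^ r) * p = p ^ (r + 1 + 1) * Z ^ 2 by ring, mul_inv, pow_succ (p * v / w)]
  generalize ∏ j, (1 - p ^ 2 * (w * v * Z * (p * p ^ r)) / u j) = A₁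
  generalize ∏ j, qPochInf (p ^ (r + 1 + 3) * (w * v * Z) / u j) p = A₂
  generalize qPochInf (p ^ (r + 1 + 1) * Z ^ 2) p = A₃
  generalize ∏ j, (1 - u j * Z * p ^ r) = A₄
  generalize ∏ j, qPoch (u j * Z) p r = A₅
  generalize p * v / w = y
  have hinv : (1 - p ^ r * p) * (1 - p ^ r * p)⁻¹ = 1 := by
    rw [mul_comm (p ^ r) p]
    exact mul_inv_cancel₀ hne
  rw [mul_comm p (p ^ r)]
  generalize (1 - p ^ r * p)⁻¹ = i at hinv ⊢
  linear_combination ((1 - Z ^ 2 * (p ^ r * p)) * A₁ * (y ^ r * y * (A₅ * A₄) *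
    (qPoch (w * v) p r * (1 - w * v * p ^ r)) *
    (qPoch (w * v * Z ^ 2) p r * (1 - w * v * Z ^ 2 * p ^ r)) * (qPoch p p r)⁻¹ * A₂ * A₃ *
    qPochInf (p ^ 3 * v / w) p)) * hinv

end AskeyWilson

/-! ### Convergence of the regularized series and its contiguous relation -/

namespace AskeyWilson

open Filter Topology

/-- Every factor except `(pX/w)^r` is bounded uniformly in `r` and in `|X| ≤ ρ`, because absorbing
the prefactor has left `(p;p)_r` as the only denominator depending on `r`. -/
theorem exists_norm_regTerm_le {p : ℂ} (hp : ‖p‖ < 1) (u : Fin 4 → ℂ) (w Z : ℂ) {ρ : ℝ}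
    (hρ : 0 ≤ ρ) : ∃ C, ∀ X, ‖X‖ ≤ ρ → ∀ r, ‖regTerm u p w Z X r‖ ≤ C * (‖p / w‖ * ρ) ^ r := by
  obtain ⟨C₀, hC₀⟩ := exists_norm_inv_qPoch_le hp (one_sub_mul_pow_ne_zero hp hp)
  have hC₀0 : 0 ≤ C₀ := (norm_nonneg _).trans (hC₀ 0)
  set E : ℝ → ℝ := fun R => Real.exp (R / (1 - ‖p‖)) with hE
  have hE0 : ∀ R, 0 ≤ E R := fun R => (Real.exp_pos _).le
  have hpow : ∀ n, ‖p ^ n‖ ≤ 1 := fun n => by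
    rw [norm_pow]; exact pow_le_one₀ (norm_nonneg p) hp.le
  refine ⟨(1 + ‖w‖ * ρ * ‖Z‖ ^ 2) * (∏ j, E ‖u j * Z‖) * E (‖w‖ * ρ) * E (‖w‖ * ρ * ‖Z‖ ^ 2) * C₀ *
    (∏ j, E (‖w‖ * ρ * ‖Z‖ / ‖u j‖)) * E (‖Z‖ ^ 2) * E (‖p / w‖ * ρ), fun X hX r => ?_⟩
  have b1 : ‖1 - w * X * Z ^ 2 * (p ^ r) ^ 2‖ ≤ 1 + ‖w‖ * ρ * ‖Z‖ ^ 2 := by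
    refine (norm_sub_le _ _).trans ?_
    rw [norm_one, norm_mul, norm_mul, norm_mul, norm_pow, ← pow_mul]
    refine add_le_add le_rfl ?_
    have := hpow (r * 2)
    calc ‖w‖ * ‖X‖ * ‖Z‖ ^ 2 * ‖p ^ (r * 2)‖ ≤ ‖w‖ * ρ * ‖Z‖ ^ 2 * 1 := by gcongr
      _ = _ := mul_one _
  have b2 : ‖∏ j, qPoch (u j * Z) p r‖ ≤ ∏ j, E ‖u j * Z‖ := by
    rw [norm_prod]
    exact Finset.prod_le_prod (fun _ _ => norm_nonneg _) fun j _ => norm_qPoch_le_of_le hp le_rfl r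
  have b3 : ‖qPoch (w * X) p r‖ ≤ E (‖w‖ * ρ) :=
    norm_qPoch_le_of_le hp (by rw [norm_mul]; gcongr) r
  have b4 : ‖qPoch (w * X * Z ^ 2) p r‖ ≤ E (‖w‖ * ρ * ‖Z‖ ^ 2) :=
    norm_qPoch_le_of_le hp (by rw [norm_mul, norm_mul, norm_pow]; gcongr) r
  have b5 : ‖∏ j, qPochInf (p ^ (r + 1) * (w * X * Z) / u j) p‖ ≤
      ∏ j, E (‖w‖ * ρ * ‖Z‖ / ‖u j‖) := by
    rw [norm_prod]
    refine Finset.prod_le_prod (fun _ _ => norm_nonneg _) fun j _ => norm_qPochInf_le_of_le hp ?_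
    rw [norm_div, norm_mul, norm_mul, norm_mul]
    have := hpow (r + 1)
    refine div_le_div_of_nonneg_right ?_ (norm_nonneg _)
    calc ‖p ^ (r + 1)‖ * (‖w‖ * ‖X‖ * ‖Z‖) ≤ 1 * (‖w‖ * ρ * ‖Z‖) := by gcongr
      _ = _ := one_mul _
  have b6 : ‖qPochInf (p ^ (r + 1) * Z ^ 2) p‖ ≤ E (‖Z‖ ^ 2) := by
    refine norm_qPochInf_le_of_le hp ?_
    rw [norm_mul, norm_pow Z]
    exact mul_le_of_le_one_left (by positivity) (hpow _)
  have b7' : ‖p * X / w‖ ≤ ‖p / w‖ * ρ := by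
    rw [show p * X / w = p / w * X by ring, norm_mul]
    gcongr
  have b7 : ‖qPochInf (p * X / w) p‖ ≤ E (‖p / w‖ * ρ) := norm_qPochInf_le_of_le hp b7'
  have hprod : ∀ f : Fin 4 → ℝ, 0 ≤ ∏ j, E (f j) := fun f => Finset.prod_nonneg fun _ _ => hE0 _
  have := hC₀ r
  have h1 := hE0 (‖w‖ * ρ)
  have h2 := hE0 (‖w‖ * ρ * ‖Z‖ ^ 2)
  have h3 := hE0 (‖Z‖ ^ 2)
  have h4 := hprod fun j => ‖u j * Z‖
  have h5 := hprod fun j => ‖w‖ * ρ * ‖Z‖ / ‖u j‖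
  calc ‖regTerm u p w Z X r‖ ≤ (1 + ‖w‖ * ρ * ‖Z‖ ^ 2) * (‖p / w‖ * ρ) ^ r *
        (∏ j, E ‖u j * Z‖) * E (‖w‖ * ρ) * E (‖w‖ * ρ * ‖Z‖ ^ 2) * C₀ *
        (∏ j, E (‖w‖ * ρ * ‖Z‖ / ‖u j‖)) * E (‖Z‖ ^ 2) * E (‖p / w‖ * ρ) := by
        rw [regTerm, norm_mul, norm_mul, norm_mul, norm_mul, norm_mul, norm_mul, norm_mul, norm_mul,
          norm_pow (p * X / w)]
        gcongr
    _ = _ := by ring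

theorem summable_regTerm {p w : ℂ} (hp : ‖p‖ < 1) (u : Fin 4 → ℂ) (Z : ℂ) {X : ℂ}
    (hX : ‖p / w * X‖ < 1) : Summable (regTerm u p w Z X) := by
  obtain ⟨C, hC⟩ := exists_norm_regTerm_le hp u w Z (norm_nonneg X)
  refine Summable.of_norm_bounded (g := fun r => C * (‖p / w‖ * ‖X‖) ^ r) ?_ (hC X le_rfl)
  refine (summable_geometric_of_lt_one (by positivity) ?_).mul_left C
  rwa [← norm_mul]

/-- The very-well-poised series multiplied by its prefactor and by `(wXZ²; p)_∞`. -/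
noncomputable def regSum (u : Fin 4 → ℂ) (p w Z X : ℂ) : ℂ := ∑' r, regTerm u p w Z X r

theorem differentiable_regTerm {p : ℂ} (hp : ‖p‖ < 1) (u : Fin 4 → ℂ) (w Z : ℂ) (r : ℕ) :
    Differentiable ℂ fun X => regTerm u p w Z X r := by
  have h1 : ∀ f : ℂ → ℂ, Differentiable ℂ f → Differentiable ℂ fun X => qPochInf (f X) p :=
    fun f hf => (differentiable_qPochInf hp).comp hf
  have h2 : ∀ f : ℂ → ℂ, Differentiable ℂ f → Differentiable ℂ fun X => qPoch (f X) p r :=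
    fun f hf => (differentiable_qPoch p r).comp hf
  unfold regTerm
  have a1 := h2 (fun X => w * X) (by fun_prop)
  have a2 := h2 (fun X => w * X * Z ^ 2) (by fun_prop)
  have a3 : Differentiable ℂ fun X => ∏ j, qPochInf (p ^ (r + 1) * (w * X * Z) / u j) p :=
    Differentiable.fun_finsetProd fun j _ => h1 _ (by simp only [div_eq_mul_inv]; fun_prop)
  have a4 := h1 (fun X => p * X / w) (by simp only [div_eq_mul_inv]; fun_prop)
  have a5 : Differentiable ℂ fun X : ℂ => (p * X / w) ^ r := by
    simp only [div_eq_mul_inv]; fun_prop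
  fun_prop

theorem differentiableOn_regSum {p w : ℂ} (hp : ‖p‖ < 1) (u : Fin 4 → ℂ) (Z : ℂ) :
    DifferentiableOn ℂ (regSum u p w Z) {X | ‖p / w * X‖ < 1} := by
  intro X hX
  have hX' : ‖p / w‖ * ‖X‖ < 1 := by simpa using hX
  obtain ⟨ρ, hρX, hρ⟩ : ∃ ρ, ‖X‖ < ρ ∧ ‖p / w‖ * ρ < 1 := by
    have hc : ContinuousAt (fun ρ : ℝ => ‖p / w‖ * ρ) ‖X‖ := by fun_prop
    have := (hc.eventually_lt continuousAt_const hX').filter_mono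
      (nhdsWithin_le_nhds (s := Set.Ioi ‖X‖))
    obtain ⟨ρ, h1, h2⟩ := (this.and self_mem_nhdsWithin).exists
    exact ⟨ρ, h2, h1⟩
  have hρ0 : 0 ≤ ρ := (norm_nonneg X).trans hρX.le
  obtain ⟨C, hC⟩ := exists_norm_regTerm_le hp u w Z hρ0
  have hd : DifferentiableOn ℂ (fun X => ∑' r, regTerm u p w Z X r) (Metric.ball 0 ρ) :=
    Complex.differentiableOn_tsum_of_summable_norm
      ((summable_geometric_of_lt_one (by positivity) hρ).mul_left C)
      (fun r => (differentiable_regTerm hp u w Z r).differentiableOn) Metric.isOpen_ball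
      fun r Y hY => hC Y (by simpa using (Metric.mem_ball.1 hY).le) r
  exact (hd.differentiableAt (Metric.isOpen_ball.mem_nhds (by simpa using hρX))).differentiableWithinAt

theorem prod_one_sub_div {u : Fin 4 → ℂ} {p w : ℂ} (hp : p ≠ 0) (hw : w ≠ 0)
    (hu : u 0 * u 1 * u 2 * u 3 = p * w ^ 2) (T : ℂ) :
    ∏ j, (1 - T / u j) = quarticInv (u 0 + u 1 + u 2 + u 3)
      (u 0 * u 1 + u 0 * u 2 + u 0 * u 3 + u 1 * u 2 + u 1 * u 3 + u 2 * u 3)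
      (u 0 * u 1 * u 2 + u 0 * u 1 * u 3 + u 0 * u 2 * u 3 + u 1 * u 2 * u 3) p w T := by
  have h : u 0 * u 1 * u 2 * u 3 ≠ 0 := by rw [hu]; positivity
  simp only [mul_ne_zero_iff] at h
  obtain ⟨⟨⟨h0, h1⟩, h2⟩, h3⟩ := h
  rw [Fin.prod_univ_four, quarticInv, ← hu]
  field_simp
  ring

theorem prod_one_sub_mul {u : Fin 4 → ℂ} {p w : ℂ}
    (hu : u 0 * u 1 * u 2 * u 3 = p * w ^ 2) (T : ℂ) :
    ∏ j, (1 - T * u j) = quartic (u 0 + u 1 + u 2 + u 3)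
      (u 0 * u 1 + u 0 * u 2 + u 0 * u 3 + u 1 * u 2 + u 1 * u 3 + u 2 * u 3)
      (u 0 * u 1 * u 2 + u 0 * u 1 * u 3 + u 0 * u 2 * u 3 + u 1 * u 2 * u 3) p w T := by
  rw [Fin.prod_univ_four, quartic, ← hu]
  ring

theorem tendsto_baseTerm {p w : ℂ} (hp : ‖p‖ < 1) (u : Fin 4 → ℂ) (Z : ℂ) {v : ℂ}
    (hv : ‖p * v / w‖ < 1) : Tendsto (baseTerm u p w Z v) atTop (𝓝 0) := by
  have hpow : Tendsto (fun r : ℕ => p ^ r) atTop (𝓝 0) := tendsto_pow_atTop_nhds_zero_of_norm_lt_one hp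
  have hc : Continuous fun a => qPochInf a p := (differentiable_qPochInf hp).continuous
  have h1 : Tendsto (fun r : ℕ => (p * v / w) ^ r) atTop (𝓝 0) :=
    tendsto_pow_atTop_nhds_zero_of_norm_lt_one hv
  have h2 : Tendsto (fun r => ∏ j, qPoch (u j * Z) p r) atTop (𝓝 (∏ j, qPochInf (u j * Z) p)) :=
    tendsto_finsetProd _ fun j _ => tendsto_qPoch _ hp
  have h3 := tendsto_qPoch (w * v) hp
  have h4 := tendsto_qPoch (w * v * Z ^ 2) hp
  have h5 := (tendsto_qPoch p hp).inv₀ (qPochInf_ne_zero hp (one_sub_mul_pow_ne_zero hp hp))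
  have h6 : ∀ (k : ℕ) (c : ℂ), Tendsto (fun r => qPochInf (p ^ (r + k) * c) p) atTop (𝓝 1) := by
    intro k c
    have : Tendsto (fun r => p ^ (r + k) * c) atTop (𝓝 0) := by
      simpa using (hpow.comp (tendsto_add_atTop_nat k)).mul_const c
    have h := (hc.tendsto 0).comp this
    rwa [qPochInf_zero] at h
  have h7 : Tendsto (fun r => ∏ j, qPochInf (p ^ (r + 3) * (w * v * Z) / u j) p) atTop
      (𝓝 (∏ _j : Fin 4, 1)) :=
    tendsto_finsetProd _ fun j _ => by simpa [mul_div_assoc] using h6 3 (w * v * Z / u j)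
  have := (((((((h1.mul h2).mul h3).mul h4).mul h5).mul h7).mul (h6 1 (Z ^ 2))).mul_const
    (qPochInf (p ^ 3 * v / w) p))
  simp only [zero_mul] at this
  exact this

/-- The contiguous relation satisfied by the very-well-poised series. -/
theorem regSum_equation {u : Fin 4 → ℂ} {p w Z v : ℂ} (hp : ‖p‖ < 1) (hp0 : p ≠ 0) (hw : w ≠ 0)
    (hZ : Z ≠ 0) (hu : u 0 * u 1 * u 2 * u 3 = p * w ^ 2) (hv : ‖p * v / w‖ < 1)
    (hwv : 1 - w * v ≠ 0) :
    Z * (pairPoly (u 0 + u 1 + u 2 + u 3)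
      (u 0 * u 1 + u 0 * u 2 + u 0 * u 3 + u 1 * u 2 + u 1 * u 3 + u 2 * u 3)
      (u 0 * u 1 * u 2 + u 0 * u 1 * u 3 + u 0 * u 2 * u 3 + u 1 * u 2 * u 3) p w (p * v) *
      (1 - p * (p * v) / w) * (1 - p * (w * v)) * (1 - (p * v) ^ 2 / p)) *
        ((1 - w * v * Z ^ 2) * (1 - p * (w * v * Z ^ 2)) * regSum u p w Z (p * (p * v))) +
      Z⁻¹ * (1 - p * (p * v) ^ 2) * regSum u p w Z v +
      midSym (u 0 + u 1 + u 2 + u 3)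
        (u 0 * u 1 * u 2 + u 0 * u 1 * u 3 + u 0 * u 2 * u 3 + u 1 * u 2 * u 3) p w Z (p * v) *
        ((1 - w * v * Z ^ 2) * regSum u p w Z (p * v)) = 0 := by
  set e1 := u 0 + u 1 + u 2 + u 3 with he1
  set e2 := u 0 * u 1 + u 0 * u 2 + u 0 * u 3 + u 1 * u 2 + u 1 * u 3 + u 2 * u 3 with he2
  set e3 := u 0 * u 1 * u 2 + u 0 * u 1 * u 3 + u 0 * u 2 * u 3 + u 1 * u 2 * u 3 with he3
  have hv0 : ‖p / w * v‖ < 1 := by rwa [show p / w * v = p * v / w by ring]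
  have hv1 : ‖p / w * (p * v)‖ < 1 := by
    rw [show p / w * (p * v) = p * (p / w * v) by ring, norm_mul]
    nlinarith [norm_nonneg p, norm_nonneg (p / w * v)]
  have hv2 : ‖p / w * (p * (p * v))‖ < 1 := by
    rw [show p / w * (p * (p * v)) = p * (p / w * (p * v)) by ring, norm_mul]
    nlinarith [norm_nonneg p, norm_nonneg (p / w * (p * v))]
  -- The antidifference. Its factor `1 - p^r` gives `c 0 = 0`, and it tends to `0` with `baseTerm`,
  -- so no boundary term survives.
  set c : ℕ → ℂ := fun r => (1 - p ^ r) * (1 - Z ^ 2 * p ^ r) *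
    quarticInv e1 e2 e3 p w (p ^ 2 * (w * v * Z * p ^ r)) * certPoly e1 e2 e3 p w Z v (p ^ r) *
    baseTerm u p w Z v r with hc
  have hterm : ∀ r, (1 - w * v) * (Z * (pairPoly e1 e2 e3 p w (p * v) *
      (1 - p * (p * v) / w) * (1 - p * (w * v)) * (1 - (p * v) ^ 2 / p)) *
        ((1 - w * v * Z ^ 2) * (1 - p * (w * v * Z ^ 2)) * regTerm u p w Z (p * (p * v)) r) +
      Z⁻¹ * (1 - p * (p * v) ^ 2) * regTerm u p w Z v r +
      midSym e1 e3 p w Z (p * v) * ((1 - w * v * Z ^ 2) * regTerm u p w Z (p * v) r)) =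
      (1 - p * (p * v) / w) * (c (r + 1) - c r) := by
    intro r
    have t0 := regTerm_eq hp u w Z v r
    have t1 := regTerm_mul_eq hp u w Z v r
    have t2 := regTerm_mul_mul_eq (p := p) u w Z v r
    have t3 := baseTerm_succ hp u w Z v r
    have t4 := certificate e1 e2 e3 hp0 hw hZ v (p ^ r)
    have hq : ∏ j, (1 - u j * Z * p ^ r) = quartic e1 e2 e3 p w (Z * p ^ r) := by
      rw [← prod_one_sub_mul hu]
      exact Finset.prod_congr rfl fun j _ => by ring
    rw [prod_one_sub_div hp0 hw hu, prod_one_sub_div hp0 hw hu] at t0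
    rw [prod_one_sub_div hp0 hw hu] at t1
    rw [prod_one_sub_div hp0 hw hu, hq] at t3
    simp only [hc, pow_succ' p r]
    rw [t0]
    linear_combination (Z * pairPoly e1 e2 e3 p w (p * v) * (1 - p * (p * v) / w) *
        (1 - (p * v) ^ 2 / p)) * t2 +
      midSym e1 e3 p w Z (p * v) * t1 +
      (1 - p * (p * v) / w) * baseTerm u p w Z v r * t4 -
      (1 - p * (p * v) / w) * certPoly e1 e2 e3 p w Z v (p * p ^ r) * t3
  have hsum := ((((summable_regTerm hp u Z hv2).hasSum.mul_left
    ((1 - w * v * Z ^ 2) * (1 - p * (w * v * Z ^ 2)))).mul_left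
      (Z * (pairPoly e1 e2 e3 p w (p * v) *
      (1 - p * (p * v) / w) * (1 - p * (w * v)) * (1 - (p * v) ^ 2 / p)))).add
    ((summable_regTerm hp u Z hv0).hasSum.mul_left (Z⁻¹ * (1 - p * (p * v) ^ 2)))).add
    (((summable_regTerm hp u Z hv1).hasSum.mul_left (1 - w * v * Z ^ 2)).mul_left
      (midSym e1 e3 p w Z (p * v))) |>.mul_left (1 - w * v)
  simp only [hterm] at hsum
  have hc0 : c 0 = 0 := by simp [hc]
  have hpow : Tendsto (fun r : ℕ => p ^ r) atTop (𝓝 0) :=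
    tendsto_pow_atTop_nhds_zero_of_norm_lt_one hp
  have hcl : Tendsto c atTop (𝓝 0) := by
    have hF : Continuous fun N : ℂ => (1 - N) * (1 - Z ^ 2 * N) *
        quarticInv e1 e2 e3 p w (p ^ 2 * (w * v * Z * N)) * certPoly e1 e2 e3 p w Z v N := by
      unfold quarticInv certPoly
      simp only [div_eq_mul_inv]
      fun_prop
    have := ((hF.tendsto 0).comp hpow).mul (tendsto_baseTerm hp u Z hv)
    simpa [hc] using this
  have hlim := hsum.tendsto_sum_nat
  simp only [← Finset.mul_sum, Finset.sum_range_sub, hc0, sub_zero] at hlim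
  have hlim0 : Tendsto (fun n => (1 - p * (p * v) / w) * c n) atTop (𝓝 0) := by
    simpa using hcl.const_mul (1 - p * (p * v) / w)
  have := tendsto_nhds_unique hlim hlim0
  -- The factor `1 - wv` came from clearing the shift of `(wX;p)_r`, and is removed only here.
  exact (mul_eq_zero.1 this).resolve_left hwv

end AskeyWilson

/-! ### The Askey–Wilson data, and the formal solution as a very-well-poised series -/

namespace AskeyWilson

open Filter Topology Polynomial

/-- The gauged Askey--Wilson equation with parameters `a, b, c, d`, where `abcd = p t²`. -/
noncomputable def awData {p a b c d t : ℂ} (hp : p ≠ 0) (ha : a ≠ 0) (hb : b ≠ 0) (hc : c ≠ 0)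
    (hd : d ≠ 0) (ht : t ≠ 0) : GaugedData p where
  Q := ((1 - C a * X) * (1 - C b * X) * (1 - C c * X) * (1 - C d * X)) *
    ((1 - C (p / a) * X) * (1 - C (p / b) * X) * (1 - C (p / c) * X) * (1 - C (p / d) * X)) *
    (1 - C p⁻¹ * X ^ 2)
  K := C (t + t⁻¹) * polyS p -
    C t⁻¹ * ((1 - C a * X) * (1 - C b * X) * (1 - C c * X) * (1 - C d * X)) *
      (1 - C p⁻¹ * X ^ 2) -
    C t * ((1 - C a⁻¹ * X) * (1 - C b⁻¹ * X) * (1 - C c⁻¹ * X) * (1 - C d⁻¹ * X)) *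
      (1 - C p * X ^ 2)
  Q_zero := by simp [coeff_zero_eq_eval_zero]
  K_zero := by simp [coeff_zero_eq_eval_zero, polyS]
  root := by
    rintro r rfl
    have : r ≠ 0 := by rintro rfl; simp at hp
    simp [this]
  -- At `r` the factor `1 - X²/p` vanishes, so `K(r) = -t ∏(1 - r/a)(1 - p²)`; at `r⁻¹` the factor
  -- `1 - pX²` vanishes, so `K(r⁻¹) = -t⁻¹ ∏(1 - a/r)(1 - p⁻²)`, the products running over `a, b, c,
  -- d`. Since `p/(ar) = r/a`, their product is `Q(r⁻¹)(1 - p²)`.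
  cross := by
    rintro r rfl
    have hr : r ≠ 0 := by rintro rfl; simp at hp
    obtain ⟨h1, h2⟩ := GaugedData.eval_polyS_eq_zero rfl hr
    simp only [eval_mul, eval_sub, eval_C, eval_X, eval_one, eval_pow, h1, h2]
    field_simp
    ring

section

variable {p a b c d t : ℂ} (hp : p ≠ 0) (ha : a ≠ 0) (hb : b ≠ 0) (hc : c ≠ 0) (hd : d ≠ 0)
  (ht : t ≠ 0)

theorem eval_awData_Q (x : ℂ) : (awData hp ha hb hc hd ht).Q.eval x =
    ((1 - a * x) * (1 - b * x) * (1 - c * x) * (1 - d * x)) *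
    ((1 - p / a * x) * (1 - p / b * x) * (1 - p / c * x) * (1 - p / d * x)) *
    (1 - p⁻¹ * x ^ 2) := by
  simp [awData]

theorem eval_awData_mid (Z x : ℂ) : ((awData hp ha hb hc hd ht).mid Z).eval x =
    (t + t⁻¹ - Z - Z⁻¹) * ((1 - x ^ 2) * (1 - p * x ^ 2) * (1 - p⁻¹ * x ^ 2)) -
    t⁻¹ * ((1 - a * x) * (1 - b * x) * (1 - c * x) * (1 - d * x)) * (1 - p⁻¹ * x ^ 2) -
    t * ((1 - a⁻¹ * x) * (1 - b⁻¹ * x) * (1 - c⁻¹ * x) * (1 - d⁻¹ * x)) * (1 - p * x ^ 2) := by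
  simp only [awData, GaugedData.mid, polyS, eval_sub, eval_mul, eval_C, eval_X, eval_one,
    eval_pow]
  ring

end

/-- The parameters `α_j / Z` of the very-well-poised series. -/
noncomputable def seriesU (p a b c t : ℂ) : Fin 4 → ℂ := ![p / t, b * c / t, a * b / t, a * c / t]

theorem prod_seriesU {p a b c t : ℂ} (ht : t ≠ 0) :
    seriesU p a b c t 0 * seriesU p a b c t 1 * seriesU p a b c t 2 * seriesU p a b c t 3 =
      p * (a * b * c / t ^ 2) ^ 2 := by
  simp [seriesU]
  field_simp

section

variable {p a b c d t : ℂ} (hp : p ≠ 0) (ha : a ≠ 0) (hb : b ≠ 0) (hc : c ≠ 0) (hd : d ≠ 0)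
  (ht : t ≠ 0)

/-- The six quotients `u_i u_j / w` are `a, b, c, p/a, p/b, p/c`; the two linear factors left over
are those of `d = p/w` and `p/d = w`. -/
theorem eval_awData_Q_eq_pairPoly (hrel : a * b * c * d = p * t ^ 2) (x : ℂ) :
    (awData hp ha hb hc hd ht).Q.eval x =
    pairPoly (p / t + b * c / t + a * b / t + a * c / t)
      (p / t * (b * c / t) + p / t * (a * b / t) + p / t * (a * c / t) +
        b * c / t * (a * b / t) + b * c / t * (a * c / t) + a * b / t * (a * c / t))
      (p / t * (b * c / t) * (a * b / t) + p / t * (b * c / t) * (a * c / t) +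
        p / t * (a * b / t) * (a * c / t) + b * c / t * (a * b / t) * (a * c / t))
      p (a * b * c / t ^ 2) x *
      (1 - p * x / (a * b * c / t ^ 2)) * (1 - a * b * c / t ^ 2 * x) * (1 - x ^ 2 / p) := by
  have hd' : d = p * t ^ 2 / (a * b * c) := by rw [← hrel]; field_simp
  have h1 : pairPoly (p / t + b * c / t + a * b / t + a * c / t)
      (p / t * (b * c / t) + p / t * (a * b / t) + p / t * (a * c / t) +
        b * c / t * (a * b / t) + b * c / t * (a * c / t) + a * b / t * (a * c / t))
      (p / t * (b * c / t) * (a * b / t) + p / t * (b * c / t) * (a * c / t) +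
        p / t * (a * b / t) * (a * c / t) + b * c / t * (a * b / t) * (a * c / t))
      p (a * b * c / t ^ 2) x =
      (1 - a * x) * (1 - b * x) * (1 - c * x) *
        ((1 - p / a * x) * (1 - p / b * x) * (1 - p / c * x)) := by
    unfold pairPoly
    field_simp
    ring
  have h2 : p * x / (a * b * c / t ^ 2) = d * x := by rw [hd']; field_simp
  have h3 : a * b * c / t ^ 2 = p / d := by rw [hd']; field_simp
  rw [eval_awData_Q, h1, h2, h3]
  ring

theorem eval_awData_mid_eq_midSym (hrel : a * b * c * d = p * t ^ 2) {Z : ℂ} (hZ : Z ≠ 0) (x : ℂ) :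
    ((awData hp ha hb hc hd ht).mid Z).eval x =
    midSym (p / t + b * c / t + a * b / t + a * c / t)
      (p / t * (b * c / t) * (a * b / t) + p / t * (b * c / t) * (a * c / t) +
        p / t * (a * b / t) * (a * c / t) + b * c / t * (a * b / t) * (a * c / t))
      p (a * b * c / t ^ 2) Z x := by
  have hd' : d = p * t ^ 2 / (a * b * c) := by rw [← hrel]; field_simp
  subst hd'
  rw [eval_awData_mid, midSym]
  field_simp
  ring

end

theorem differentiable_tsum_mul_pow {g : ℕ → ℂ} (hg : ∀ R : ℝ, 0 ≤ R → ∃ A, ∀ n, ‖g n‖ * R ^ n ≤ A) :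
    Differentiable ℂ fun x => ∑' n, g n * x ^ n := by
  intro x
  obtain ⟨A, hA⟩ := hg (2 * (‖x‖ + 1)) (by positivity)
  have hd : DifferentiableOn ℂ (fun x => ∑' n, g n * x ^ n) (Metric.ball 0 (‖x‖ + 1)) := by
    refine Complex.differentiableOn_tsum_of_summable_norm (u := fun n => A * (1 / 2) ^ n)
      (summable_geometric_two.mul_left A) (fun n => by fun_prop) Metric.isOpen_ball
      fun n y hy => ?_
    have hy' : ‖y‖ ≤ ‖x‖ + 1 := by simpa using (Metric.mem_ball.1 hy).le
    rw [norm_mul, norm_pow]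
    calc ‖g n‖ * ‖y‖ ^ n ≤ ‖g n‖ * (‖x‖ + 1) ^ n := by gcongr
      _ = ‖g n‖ * (2 * (‖x‖ + 1)) ^ n * (1 / 2) ^ n := by
        rw [mul_assoc, ← mul_pow]; congr 2; ring
      _ ≤ _ := by gcongr; exact hA n
  exact hd.differentiableAt (Metric.isOpen_ball.mem_nhds (by simp))

theorem regSum_zero (u : Fin 4 → ℂ) (p w Z : ℂ) : regSum u p w Z 0 = qPochInf (p * Z ^ 2) p := by
  rw [regSum, tsum_eq_single 0]
  · simp [regTerm, qPoch_zero, qPochInf_zero]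
  · intro r hr
    simp [regTerm, hr]

/-- Near `X = 0` the quotient of `regSum` by `(wXZ²;p)_∞` is holomorphic, and its Taylor series
solves the difference equation with the constant term of `G`. Nonresonance makes the two formal
series equal. Both sides of the claim are holomorphic for `|pX/w| < 1`, so they agree there. -/
theorem tsum_G_mul_qPochInf {p a b c d t : ℂ} (hp1 : ‖p‖ < 1) (hp : p ≠ 0) (ha : a ≠ 0) (hb : b ≠ 0)
    (hc : c ≠ 0) (hd : d ≠ 0) (ht : t ≠ 0) (hrel : a * b * c * d = p * t ^ 2) {Z : ℂ} (hZ : Z ≠ 0)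
    (hres : ∀ n : ℕ, 0 < n → 1 - p ^ n * Z ^ 2 ≠ 0) {x : ℂ}
    (hx : ‖p / (a * b * c / t ^ 2) * x‖ < 1) :
    (∑' n, (awData hp ha hb hc hd ht).G n Z * x ^ n) * qPochInf (a * b * c / t ^ 2 * x * Z ^ 2) p =
      regSum (seriesU p a b c t) p (a * b * c / t ^ 2) Z x := by
  set D := awData hp ha hb hc hd ht with hD
  set w := a * b * c / t ^ 2 with hw
  have hw0 : w ≠ 0 := by rw [hw]; positivity
  set u := seriesU p a b c t with hu
  have hprod := prod_seriesU (p := p) (a := a) (b := b) (c := c) ht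
  rw [← hu, ← hw] at hprod
  have hqd : Differentiable ℂ fun X : ℂ => qPochInf (w * X * Z ^ 2) p :=
    (differentiable_qPochInf hp1).comp (by fun_prop)
  set F : ℂ → ℂ := fun X => regSum u p w Z X / qPochInf (w * X * Z ^ 2) p with hF
  obtain ⟨δ, hδ, hball⟩ : ∃ δ > 0, ∀ X : ℂ, ‖X‖ < δ →
      ‖p / w * X‖ < 1 ∧ qPochInf (w * X * Z ^ 2) p ≠ 0 ∧ 1 - w * X ≠ 0 := by
    have h1 : ∀ᶠ X : ℂ in 𝓝 0, ‖p / w * X‖ < 1 :=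
      ContinuousAt.eventually_lt (by fun_prop) continuousAt_const (by simp)
    have h2 : ∀ᶠ X : ℂ in 𝓝 0, qPochInf (w * X * Z ^ 2) p ≠ 0 :=
      hqd.continuous.continuousAt.eventually_ne (by simp [qPochInf_zero])
    have h3 : ∀ᶠ X : ℂ in 𝓝 0, 1 - w * X ≠ 0 :=
      ContinuousAt.eventually_ne (by fun_prop) (by simp)
    obtain ⟨δ, hδ, h⟩ := Metric.eventually_nhds_iff.1 (h1.and (h2.and h3))
    exact ⟨δ, hδ, fun X hX => h (by simpa using hX)⟩
  have hFd : DifferentiableOn ℂ F (Metric.ball 0 δ) :=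
    DifferentiableOn.div ((differentiableOn_regSum hp1 u Z).mono fun X hX =>
      (hball X (by simpa using hX)).1) hqd.differentiableOn
      fun X hX => (hball X (by simpa using hX)).2.1
  set f : PowerSeries ℂ := PowerSeries.mk fun n => (n.factorial : ℂ)⁻¹ * iteratedDeriv n F 0 with hf
  have hfe : ∀ X : ℂ, ‖X‖ < δ → HasEval f X (F X) := by
    intro X hX
    have := Complex.hasSum_taylorSeries_on_ball hFd (z := X) (by simpa using hX)
    simp only [smul_eq_mul, sub_zero] at this
    refine this.congr_fun fun n => ?_
    rw [hf, PowerSeries.coeff_mk]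
    ring
  have hop : D.op Z f = 0 := by
    refine eq_zero_of_eventually_hasEval ?_
    have hev : ∀ᶠ X : ℂ in 𝓝 0, ‖p⁻¹ * X‖ < δ :=
      ContinuousAt.eventually_lt (by fun_prop) continuousAt_const (by simpa using hδ)
    filter_upwards [nhdsWithin_le_nhds hev] with X hX
    -- The contiguous relation links `v`, `pv`, `p²v`, while the operator at `X` links `X/p`, `X`,
    -- `pX`. The largest of the three points it needs is `v`, which has to stay in the `δ`-ball.
    set v := p⁻¹ * X with hv
    have hXv : X = p * v := by rw [hv]; field_simp
    have hpv : ∀ y : ℂ, ‖y‖ < δ → ‖p * y‖ < δ := fun y hy => by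
      rw [norm_mul]
      nlinarith [norm_nonneg p, norm_nonneg y]
    have hX1 : ‖X‖ < δ := by rw [hXv]; exact hpv v hX
    have hX2 : ‖p * X‖ < δ := hpv X hX1
    have e := ((hasEval_rescale.2 (hfe _ hX2)).polynomial_mul (C Z * D.Q)).add
      ((hasEval_rescale.2 (hfe _ hX)).polynomial_mul (C Z⁻¹ * (1 - C p * Polynomial.X ^ 2))) |>.add
      ((hfe _ hX1).polynomial_mul (D.mid Z))
    have hb0 := hball v hX
    have hb2 := hball (p * X) hX2
    have key := regSum_equation hp1 hp hw0 hZ hprod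
      (by rw [show p * v / w = p / w * v by ring]; exact hb0.1) hb0.2.2
    -- The ratios of `(wXZ²;p)_∞` at the three points are exactly the factors that multiply `regSum`
    -- in the contiguous relation.
    have hq0 : qPochInf (w * v * Z ^ 2) p = (1 - w * v * Z ^ 2) * (1 - p * (w * v * Z ^ 2)) *
        qPochInf (w * (p * X) * Z ^ 2) p := by
      rw [qPochInf_eq_one_sub_mul _ hp1, qPochInf_eq_one_sub_mul (w * v * Z ^ 2 * p) hp1, hXv]
      ring_nf
    have hq1 : qPochInf (w * X * Z ^ 2) p = (1 - p * (w * v * Z ^ 2)) *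
        qPochInf (w * (p * X) * Z ^ 2) p := by
      rw [qPochInf_eq_one_sub_mul _ hp1, hXv]
      ring_nf
    have hne0 := hb0.2.1
    have hne2 := hb2.2.1
    rw [hq0] at hne0
    have hA : 1 - w * v * Z ^ 2 ≠ 0 := fun h => hne0 (by rw [h]; simp)
    have hB : 1 - p * (w * v * Z ^ 2) ≠ 0 := fun h => hne0 (by rw [h]; simp)
    have hzero : HasEval (D.op Z f) X 0 := by
      have e' : HasEval (D.op Z f) X _ := e
      refine Eq.mp (congrArg (HasEval (D.op Z f) X) ?_) e'
      simp only [hF, eval_mul, eval_sub, eval_C, eval_one, eval_pow, eval_X]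
      rw [← hv, hD, eval_awData_Q_eq_pairPoly hp ha hb hc hd ht hrel,
        eval_awData_mid_eq_midSym hp ha hb hc hd ht hrel hZ, ← hw, hq0, hq1]
      rw [← hXv] at key
      have hu0 : u 0 = p / t := rfl
      have hu1 : u 1 = b * c / t := rfl
      have hu2 : u 2 = a * b / t := rfl
      have hu3 : u 3 = a * c / t := rfl
      rw [hu0, hu1, hu2, hu3] at key
      rw [show p * (w * v) = w * X by rw [hXv]; ring] at key
      generalize pairPoly _ _ _ _ _ _ * _ * _ * _ = A₂ at key ⊢
      generalize midSym _ _ _ _ _ _ = A₁ at key ⊢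
      generalize 1 - w * v * Z ^ 2 = A₃ at key hA ⊢
      generalize 1 - p * (w * v * Z ^ 2) = A₄ at key hB ⊢
      generalize regSum u p w Z (p * X) = s2 at key ⊢
      generalize regSum u p w Z X = s1 at key ⊢
      generalize regSum u p w Z v = s0 at key ⊢
      generalize qPochInf (w * (p * X) * Z ^ 2) p = m at hne2 ⊢
      refine (mul_left_cancel₀ (mul_ne_zero (mul_ne_zero hA hB) hne2) ?_)
      rw [mul_zero, ← key]
      field_simp
    exact hzero
  have hf0 : PowerSeries.coeff 0 f = PowerSeries.coeff 0 (PowerSeries.mk fun n => D.G n Z) := by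
    simp [hf, hF, regSum_zero, qPochInf_zero, D.G_zero]
  have hfG := D.eq_of_op_eq_zero hp hp1 hZ hres hop (D.op_G hp hp1 hZ) hf0
  have hbound : ∀ R : ℝ, 0 ≤ R → ∃ A, ∀ n, ‖D.G n Z‖ * R ^ n ≤ A := by
    intro R hR
    obtain ⟨A, hA⟩ := D.exists_entire_bound hp hp1 (isCompact_singleton (x := Z)) (by simpa using hZ.symm) hR
    exact ⟨A, hA Z rfl⟩
  have hΨ := (differentiable_tsum_mul_pow hbound).mul hqd
  set B := Metric.ball (0 : ℂ) (‖p / w‖⁻¹) with hB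
  have hpw : 0 < ‖p / w‖ := norm_pos_iff.2 (div_ne_zero hp hw0)
  have hBmem : ∀ X : ℂ, X ∈ B ↔ ‖p / w * X‖ < 1 := fun X => by
    rw [hB, Metric.mem_ball, dist_zero_right, norm_mul, inv_eq_one_div, lt_div_iff₀' hpw]
  -- Multiplication by `(wXZ²;p)_∞` removes the poles of the quotient, which is why the identity
  -- theorem is applied on this larger disc to the product.
  have hid : Set.EqOn (fun X => (∑' n, D.G n Z * X ^ n) * qPochInf (w * X * Z ^ 2) p)
      (regSum u p w Z) B := by
    refine AnalyticOnNhd.eqOn_of_preconnected_of_eventuallyEq (z₀ := 0)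
      (hΨ.differentiableOn.analyticOnNhd Metric.isOpen_ball)
      (((differentiableOn_regSum hp1 u Z).mono fun X hX => (hBmem X).1 hX).analyticOnNhd
        Metric.isOpen_ball) (convex_ball _ _).isPreconnected ((hBmem 0).2 (by simp)) ?_
    filter_upwards [Metric.ball_mem_nhds (0 : ℂ) hδ] with X hX
    have hX' : ‖X‖ < δ := by simpa using hX
    have h1 := hfe X hX'
    rw [hfG] at h1
    have h2 : (∑' n, D.G n Z * X ^ n) = F X := by
      simpa [HasEval] using HasSum.tsum_eq h1
    rw [h2, hF]
    exact div_mul_cancel₀ _ (hball X hX').2.1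
  exact hid ((hBmem x).2 hx)

end AskeyWilson

/-! ### Powers of `q`, Hecke parameters, and the gauge transformation -/

namespace AskeyWilson

open Filter Topology Polynomial

theorem qpow_add (τ x y : ℂ) : qpow τ (x + y) = qpow τ x * qpow τ y := by
  rw [qpow, qpow, qpow, ← Complex.exp_add]; ring_nf

theorem qpow_zero (τ : ℂ) : qpow τ 0 = 1 := by simp [qpow]

theorem qpow_ne_zero (τ x : ℂ) : qpow τ x ≠ 0 := Complex.exp_ne_zero _

theorem qpow_neg (τ x : ℂ) : qpow τ (-x) = (qpow τ x)⁻¹ := by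
  rw [qpow, qpow, ← Complex.exp_neg]; ring_nf

theorem qpow_sub (τ x y : ℂ) : qpow τ (x - y) = qpow τ x / qpow τ y := by
  rw [sub_eq_add_neg, qpow_add, qpow_neg, div_eq_mul_inv]

theorem qpow_nat_mul (τ : ℂ) (n : ℕ) (x : ℂ) : qpow τ (n * x) = qpow τ x ^ n := by
  rw [qpow, qpow, ← Complex.exp_nat_mul]; ring_nf

theorem qpow_two_mul (τ x : ℂ) : qpow τ (2 * x) = qpow τ x ^ 2 := by
  simpa using qpow_nat_mul τ 2 x

theorem qpow_add_inv {τ : ℂ} (hτ : τ ≠ 0) (z : ℂ) : qpow τ (z + τ⁻¹) = qpow τ z := by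
  have : qpow τ τ⁻¹ = 1 := by
    rw [qpow, mul_assoc _ τ, mul_inv_cancel₀ hτ, mul_one, Complex.exp_two_pi_mul_I]
  rw [qpow_add, this, mul_one]

theorem exists_qpow_eq {τ : ℂ} (hτ : τ ≠ 0) {X : ℂ} (hX : X ≠ 0) : ∃ x, qpow τ x = X := by
  refine ⟨Complex.log X / (2 * Real.pi * Complex.I * τ), ?_⟩
  have : (2 * Real.pi * Complex.I * τ : ℂ) ≠ 0 := by
    simp [Real.pi_ne_zero, hτ]
  rw [qpow, mul_div_cancel₀ _ this, Complex.exp_log hX]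

theorem differentiable_qpow (τ : ℂ) : Differentiable ℂ (qpow τ) := by
  unfold qpow; fun_prop

theorem norm_qpow_lt_one {τ : ℂ} (hτ : 0 < τ.im) {s : ℝ} (hs : 0 < s) : ‖qpow τ s‖ < 1 := by
  rw [qpow, Complex.norm_exp, Real.exp_lt_one_iff]
  simp
  positivity

section parameters

variable (τ : ℂ) (s : ℝ) (h : HeckeParams)

theorem parA_ne_zero : parA τ h ≠ 0 := qpow_ne_zero _ _
theorem parB_ne_zero : parB τ h ≠ 0 := neg_ne_zero.2 (qpow_ne_zero _ _)
theorem parC_ne_zero : parC τ s h ≠ 0 := qpow_ne_zero _ _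
theorem parD_ne_zero : parD τ s h ≠ 0 := neg_ne_zero.2 (qpow_ne_zero _ _)

theorem qpow_half_sq : qpow τ ((s : ℂ) / 2) ^ 2 = qpow τ s := by
  rw [← qpow_two_mul]; congr 1; ring

theorem parA_mul_parB_mul_parC_mul_parD :
    parA τ h * parB τ h * parC τ s h * parD τ s h = qpow τ s * parA τ h.dual ^ 2 := by
  have h1 := qpow_ne_zero τ h.lam
  have h2 := qpow_ne_zero τ h.varsigma
  simp only [parA, parB, parC, parD, HeckeParams.dual, qpow_add, qpow_sub, ← qpow_half_sq τ s]
  field_simp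

theorem parB_dual : parB τ h.dual = parA τ h * parB τ h / parA τ h.dual := by
  have h1 := qpow_ne_zero τ h.lam
  have h2 := qpow_ne_zero τ h.upsilon
  have h3 := qpow_ne_zero τ h.kappa
  simp only [parA, parB, HeckeParams.dual, qpow_add, qpow_sub]
  field_simp

theorem parC_dual : parC τ s h.dual = parA τ h * parC τ s h / parA τ h.dual := by
  have h1 := qpow_ne_zero τ h.lam
  have h2 := qpow_ne_zero τ h.upsilon
  have h3 := qpow_ne_zero τ h.kappa
  simp only [parA, parC, HeckeParams.dual, qpow_add]
  field_simp

theorem parD_dual : parD τ s h.dual = parA τ h * parD τ s h / parA τ h.dual := by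
  have h1 := qpow_ne_zero τ h.lam
  have h2 := qpow_ne_zero τ h.upsilon
  have h3 := qpow_ne_zero τ h.kappa
  simp only [parA, parD, HeckeParams.dual, qpow_add, qpow_sub]
  field_simp

/-- The gauged Askey--Wilson equation attached to the Hecke parameters. -/
noncomputable def gaugedData : GaugedData (qpow τ s) :=
  awData (qpow_ne_zero τ s) (parA_ne_zero τ h) (parB_ne_zero τ h) (parC_ne_zero τ s h)
    (parD_ne_zero τ s h) (parA_ne_zero τ h.dual)

end parameters

theorem gaugeW_add (τ : ℂ) {s : ℝ} (hs : s ≠ 0) (h : HeckeParams) (x z : ℂ) :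
    gaugeW τ s h (x + s) z = gaugeW τ s h x z * (parA τ h.dual * qpow τ z) := by
  have : (s : ℂ) ≠ 0 := by exact_mod_cast hs
  rw [gaugeW, gaugeW, parA, ← qpow_add, ← qpow_add]
  congr 1
  simp only [HeckeParams.dual]
  field_simp
  ring

theorem gaugeW_sub (τ : ℂ) {s : ℝ} (hs : s ≠ 0) (h : HeckeParams) (x z : ℂ) :
    gaugeW τ s h (x - s) z = gaugeW τ s h x z / (parA τ h.dual * qpow τ z) := by
  have := gaugeW_add τ hs h (x - s) z
  rw [sub_add_cancel] at this
  rw [this, mul_div_cancel_right₀]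
  exact mul_ne_zero (parA_ne_zero _ _) (qpow_ne_zero _ _)

theorem St_eq (τ : ℂ) {s : ℝ} (hp : ‖qpow τ s‖ < 1) (h : HeckeParams) (x : ℂ) :
    St τ s h x = ((1 - qpow τ s / parA τ h * qpow τ x) * (1 - qpow τ s / parB τ h * qpow τ x) *
      (1 - qpow τ s / parC τ s h * qpow τ x) * (1 - qpow τ s / parD τ s h * qpow τ x)) *
        St τ s h (x + s) := by
  have key : ∀ e : ℂ, qPochInf (qpow τ (s + x) / e) (qpow τ s) =
      (1 - qpow τ s / e * qpow τ x) * qPochInf (qpow τ (s + (x + s)) / e) (qpow τ s) := by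
    intro e
    rw [qPochInf_eq_one_sub_mul _ hp, qpow_add, qpow_add, qpow_add]
    ring_nf
  rw [St, St, key, key, key, key]
  ring

theorem St_sub_eq (τ : ℂ) {s : ℝ} (hp : ‖qpow τ s‖ < 1) (h : HeckeParams) (x : ℂ) :
    St τ s h (x - s) = ((1 - (parA τ h)⁻¹ * qpow τ x) * (1 - (parB τ h)⁻¹ * qpow τ x) *
      (1 - (parC τ s h)⁻¹ * qpow τ x) * (1 - (parD τ s h)⁻¹ * qpow τ x)) * St τ s h x := by
  have hne := qpow_ne_zero τ s
  have key : ∀ e : ℂ, qpow τ s / e * qpow τ (x - s) = e⁻¹ * qpow τ x := by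
    intro e
    rw [qpow_sub]
    field_simp
  rw [St_eq τ hp, key, key, key, key, sub_add_cancel]

theorem coeffA_eq (τ : ℂ) (s : ℝ) (h : HeckeParams) (x : ℂ) :
    coeffA τ s h x = ((1 - parA τ h * qpow τ x) * (1 - parB τ h * qpow τ x) *
      (1 - parC τ s h * qpow τ x) * (1 - parD τ s h * qpow τ x)) /
      (parA τ h.dual * ((1 - qpow τ x ^ 2) * (1 - qpow τ s * qpow τ x ^ 2))) := by
  rw [coeffA, qpow_add, qpow_two_mul]
  ring_nf

/-- Reversing each numerator factor by `1 - a/X = -(a/X)(1 - X/a)` produces `abcd·X⁻⁴`, and `abcd =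
p t²`. The new numerator is the one that the shift of `St` cancels. -/
theorem coeffA_neg_eq (τ : ℂ) (s : ℝ) (h : HeckeParams) (x : ℂ)
    (h1 : qpow τ (2 * -x) ≠ 1) (h2 : qpow τ (s + 2 * -x) ≠ 1) :
    coeffA τ s h (-x) = parA τ h.dual * ((1 - (parA τ h)⁻¹ * qpow τ x) *
      (1 - (parB τ h)⁻¹ * qpow τ x) * (1 - (parC τ s h)⁻¹ * qpow τ x) *
      (1 - (parD τ s h)⁻¹ * qpow τ x)) /
      ((1 - qpow τ x ^ 2) * (1 - (qpow τ s)⁻¹ * qpow τ x ^ 2)) := by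
  have hrel := parA_mul_parB_mul_parC_mul_parD τ s h
  have ha := parA_ne_zero τ h
  have hb := parB_ne_zero τ h
  have hc := parC_ne_zero τ s h
  have hd := parD_ne_zero τ s h
  have ht := parA_ne_zero τ h.dual
  have hX := qpow_ne_zero τ x
  have hp := qpow_ne_zero τ s
  rw [qpow_two_mul, qpow_neg] at h1
  rw [qpow_add, qpow_two_mul, qpow_neg] at h2
  rw [coeffA_eq, qpow_neg]
  generalize parA τ h = a at *
  generalize parB τ h = b at *
  generalize parC τ s h = c at *
  generalize parD τ s h = d at *
  generalize parA τ h.dual = t at *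
  generalize qpow τ x = X at *
  generalize qpow τ s = p at *
  have n1 : 1 - X⁻¹ ^ 2 ≠ 0 := sub_ne_zero.2 h1.symm
  have n2 : 1 - p * X⁻¹ ^ 2 ≠ 0 := sub_ne_zero.2 h2.symm
  have n3 : 1 - X ^ 2 ≠ 0 := fun h0 => n1 (by
    rw [inv_pow, ← sub_eq_zero.1 h0]; simp)
  have n4 : 1 - p⁻¹ * X ^ 2 ≠ 0 := fun h0 => n2 (by
    have : X ^ 2 = p := by field_simp at h0; linear_combination -h0
    rw [inv_pow, this]; field_simp; ring)
  rw [div_eq_div_iff (mul_ne_zero ht (mul_ne_zero n1 n2)) (mul_ne_zero n3 n4)]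
  have e1 : (1 - a * X⁻¹) * (1 - b * X⁻¹) * (1 - c * X⁻¹) * (1 - d * X⁻¹) =
      (a * b * c * d) * X⁻¹ ^ 4 *
        ((1 - a⁻¹ * X) * (1 - b⁻¹ * X) * (1 - c⁻¹ * X) * (1 - d⁻¹ * X)) := by
    field_simp
    ring
  rw [e1, hrel]
  generalize (1 - a⁻¹ * X) * (1 - b⁻¹ * X) * (1 - c⁻¹ * X) * (1 - d⁻¹ * X) = E
  field_simp
  ring

/-- The left-hand side of the gauged equation. -/
noncomputable def gaugedLHS (τ : ℂ) (s : ℝ) (h : HeckeParams) (Γ : ℕ → ℂ → ℂ) (x z : ℂ) : ℂ :=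
  qpow τ z * (gaugedData τ s h).Q.eval (qpow τ x) * seriesPsi τ Γ (x + s) z +
    (qpow τ z)⁻¹ * (1 - qpow τ s * qpow τ x ^ 2) * seriesPsi τ Γ (x - s) z +
    ((gaugedData τ s h).mid (qpow τ z)).eval (qpow τ x) * seriesPsi τ Γ x z

/-- The shifts `x ± s` multiply `W` by `(tZ)^{±1}`. The ratio `St(x)/St(x+s)` supplies the factors
`1 - pX/a` of `Q`, and `St(x)/St(x-s)` cancels the numerator of `A(-x)`, so only `Z⁻¹(1 - pX²)`
remains in front of `Ψ(x-s)`. -/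
theorem eigen_eq_gaugedLHS {τ : ℂ} {s : ℝ} (hs : s ≠ 0) (hp1 : ‖qpow τ s‖ < 1) (h : HeckeParams)
    (Γ : ℕ → ℂ → ℂ) {x z : ℂ} (hreg : RegularPoint τ s h x z) :
    ∃ k : ℂ, k ≠ 0 ∧ opD τ s h (fun y => seriesPhi τ s h Γ y z) x +
      (-qpow τ z - qpow τ (-z) + parA τ h.dual + (parA τ h.dual)⁻¹) *
        seriesPhi τ s h Γ x z = k * gaugedLHS τ s h Γ x z := by
  obtain ⟨r1, r2, r3, r4, r5, r6, r7, r8⟩ := hreg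
  have hW : gaugeW τ s h x z ≠ 0 := qpow_ne_zero _ _
  have ht := parA_ne_zero τ h.dual
  have hX := qpow_ne_zero τ x
  have hZ := qpow_ne_zero τ z
  have hp := qpow_ne_zero τ s
  have hSt := St_eq τ hp1 h x
  have hSts := St_sub_eq τ hp1 h x
  have n1 : 1 - qpow τ x ^ 2 ≠ 0 := by
    rw [qpow_two_mul] at r1; exact sub_ne_zero.2 r1.symm
  have n2 : 1 - qpow τ s * qpow τ x ^ 2 ≠ 0 := by
    rw [qpow_add, qpow_two_mul] at r2; exact sub_ne_zero.2 r2.symm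
  have n3 : 1 - (qpow τ s)⁻¹ * qpow τ x ^ 2 ≠ 0 := fun h0 => r4 (by
    have : qpow τ x ^ 2 = qpow τ s := by field_simp at h0; linear_combination -h0
    rw [qpow_add, qpow_two_mul, qpow_neg, inv_pow, this]; field_simp)
  -- The gauge factor at `(x,z)` divided by the common denominator of `A(x)` and `A(-x)`; it is
  -- nonzero at regular points.
  refine ⟨gaugeW τ s h x z / (St τ s h x * St τ s h.dual z) /
    ((1 - qpow τ x ^ 2) * (1 - qpow τ s * qpow τ x ^ 2) * (1 - (qpow τ s)⁻¹ * qpow τ x ^ 2)),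
    ?_, ?_⟩
  · exact div_ne_zero (div_ne_zero hW (mul_ne_zero r5 r8)) (mul_ne_zero (mul_ne_zero n1 n2) n3)
  rw [opD, coeffA_eq, coeffA_neg_eq τ s h x r3 r4]
  simp only [seriesPhi, gaugedLHS, gaugedData, eval_awData_Q, eval_awData_mid]
  rw [gaugeW_add τ hs, gaugeW_sub τ hs, qpow_neg τ z]
  generalize (1 - qpow τ s / parA τ h * qpow τ x) * (1 - qpow τ s / parB τ h * qpow τ x) *
      (1 - qpow τ s / parC τ s h * qpow τ x) * (1 - qpow τ s / parD τ s h * qpow τ x) = E₁ at *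
  generalize (1 - (parA τ h)⁻¹ * qpow τ x) * (1 - (parB τ h)⁻¹ * qpow τ x) *
      (1 - (parC τ s h)⁻¹ * qpow τ x) * (1 - (parD τ s h)⁻¹ * qpow τ x) = E₂ at *
  generalize (1 - parA τ h * qpow τ x) * (1 - parB τ h * qpow τ x) *
      (1 - parC τ s h * qpow τ x) * (1 - parD τ s h * qpow τ x) = E₃ at *
  have hE₂ : E₂ ≠ 0 := fun h0 => r7 (by rw [hSts, h0, zero_mul])
  have hE₁ : E₁ ≠ 0 := fun h0 => r5 (by rw [hSt, h0, zero_mul])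
  rw [hSts, hSt]
  generalize St τ s h (x + s) = σ at *
  generalize St τ s h.dual z = σ' at *
  generalize gaugeW τ s h x z = W at *
  generalize seriesPsi τ Γ (x + s) z = ψ₁
  generalize seriesPsi τ Γ (x - s) z = ψ₂
  generalize seriesPsi τ Γ x z = ψ
  generalize parA τ h.dual = t at *
  generalize qpow τ x = X at *
  generalize qpow τ z = Z at *
  generalize qpow τ s = p at *
  generalize 1 - p⁻¹ * X ^ 2 = A₃ at *
  generalize 1 - p * X ^ 2 = A₂ at *
  generalize 1 - X ^ 2 = A₁ at *
  field_simp
  ring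

end AskeyWilson

/-! ### Existence and uniqueness of the asymptotic solution -/

namespace AskeyWilson

open Filter Topology Polynomial

/-- Entire functions form an integral domain. This removes exceptional values of `z`: zeros of
`St^d`, and resonances. -/
theorem eq_zero_of_mul_eq_zero_of_differentiable {f g : ℂ → ℂ} (hf : Differentiable ℂ f)
    (hg : Differentiable ℂ g) (hfg : ∀ z, f z * g z = 0) {z₀ : ℂ} (h0 : f z₀ ≠ 0) (z : ℂ) :
    g z = 0 := by
  have := AnalyticOnNhd.eq_zero_or_eq_zero_of_mul_eq_zero
    (hf.differentiableOn.analyticOnNhd isOpen_univ) (hg.differentiableOn.analyticOnNhd isOpen_univ)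
    (fun z _ => hfg z) isPreconnected_univ
  exact this.resolve_left (fun h => h0 (h z₀ trivial)) z trivial

theorem differentiable_tsum_of_normallyConvergent {F : ℕ → ℂ × ℂ → ℂ}
    (hF : ∀ r, Differentiable ℂ (F r)) (hn : NormallyConvergentOnCompacta F) :
    Differentiable ℂ fun P => ∑' r, F r P := by
  intro P
  obtain ⟨u, hu, hb⟩ := hn (Metric.closedBall P 2) (isCompact_closedBall P 2)
  have hmem : ∀ Q ∈ Metric.ball P 1, Metric.ball Q 1 ⊆ Metric.closedBall P 2 := by
    intro Q hQ R hR
    have h1 := Metric.mem_ball.1 hQ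
    have h2 := Metric.mem_ball.1 hR
    have h3 := dist_triangle R Q P
    rw [Metric.mem_closedBall]
    linarith
  refine (hasFDerivAt_tsum_of_isPreconnected (u := fun r => u r + u r) (f := F)
    (f' := fun r Q => fderiv ℂ (F r) Q) (s := Metric.ball P 1) (x₀ := P) (hu.add hu)
    Metric.isOpen_ball (convex_ball P 1).isPreconnected (fun r Q _ => (hF r Q).hasFDerivAt) ?_
    (Metric.mem_ball_self one_pos) ?_ (Metric.mem_ball_self one_pos)).differentiableAt
  · intro r Q hQ
    -- Schwarz-type estimate on unit balls: the variation of `F r` around `Q` is at most `2 u r`, so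
    -- the derivatives are summably bounded as well.
    have := Complex.norm_fderiv_le_div_of_mapsTo_ball (f := F r) (c := Q) (R₁ := 1)
      (R₂ := u r + u r) (hF r).differentiableOn (fun R hR => ?_) one_pos
    · simpa using this
    · rw [mem_closedBall_iff_norm]
      exact (norm_sub_le _ _).trans (add_le_add (hb r R (hmem Q hQ hR))
        (hb r Q (hmem Q hQ (Metric.mem_ball_self one_pos))))
  · exact Summable.of_norm_bounded hu fun r => hb r P (Metric.mem_closedBall_self (by norm_num))

/-- Apart from `y^r`, the summand converges as `r → ∞` to a finite quotient of infinite products and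
is therefore bounded. -/
theorem summable_W87Term {α : Fin 6 → ℂ} {p y : ℂ} (hp : ‖p‖ < 1) (hy : ‖y‖ < 1)
    (hα : W87Defined α p) : Summable (W87Term α p y) := by
  have hne : ∀ (j : Fin 6) (i : ℕ), 1 - p * α 0 / α j * p ^ i ≠ 0 := fun j i h0 =>
    hα.2 j (i + 1) (by rw [qPoch_succ, h0, mul_zero])
  have hlim : Tendsto (fun r : ℕ => (1 - α 0 * p ^ (2 * r)) / (1 - α 0) *
      ∏ j : Fin 6, qPoch (α j) p r / qPoch (p * α 0 / α j) p r) atTop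
      (𝓝 ((1 - α 0 * 0) / (1 - α 0) *
        ∏ j : Fin 6, qPochInf (α j) p / qPochInf (p * α 0 / α j) p)) := by
    have hpow : Tendsto (fun r : ℕ => p ^ (2 * r)) atTop (𝓝 0) :=
      (tendsto_pow_atTop_nhds_zero_of_norm_lt_one hp).comp
        (tendsto_id.const_mul_atTop' (by norm_num : 0 < 2))
    exact (((hpow.const_mul (α 0)).const_sub 1).div_const _).mul
      (tendsto_finsetProd _ fun j _ =>
        (tendsto_qPoch _ hp).div (tendsto_qPoch _ hp) (qPochInf_ne_zero hp (hne j)))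
  obtain ⟨C, hC⟩ := (Metric.isBounded_range_of_tendsto _ hlim).exists_norm_le
  refine Summable.of_norm_bounded (g := fun r => ‖y‖ ^ r * C)
    ((summable_geometric_of_lt_one (norm_nonneg y) hy).mul_right C) fun r => ?_
  have e : W87Term α p y r = y ^ r * ((1 - α 0 * p ^ (2 * r)) / (1 - α 0) *
      ∏ j : Fin 6, qPoch (α j) p r / qPoch (p * α 0 / α j) p r) := by
    rw [W87Term]; ring
  rw [e, norm_mul, norm_pow]
  gcongr
  exact hC _ (Set.mem_range_self r)

theorem seriesPsi_eq (τ : ℂ) (Γ : ℕ → ℂ → ℂ) (x z : ℂ) :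
    seriesPsi τ Γ x z = ∑' r, Γ r z * qpow τ x ^ r := by
  simp [seriesPsi, qpow_nat_mul]

theorem summable_of_normallyConvergent {τ : ℂ} {Γ : ℕ → ℂ → ℂ}
    (hn : NormallyConvergentOnCompacta fun r P => Γ r P.2 * qpow τ (r * P.1)) (x z : ℂ) :
    Summable fun r => Γ r z * qpow τ x ^ r := by
  obtain ⟨u, hu, hb⟩ := hn {(x, z)} isCompact_singleton
  refine Summable.of_norm_bounded hu fun r => ?_
  have := hb r (x, z) rfl
  beta_reduce at this
  rwa [qpow_nat_mul] at this

theorem hasEval_gaugedLHS {τ : ℂ} {s : ℝ} {h : HeckeParams} {Γ : ℕ → ℂ → ℂ}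
    (hn : NormallyConvergentOnCompacta fun r P => Γ r P.2 * qpow τ (r * P.1)) (x z : ℂ) :
    HasEval ((gaugedData τ s h).op (qpow τ z) (PowerSeries.mk fun r => Γ r z)) (qpow τ x)
      (gaugedLHS τ s h Γ x z) := by
  have hs : ∀ y, HasEval (PowerSeries.mk fun r => Γ r z) (qpow τ y) (seriesPsi τ Γ y z) := by
    intro y
    rw [HasEval, seriesPsi_eq]
    simpa using (summable_of_normallyConvergent hn y z).hasSum
  have e1 : qpow τ s * qpow τ x = qpow τ (x + s) := by rw [qpow_add, mul_comm]
  have e2 : (qpow τ s)⁻¹ * qpow τ x = qpow τ (x - s) := by rw [qpow_sub, div_eq_inv_mul]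
  have := ((hasEval_rescale.2 (e1 ▸ hs (x + s))).polynomial_mul
      (C (qpow τ z) * (gaugedData τ s h).Q)).add
    ((hasEval_rescale.2 (e2 ▸ hs (x - s))).polynomial_mul
      (C (qpow τ z)⁻¹ * (1 - C (qpow τ s) * X ^ 2))) |>.add
    ((hs x).polynomial_mul ((gaugedData τ s h).mid (qpow τ z)))
  simpa only [gaugedLHS, eval_mul, eval_C, eval_sub, eval_one, eval_pow, eval_X] using! this

theorem differentiable_St {τ : ℂ} {s : ℝ} (hp : ‖qpow τ s‖ < 1) (h : HeckeParams) :
    Differentiable ℂ (St τ s h) := by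
  have key : ∀ e : ℂ, Differentiable ℂ fun x => qPochInf (qpow τ (s + x) / e) (qpow τ s) := by
    intro e
    refine (differentiable_qPochInf hp).comp ?_
    have : Differentiable ℂ fun x => qpow τ (s + x) :=
      (differentiable_qpow τ).comp (by fun_prop)
    simp only [div_eq_mul_inv]
    fun_prop
  exact (((key _).mul (key _)).mul (key _)).mul (key _)

theorem eventually_St_ne_zero {τ : ℂ} {s : ℝ} (hp : ‖qpow τ s‖ < 1) (h : HeckeParams) :
    ∀ᶠ X in 𝓝 (0 : ℂ), ∀ x, qpow τ x = X → St τ s h x ≠ 0 := by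
  have key : ∀ e : ℂ, ∀ᶠ X in 𝓝 (0 : ℂ), ‖qpow τ s * X / e‖ < 1 := by
    intro e
    simp only [div_eq_mul_inv]
    exact ContinuousAt.eventually_lt (by fun_prop) continuousAt_const (by simp)
  filter_upwards [key (parA τ h), key (parB τ h), key (parC τ s h), key (parD τ s h)]
    with X h1 h2 h3 h4 x hx
  subst hx
  simp only [← qpow_add] at h1 h2 h3 h4
  exact mul_ne_zero (mul_ne_zero (mul_ne_zero (qPochInf_ne_zero_of_norm_lt hp h1)
    (qPochInf_ne_zero_of_norm_lt hp h2)) (qPochInf_ne_zero_of_norm_lt hp h3))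
    (qPochInf_ne_zero_of_norm_lt hp h4)

theorem exists_St_ne_zero {τ : ℂ} (hτ : τ ≠ 0) {s : ℝ} (hp : ‖qpow τ s‖ < 1) (h : HeckeParams) :
    ∃ x, St τ s h x ≠ 0 := by
  obtain ⟨X, hX, hX0⟩ := (((eventually_St_ne_zero hp h).filter_mono
    (nhdsWithin_le_nhds (s := {0}ᶜ))).and self_mem_nhdsWithin).exists
  obtain ⟨x, hx⟩ := exists_qpow_eq hτ hX0
  exact ⟨x, hX x hx⟩

/-- All excluded values of `X = q^x` stay away from `0`. The eigenvalue equation is thus available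
on a full punctured neighbourhood, enough to determine a power series. -/
theorem eventually_regularPoint {τ : ℂ} {s : ℝ} (hp : ‖qpow τ s‖ < 1) (h : HeckeParams)
    {z : ℂ} (hz : St τ s h.dual z ≠ 0) :
    ∀ᶠ X in 𝓝 (0 : ℂ), ∀ x, qpow τ x = X → RegularPoint τ s h x z := by
  have hp0 := qpow_ne_zero τ s
  have hc : ∀ c : ℂ, Tendsto (fun X => c * X) (𝓝 0) (𝓝 (0 : ℂ)) := fun c => by
    have : Continuous fun X : ℂ => c * X := by fun_prop
    simpa using this.tendsto 0
  have key : ∀ c d : ℂ, d ≠ 0 → ∀ᶠ X in 𝓝 (0 : ℂ), c * X ^ 2 ≠ d := fun c d hd =>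
    ContinuousAt.eventually_ne (by fun_prop) (by simpa using hd.symm)
  filter_upwards [key 1 1 one_ne_zero, key (qpow τ s) 1 one_ne_zero, key 1 _ hp0,
    eventually_St_ne_zero hp h, (hc (qpow τ s)).eventually (eventually_St_ne_zero hp h),
    (hc (qpow τ s)⁻¹).eventually (eventually_St_ne_zero hp h)] with X k1 k2 k3 s1 s2 s3 x hx
  have hX := qpow_ne_zero τ x
  refine ⟨?_, ?_, ?_, ?_, s1 x hx, s2 _ ?_, s3 _ ?_, hz⟩
  · rw [qpow_two_mul, hx]; simpa using k1
  · rw [qpow_add, qpow_two_mul, hx]; exact k2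
  · rw [qpow_two_mul, qpow_neg, hx, inv_pow]; simpa using k1
  · rw [qpow_add, qpow_two_mul, qpow_neg, hx, inv_pow]
    intro h0
    rw [hx] at hX
    exact k3 (by field_simp at h0; rw [one_mul, h0])
  · rw [qpow_add, hx, mul_comm]
  · rw [qpow_sub, hx, div_eq_inv_mul]

section main

variable {τ : ℂ} {s : ℝ} {h : HeckeParams}

theorem differentiable_low (n m : ℕ) :
    Differentiable ℂ fun z => (gaugedData τ s h).low n m (qpow τ z) := fun z =>
  (((gaugedData τ s h).differentiableOn_low n m).differentiableAt
    (isOpen_compl_singleton.mem_nhds (qpow_ne_zero τ z))).comp z (differentiable_qpow τ z)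

theorem differentiable_G (hp : ‖qpow τ s‖ < 1) (n : ℕ) :
    Differentiable ℂ fun z => (gaugedData τ s h).G n (qpow τ z) := fun z =>
  (((gaugedData τ s h).differentiableOn_G hp n).differentiableAt
    (isOpen_compl_singleton.mem_nhds (qpow_ne_zero τ z))).comp z (differentiable_qpow τ z)

/-- If `St^d(z) ≠ 0`, the gauged equation holds for all small nonzero `X`, so its power series
vanishes. Each coefficient is entire in `z`, and its product with `St^d` is identically zero, which
settles the remaining `z`. -/
theorem IsAsymptoticSolution.op_eq_zero (hτ : τ ≠ 0) (hs : s ≠ 0) (hp : ‖qpow τ s‖ < 1)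
    {Γ : ℕ → ℂ → ℂ} (hΓ : IsAsymptoticSolution τ s h Γ) (z : ℂ) :
    (gaugedData τ s h).op (qpow τ z) (PowerSeries.mk fun r => Γ r z) = 0 := by
  have hreg : ∀ z, St τ s h.dual z ≠ 0 →
      (gaugedData τ s h).op (qpow τ z) (PowerSeries.mk fun r => Γ r z) = 0 := by
    intro z hz
    refine eq_zero_of_eventually_hasEval ?_
    filter_upwards [nhdsWithin_le_nhds (eventually_regularPoint hp h hz), self_mem_nhdsWithin]
      with X hX hX0
    obtain ⟨x, rfl⟩ := exists_qpow_eq hτ hX0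
    have hr := hX x rfl
    obtain ⟨k, hk, e⟩ := eigen_eq_gaugedLHS hs hp h Γ hr
    rw [hΓ.eigen x z hr] at e
    have h0 := (mul_eq_zero.1 e.symm).resolve_left hk
    rw [← h0]
    exact hasEval_gaugedLHS hΓ.normal x z
  ext n
  obtain ⟨z₀, hz₀⟩ := exists_St_ne_zero hτ hp h.dual
  refine eq_zero_of_mul_eq_zero_of_differentiable (f := St τ s h.dual)
    (g := fun z => PowerSeries.coeff n
      ((gaugedData τ s h).op (qpow τ z) (PowerSeries.mk fun r => Γ r z)))
    (differentiable_St hp h.dual) ?_ (fun z => ?_) hz₀ z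
  · have e : (fun z => PowerSeries.coeff n
        ((gaugedData τ s h).op (qpow τ z) (PowerSeries.mk fun r => Γ r z))) = fun z =>
        qpow τ (-z) * (qpow τ s)⁻¹ ^ n * (1 - qpow τ s ^ n) * (1 - qpow τ s ^ n * qpow τ z ^ 2) *
          Γ n z + ∑ m ∈ Finset.range n, (gaugedData τ s h).low n m (qpow τ z) * Γ m z := by
      funext z
      rw [GaugedData.coeff_op _ (qpow_ne_zero τ s) (qpow_ne_zero τ z), qpow_neg]
      simp
    rw [e]
    have d1 := differentiable_qpow τ
    have d2 : Differentiable ℂ fun z => qpow τ (-z) := d1.comp differentiable_neg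
    have d3 := hΓ.holomorphic n
    have d4 : Differentiable ℂ fun z =>
        ∑ m ∈ Finset.range n, (gaugedData τ s h).low n m (qpow τ z) * Γ m z :=
      Differentiable.fun_sum fun m _ => (differentiable_low n m).mul (hΓ.holomorphic m)
    fun_prop
  · by_cases hz : St τ s h.dual z = 0
    · rw [hz, zero_mul]
    · simp only [hreg z hz, map_zero, mul_zero]

/-- At step `n` the difference of the two coefficients is killed by `1 - pⁿZ²`, a nonzero entire
function of `z`; holomorphy of `Γ_n` gives equality at resonant `z` too. -/
theorem IsAsymptoticSolution.eq_G (hτ : τ ≠ 0) (hs : s ≠ 0) (hp : ‖qpow τ s‖ < 1)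
    {Γ : ℕ → ℂ → ℂ} (hΓ : IsAsymptoticSolution τ s h Γ) (r : ℕ) (z : ℂ) :
    Γ r z = (gaugedData τ s h).G r (qpow τ z) := by
  induction r using Nat.strong_induction_on generalizing z with
  | _ n ih =>
    rcases Nat.eq_zero_or_pos n with rfl | hn
    · rw [hΓ.initial, GaugedData.G_zero, qpow_add, qpow_two_mul]
    have hp0 := qpow_ne_zero τ s
    have hpn : 1 - qpow τ s ^ n ≠ 0 := by
      have := one_sub_mul_pow_ne_zero hp hp (n - 1)
      rwa [← pow_succ', Nat.sub_add_cancel hn] at this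
    rw [← sub_eq_zero]
    refine eq_zero_of_mul_eq_zero_of_differentiable
      (f := fun z => 1 - qpow τ s ^ n * qpow τ z ^ 2)
      (g := fun z => Γ n z - (gaugedData τ s h).G n (qpow τ z)) (z₀ := 0) ?_
      ((hΓ.holomorphic n).sub (differentiable_G hp n)) (fun z => ?_)
      (by simpa [qpow_zero] using hpn) z
    · have := differentiable_qpow τ
      fun_prop
    · have hZ := qpow_ne_zero τ z
      have e1 := GaugedData.coeff_op (gaugedData τ s h) hp0 hZ (PowerSeries.mk fun r => Γ r z) n
      have e2 := GaugedData.coeff_op (gaugedData τ s h) hp0 hZ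
        (PowerSeries.mk fun r => (gaugedData τ s h).G r (qpow τ z)) n
      rw [hΓ.op_eq_zero hτ hs hp] at e1
      rw [GaugedData.op_G _ hp0 hp hZ] at e2
      simp only [PowerSeries.coeff_mk] at e1 e2
      have e3 : ∑ m ∈ Finset.range n, (gaugedData τ s h).low n m (qpow τ z) * Γ m z =
          ∑ m ∈ Finset.range n, (gaugedData τ s h).low n m (qpow τ z) *
            (gaugedData τ s h).G m (qpow τ z) :=
        Finset.sum_congr rfl fun m hm => by rw [ih m (Finset.mem_range.1 hm)]
      rw [e3] at e1
      have e4 := add_right_cancel (e1.symm.trans e2)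
      have hc : (qpow τ z)⁻¹ * (qpow τ s)⁻¹ ^ n * (1 - qpow τ s ^ n) ≠ 0 := by positivity
      refine (mul_eq_zero.1 (?_ : ((qpow τ z)⁻¹ * (qpow τ s)⁻¹ ^ n * (1 - qpow τ s ^ n)) *
        ((1 - qpow τ s ^ n * qpow τ z ^ 2) * (Γ n z - (gaugedData τ s h).G n (qpow τ z))) = 0)
        ).resolve_left hc
      linear_combination e4

theorem normallyConvergent_G (hp : ‖qpow τ s‖ < 1) : NormallyConvergentOnCompacta
    fun r P => (gaugedData τ s h).G r (qpow τ P.2) * qpow τ (r * P.1) := by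
  intro K hK
  have hq := (differentiable_qpow τ).continuous
  obtain ⟨R, hR⟩ := hK.exists_bound_of_continuousOn (f := fun P : ℂ × ℂ => qpow τ P.1)
    (hq.comp continuous_fst).continuousOn
  have hK' : IsCompact ((fun P : ℂ × ℂ => qpow τ P.2) '' K) :=
    hK.image (hq.comp continuous_snd)
  obtain ⟨A, hA⟩ := (gaugedData τ s h).exists_entire_bound (qpow_ne_zero τ s) hp hK'
    -- The bound is taken at twice the largest `|q^x|`, which leaves the geometric factor `(1/2)^r`
    -- for the majorant.
    (by rintro _ ⟨P, _, rfl⟩; exact qpow_ne_zero τ P.2) (R := 2 * |R|) (by positivity)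
  refine ⟨fun r => A * (1 / 2) ^ r, summable_geometric_two.mul_left A, fun r P hP => ?_⟩
  have h1 := hA _ ⟨P, hP, rfl⟩ r
  have h2 := (hR P hP).trans (le_abs_self R)
  beta_reduce
  rw [qpow_nat_mul, norm_mul, norm_pow]
  calc ‖(gaugedData τ s h).G r (qpow τ P.2)‖ * ‖qpow τ P.1‖ ^ r ≤
        ‖(gaugedData τ s h).G r (qpow τ P.2)‖ * |R| ^ r := by gcongr
    _ = ‖(gaugedData τ s h).G r (qpow τ P.2)‖ * (2 * |R|) ^ r * (1 / 2) ^ r := by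
        rw [mul_assoc, ← mul_pow]; congr 2; ring
    _ ≤ A * (1 / 2) ^ r := by gcongr

theorem isAsymptoticSolution_G (hs : s ≠ 0) (hp : ‖qpow τ s‖ < 1) :
    IsAsymptoticSolution τ s h fun r z => (gaugedData τ s h).G r (qpow τ z) where
  holomorphic := differentiable_G hp
  initial z := by rw [GaugedData.G_zero, qpow_add, qpow_two_mul]
  normal := normallyConvergent_G hp
  eigen x z hreg := by
    obtain ⟨k, _, e⟩ := eigen_eq_gaugedLHS hs hp h
      (fun r z => (gaugedData τ s h).G r (qpow τ z)) hreg
    rw [e]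
    have := hasEval_gaugedLHS (s := s) (h := h)
      (Γ := fun r z => (gaugedData τ s h).G r (qpow τ z)) (normallyConvergent_G (h := h) hp) x z
    rw [GaugedData.op_G _ (qpow_ne_zero τ s) hp (qpow_ne_zero τ z)] at this
    have h0 : HasEval 0 (qpow τ x) 0 := by simp [HasEval]
    rw [this.unique h0, mul_zero]

end main

end AskeyWilson

/-! ### The `₈W₇` formula -/

namespace AskeyWilson

open Filter Topology Polynomial

section

variable {τ : ℂ} {s : ℝ} {h : HeckeParams}

/-- With `d` and the dual parameters eliminated through `abcd = p t²`, four of the parameters become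
`u_j Z`, the form in which the telescoping was proved; the leading and the last one are `wXZ²` and
`wX`. -/
theorem psiParams_eq (x z : ℂ) :
    let a := parA τ h; let b := parB τ h; let c := parC τ s h; let t := parA τ h.dual
    let p := qpow τ s; let X := qpow τ x; let Z := qpow τ z; let w := a * b * c / t ^ 2
    psiParams τ s h x z = ![w * X * Z ^ 2, seriesU p a b c t 0 * Z, seriesU p a b c t 1 * Z,
      seriesU p a b c t 2 * Z, seriesU p a b c t 3 * Z, w * X] := by
  intro a b c t p X Z w
  have ha : a ≠ 0 := parA_ne_zero τ h
  have hb : b ≠ 0 := parB_ne_zero τ h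
  have hc : c ≠ 0 := parC_ne_zero τ s h
  have hd := parD_ne_zero τ s h
  have ht : t ≠ 0 := parA_ne_zero τ h.dual
  have hp : p ≠ 0 := qpow_ne_zero τ s
  have hrel : a * b * c * parD τ s h = p * t ^ 2 := parA_mul_parB_mul_parC_mul_parD τ s h
  have hd' : parD τ s h = p * t ^ 2 / (a * b * c) := by
    rw [← hrel]; field_simp
  rw [psiParams, parB_dual, parC_dual, parD_dual]
  simp only [qpow_add, qpow_two_mul]
  change ![p * X * Z ^ 2 / parD τ s h, p * Z / t, p * Z / (a * parD τ s h / t), a * b / t * Z,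
    a * c / t * Z, p * X / parD τ s h] = ![w * X * Z ^ 2, p / t * Z, b * c / t * Z, a * b / t * Z,
    a * c / t * Z, w * X]
  have e1 : p / parD τ s h = w := by
    rw [hd']; simp only [w]; field_simp
  have e2 : p * Z / (a * parD τ s h / t) = b * c / t * Z := by rw [hd']; field_simp
  rw [e2, ← e1]
  ring_nf

theorem parD_eq : parD τ s h = qpow τ s / (parA τ h * parB τ h * parC τ s h / parA τ h.dual ^ 2) := by
  have ha := parA_ne_zero τ h
  have hb := parB_ne_zero τ h
  have hc := parC_ne_zero τ s h
  have ht := parA_ne_zero τ h.dual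
  have hrel := parA_mul_parB_mul_parC_mul_parD τ s h
  field_simp
  linear_combination hrel

/-- Very-well-poised terms with the infinite products of their denominators absorbed. -/
theorem qPochInf_mul_W87Term_cons {p : ℂ} (hp1 : ‖p‖ < 1) (hp : p ≠ 0) {w X Z : ℂ} (hw : w ≠ 0)
    (hX : X ≠ 0) (hZ : Z ≠ 0) (u : Fin 4 → ℂ)
    (hden : qPochInf (w * X * Z ^ 2 * p) p ≠ 0)
    (hdef : W87Defined ![w * X * Z ^ 2, u 0 * Z, u 1 * Z, u 2 * Z, u 3 * Z, w * X] p) (r : ℕ) :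
    qPochInf (w * X * Z ^ 2) p * (qPochInf (p * (w * X * Z) / u 1) p *
      qPochInf (p * (w * X * Z) / u 3) p * qPochInf (p * (w * X * Z) / u 2) p *
      qPochInf (p * (w * X * Z) / u 0) p * qPochInf (p * Z ^ 2) p * qPochInf (p * X / w) p /
      qPochInf (w * X * Z ^ 2 * p) p *
      W87Term ![w * X * Z ^ 2, u 0 * Z, u 1 * Z, u 2 * Z, u 3 * Z, w * X] p (p * X / w) r) =
    regTerm u p w Z X r := by
  obtain ⟨h0, hq⟩ := hdef
  simp only [Matrix.cons_val_zero] at h0 hq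
  have q1 := hq 1 r
  have q2 := hq 2 r
  have q3 := hq 3 r
  have q4 := hq 4 r
  have q5 := hq 5 r
  have hpp : qPoch p p r ≠ 0 := qPoch_ne_zero (one_sub_mul_pow_ne_zero hp1 hp1) r
  simp only [Matrix.cons_val] at q1 q2 q3 q4 q5
  have f0 : p * (w * X * Z ^ 2) / (w * X * Z ^ 2) = p := by field_simp
  have f5 : p * (w * X * Z ^ 2) / (w * X) = p * Z ^ 2 := by field_simp
  have fj : ∀ v : ℂ, p * (w * X * Z ^ 2) / (v * Z) = p * (w * X * Z) / v := fun v => by field_simp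
  rw [fj] at q1 q2 q3 q4
  rw [f5] at q5
  have split : ∀ c : ℂ, qPochInf (p * c) p = qPoch (p * c) p r * qPochInf (p ^ (r + 1) * c) p :=
    fun c => by rw [qPochInf_eq_qPoch_mul _ hp1 r]; ring_nf
  have split' : ∀ c v : ℂ, qPochInf (p * c / v) p =
      qPoch (p * c / v) p r * qPochInf (p ^ (r + 1) * c / v) p := fun c v => by
    rw [mul_div_assoc, mul_div_assoc, split]
  -- The factor `(wXZ²;p)_∞` cancels both `1 - α₀` and the denominator of the prefactor. Each
  -- numerator product is split at index `r`, its finite part cancelling a denominator of the term.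
  rw [qPochInf_eq_one_sub_mul (w * X * Z ^ 2) hp1, split' _ (u 0), split' _ (u 1), split' _ (u 2),
    split' _ (u 3), split (Z ^ 2), W87Term, regTerm]
  simp only [Fin.prod_univ_six, Fin.prod_univ_four, Matrix.cons_val]
  rw [f0, f5, fj, fj, fj, fj, mul_comm 2 r, pow_mul]
  generalize qPoch (p * (w * X * Z) / u 0) p r = Q0 at *
  generalize qPoch (p * (w * X * Z) / u 1) p r = Q1 at *
  generalize qPoch (p * (w * X * Z) / u 2) p r = Q2 at *
  generalize qPoch (p * (w * X * Z) / u 3) p r = Q3 at *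
  generalize qPoch (p * Z ^ 2) p r = Q4 at *
  generalize qPochInf (w * X * Z ^ 2 * p) p = Q6 at *
  generalize 1 - w * X * Z ^ 2 = Q7 at *
  generalize 1 - w * X * Z ^ 2 * (p ^ r) ^ 2 = Q8 at *
  generalize (p * X / w) ^ r = Q9 at *
  -- The pairs to be cancelled are isolated in an intermediate expression, so that what remains is a
  -- ring identity with inverses as atoms.
  refine Eq.trans (b := Q0 * Q0⁻¹ * (Q1 * Q1⁻¹) * (Q2 * Q2⁻¹) * (Q3 * Q3⁻¹) * (Q4 * Q4⁻¹) *
    (Q6 * Q6⁻¹) * (Q7 * Q7⁻¹) * _) ?_ (by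
      rw [mul_inv_cancel₀ q1, mul_inv_cancel₀ q2, mul_inv_cancel₀ q3, mul_inv_cancel₀ q4,
        mul_inv_cancel₀ q5, mul_inv_cancel₀ hden, mul_inv_cancel₀ h0]
      simp only [one_mul]
      rfl)
  simp only [div_eq_mul_inv]
  ring

/-- Each term of the prefactored series is the corresponding term of the regularized series. -/
theorem qPochInf_mul_W87Term (hp1 : ‖qpow τ s‖ < 1) (x z : ℂ)
    (hden : qPochInf (qpow τ (2 * s + x + 2 * z) / parD τ s h) (qpow τ s) ≠ 0)
    (hdef : W87Defined (psiParams τ s h x z) (qpow τ s)) (r : ℕ) :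
    let w := parA τ h * parB τ h * parC τ s h / parA τ h.dual ^ 2
    qPochInf (w * qpow τ x * qpow τ z ^ 2) (qpow τ s) * (psiPrefactor τ s h x z *
      W87Term (psiParams τ s h x z) (qpow τ s) (parD τ s h * qpow τ x) r) =
      regTerm (seriesU (qpow τ s) (parA τ h) (parB τ h) (parC τ s h) (parA τ h.dual)) (qpow τ s) w
        (qpow τ z) (qpow τ x) r := by
  intro w
  have ha := parA_ne_zero τ h
  have hb := parB_ne_zero τ h
  have hc := parC_ne_zero τ s h
  have ht := parA_ne_zero τ h.dual
  have hp := qpow_ne_zero τ s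
  have hX := qpow_ne_zero τ x
  have hZ := qpow_ne_zero τ z
  have hd : parD τ s h = qpow τ s / w := parD_eq
  have hw : w ≠ 0 := by simp only [w]; positivity
  have hpar := psiParams_eq (τ := τ) (s := s) (h := h) x z
  dsimp only at hpar
  have e2 : qpow τ (2 * s + x + 2 * z) / parD τ s h = w * qpow τ x * qpow τ z ^ 2 * qpow τ s := by
    rw [hd, qpow_add, qpow_add, qpow_two_mul, qpow_two_mul]
    field_simp
  have e3 : parD τ s h * qpow τ x = qpow τ s * qpow τ x / w := by rw [hd]; ring
  have e4 : qpow τ (s + 2 * z) = qpow τ s * qpow τ z ^ 2 := by rw [qpow_add, qpow_two_mul]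
  have e5 : qpow τ (s + x + z) = qpow τ s * qpow τ x * qpow τ z := by rw [qpow_add, qpow_add]
  rw [e2] at hden
  rw [hpar] at hdef
  rw [← qPochInf_mul_W87Term_cons hp1 hp hw hX hZ _ hden hdef r, psiPrefactor, hpar, e2, e3, e4, e5,
    hd]
  have g1 : qpow τ s * qpow τ x * qpow τ z * parA τ h / parA τ h.dual =
      qpow τ s * (w * qpow τ x * qpow τ z) / (parB τ h * parC τ s h / parA τ h.dual) := by
    simp only [w]; field_simp
  have g2 : qpow τ s * qpow τ x * qpow τ z * parB τ h / parA τ h.dual =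
      qpow τ s * (w * qpow τ x * qpow τ z) / (parA τ h * parC τ s h / parA τ h.dual) := by
    simp only [w]; field_simp
  have g3 : qpow τ s * qpow τ x * qpow τ z * parC τ s h / parA τ h.dual =
      qpow τ s * (w * qpow τ x * qpow τ z) / (parA τ h * parB τ h / parA τ h.dual) := by
    simp only [w]; field_simp
  have g4 : qpow τ s * qpow τ x * qpow τ z * parA τ h.dual / (qpow τ s / w) =
      qpow τ s * (w * qpow τ x * qpow τ z) / (qpow τ s / parA τ h.dual) := by
    field_simp
  rw [g1, g2, g3, g4]
  rfl

theorem seriesPsi_eq_psiPrefactor_mul_W87 (hp1 : ‖qpow τ s‖ < 1) {x z : ℂ}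
    (hy : ‖parD τ s h * qpow τ x‖ < 1)
    (hden : qPochInf (qpow τ (2 * s + x + 2 * z) / parD τ s h) (qpow τ s) ≠ 0)
    (hdef : W87Defined (psiParams τ s h x z) (qpow τ s)) :
    seriesPsi τ (fun r z => (gaugedData τ s h).G r (qpow τ z)) x z =
      psiPrefactor τ s h x z *
        W87 (psiParams τ s h x z) (qpow τ s) (parD τ s h * qpow τ x) := by
  set w := parA τ h * parB τ h * parC τ s h / parA τ h.dual ^ 2 with hw
  have hd : parD τ s h = qpow τ s / w := parD_eq
  have hp := qpow_ne_zero τ s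
  have hw0 : w ≠ 0 := by
    rintro h0
    rw [h0, div_zero] at hd
    exact parD_ne_zero τ s h hd
  have hpar := psiParams_eq (τ := τ) (s := s) (h := h) x z
  dsimp only at hpar
  rw [← hw] at hpar
  -- The last parameter of the series has denominator `(pα₀/α₅;p)_n = (pZ²;p)_n`; its last factor is
  -- `1 - pⁿZ²`.
  have hres : ∀ n : ℕ, 0 < n → 1 - qpow τ s ^ n * qpow τ z ^ 2 ≠ 0 := by
    intro n hn h0
    have := hdef.2 5 n
    rw [hpar] at this
    simp only [Matrix.cons_val] at this
    have f5 : qpow τ s * (w * qpow τ x * qpow τ z ^ 2) / (w * qpow τ x) =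
        qpow τ s * qpow τ z ^ 2 := by
      have := qpow_ne_zero τ x
      field_simp
    rw [f5, ← Nat.sub_add_cancel hn, qPoch_succ] at this
    refine this (mul_eq_zero_of_right _ ?_)
    rw [← h0]
    conv_rhs => rw [← Nat.sub_add_cancel hn, pow_succ]
    ring
  have key := tsum_G_mul_qPochInf hp1 hp (parA_ne_zero τ h) (parB_ne_zero τ h)
    (parC_ne_zero τ s h) (parD_ne_zero τ s h) (parA_ne_zero τ h.dual)
    (parA_mul_parB_mul_parC_mul_parD τ s h) (qpow_ne_zero τ z) hres (x := qpow τ x)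
    (by rw [← hw, ← hd]; exact hy)
  -- This is `(1 - α₀)(pα₀;p)_∞`, whose two factors are nonzero by definedness of the series and of
  -- the prefactor; it can therefore be cancelled from the regularized identity.
  have hα : qPochInf (w * qpow τ x * qpow τ z ^ 2) (qpow τ s) ≠ 0 := by
    rw [qPochInf_eq_one_sub_mul _ hp1]
    refine mul_ne_zero ?_ ?_
    · have := hdef.1
      rwa [hpar] at this
    · convert hden using 2
      rw [qpow_add, qpow_add, qpow_two_mul, qpow_two_mul, hd]
      field_simp
  refine mul_right_cancel₀ hα ?_
  rw [seriesPsi_eq]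
  refine Eq.trans key ?_
  rw [regSum, W87, mul_comm _ (qPochInf _ _), ← tsum_mul_left, ← tsum_mul_left]
  exact tsum_congr fun r => (qPochInf_mul_W87Term hp1 x z hden hdef r).symm

end

end AskeyWilson

/-! ### Assembly of the main theorem -/

theorem mainTheorem9 (τ : ℂ) (hτ_re : τ.re = 0) (hτ_im : 0 < τ.im) (s : ℚ) (hs : 0 < s)
    (h : AskeyWilson.HeckeParams) :
    (∃! Γ : ℕ → ℂ → ℂ, AskeyWilson.IsAsymptoticSolution τ (s : ℝ) h Γ) ∧
    ∀ Γ : ℕ → ℂ → ℂ, AskeyWilson.IsAsymptoticSolution τ (s : ℝ) h Γ →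
      Differentiable ℂ (fun p : ℂ × ℂ => AskeyWilson.seriesPsi τ Γ p.1 p.2) ∧
      (∀ (r : ℕ) (z : ℂ), Γ r (z + τ⁻¹) = Γ r z) ∧
      ∀ x z : ℂ,
        ‖AskeyWilson.parD τ (s : ℝ) h * AskeyWilson.qpow τ x‖ < 1 →
        AskeyWilson.qPochInf
            (AskeyWilson.qpow τ (2 * ((s : ℝ) : ℂ) + x + 2 * z) / AskeyWilson.parD τ (s : ℝ) h)
            (AskeyWilson.qpow τ ((s : ℝ) : ℂ)) ≠ 0 →
        AskeyWilson.W87Defined (AskeyWilson.psiParams τ (s : ℝ) h x z)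
            (AskeyWilson.qpow τ ((s : ℝ) : ℂ)) →
        Summable (AskeyWilson.W87Term (AskeyWilson.psiParams τ (s : ℝ) h x z)
            (AskeyWilson.qpow τ ((s : ℝ) : ℂ))
            (AskeyWilson.parD τ (s : ℝ) h * AskeyWilson.qpow τ x)) ∧
        AskeyWilson.seriesPsi τ Γ x z =
          AskeyWilson.psiPrefactor τ (s : ℝ) h x z *
            AskeyWilson.W87 (AskeyWilson.psiParams τ (s : ℝ) h x z)
              (AskeyWilson.qpow τ ((s : ℝ) : ℂ))
              (AskeyWilson.parD τ (s : ℝ) h * AskeyWilson.qpow τ x) := by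
  have hs' : (0 : ℝ) < (s : ℝ) := by exact_mod_cast hs
  have hτ : τ ≠ 0 := by rintro rfl; simp at hτ_im
  have hp := AskeyWilson.norm_qpow_lt_one hτ_im hs'
  have hG : ∀ Γ : ℕ → ℂ → ℂ, AskeyWilson.IsAsymptoticSolution τ (s : ℝ) h Γ →
      Γ = fun r z => (AskeyWilson.gaugedData τ (s : ℝ) h).G r (AskeyWilson.qpow τ z) :=
    fun Γ hΓ => funext fun r => funext fun z => hΓ.eq_G hτ hs'.ne' hp r z
  refine ⟨⟨_, AskeyWilson.isAsymptoticSolution_G hs'.ne' hp, hG⟩, fun Γ hΓ => ⟨?_, ?_, ?_⟩⟩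
  · refine AskeyWilson.differentiable_tsum_of_normallyConvergent (fun r => ?_) hΓ.normal
    have h1 := hΓ.holomorphic r
    have h2 := AskeyWilson.differentiable_qpow τ
    fun_prop
  · intro r z
    rw [hG Γ hΓ]
    simp only [AskeyWilson.qpow_add_inv hτ]
  · intro x z hy hden hdef
    refine ⟨AskeyWilson.summable_W87Term hp hy hdef, ?_⟩
    rw [hG Γ hΓ]
    exact AskeyWilson.seriesPsi_eq_psiPrefactor_mul_W87 hp hy hden hdef
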